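/- **Setting.** Let $\Gamma_Y\subset[0,1]^2$ be a finite connected oriented graph. Each edge $e$ is an open arc with an injective $W^{1,\infty}$ arc length parametrization $\gamma_e:(0,\ell_e)\to e$, $\ell_e>0$, $|\gamma_e'|=1$ a.e.; the vertices are the endpoints of the edges, distinct edges are disjoint and contain no vertices, and two different points of $\Gamma_Y$ that differ by an element of $\mathbb Z^2$ are vertices. Assume that there are $y_1,y_2\in\Gamma_Y$ with $y_1+e_1,\ y_2+e_2\in\Gamma_Y$, where $e_1=(1,0)$, $e_2=(0,1)$. Let $t=\gamma_e'\circ\gamma_e^{-1}$ be the unit tangent field and $\partial_\Gamma u=(u\circ\gamma_e)'\circ\gamma_e^{-1}$ the derivative along edges; integrals over a graph are sums of arc length integrals over its edges. For a graph $G$ let $H^1(G)$ be the space of $u\in L^2(G)$ that are continuous on $G$ with $\partial_\Gamma u\in L^2(G)$, normed by $(\|u\|^2_{L^2}+\|\partial_\Gamma u\|_{L^2}^2)^{1/2}$, and let $H^1_\sharp(\Gamma_Y)$ be the space $H^1$ of the graph obtained from $\Gamma_Y$ by identifying vertices that differ by an element of $\mathbb Z^2$. Let $\Omega=(0,L_1)\times(0,L_2)$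 with $L_1,L_2>0$, $L_1/L_2\in\mathbb Q$, let $T>0$, and let $\Gamma_D\subset\partial\Omega$ be a finite union of line segments of positive length. For $\delta>0$ with $N_i=L_i/\delta\in\mathbb N$ let $\Gamma^\delta=\bigcup_{0\le n_1<N_1}\bigcup_{0\le n_2<N_2}\delta(\Gamma_Y+n_1e_1+n_2e_2)$, a graph in which coinciding endpoints are one vertex and the edges are oriented as in $\Gamma_Y$. Put $\mathcal H^\delta=\{v\in H^1(\Gamma^\delta): v=0\text{ on }\Gamma^\delta\cap\Gamma_D\}$ and $\mathcal H=\{v\in H^1(\Omega): v=0\text{ on }\Gamma_D\text{ (trace)}\}$. A sequence $v^\delta\in L^2(0,T;L^2(\Gamma^\delta))$ ($\delta\to0$) is *mesh two-scale convergent* to $z\in L^2(0,T;L^2(\Omega;L^2(\Gamma_Y)))$, written $v^\delta\rightharpoonup z$, if for every $\psi\in C^\infty([0,T]\times\overline\Omega;H^1_\sharp(\Gamma_Y))$, extended $\mathbb Z^2$-periodically in $y$, $$\delta\int_0^T\!\!\int_{\Gamma^\delta}v^\delta(t,x)\,\psi\big(t,x,\tfrac x\delta\big)\,ds(x)\,dt\;\longrightarrow\;\int_0^T\!\!\int_\Omega\int_{\Gamma_Y}z(t,x,y)\,\psi(t,x,y)\,ds(y)\,dx\,dt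 .$$ For functions that do not depend on time, the notion is the same without the variable $t$. **Statement.** Let $(v^\delta)$ be a sequence, indexed by admissible $\delta\to0$, with $v^\delta\in L^2(0,T;H^1(\Gamma^\delta))$ and weak time derivative $\partial_tv^\delta\in L^2(0,T;L^2(\Gamma^\delta))$, such that for some constant $C$ and all $\delta$ of the sequence $$\sqrt\delta\,\|v^\delta\|_{L^2(0,T;L^2(\Gamma^\delta))}\le C,\qquad \sqrt\delta\,\|\partial_\Gamma v^\delta\|_{L^2(0,T;L^2(\Gamma^\delta))}\le C,\qquad \sqrt\delta\,\|\partial_tv^\delta\|_{L^2(0,T;L^2(\Gamma^\delta))}\le C .$$ Then there are a subsequence (still denoted by $v^\delta$) and functions $v^0\in L^2(0,T;H^1(\Omega))$ with $\partial_tv^0\in L^2(0,T;L^2(\Omega))$, and $v^1\in L^2(0,T;L^2(\Omega;H^1_\sharp(\Gamma_Y)))$, such that in the sense of mesh two-scale convergence $$v^\delta\rightharpoonup v^0,\qquad \partial_\Gamma v^\delta\rightharpoonup\nabla v^0\cdot t+\partial_{\Gamma,y}v^1,\qquad \partial_tv^\delta\rightharpoonup\partial_tv^0 ,$$ where $\partial_{\Gamma,y}$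 is $\partial_\Gamma$ with respect to $y\in\Gamma_Y$. Moreover, if $v^\delta\in L^2(0,T;\mathcal H^\delta)$ for all $\delta$ of the sequence, then $v^0\in L^2(0,T;\mathcal H)$. If the initial values $v^\delta|_{t=0}$ are mesh two-scale convergent (along the subsequence) with a limit in $L^2(\Omega;L^2(\Gamma_Y))$, then this limit is $v^0|_{t=0}$. -/

import Mathlib

open Set Filter Topology MeasureTheory
open scoped NNReal ENNReal ContDiff

noncomputable section

/-! ### Function spaces on metric graphs -/

/-- An oriented metric graph: the edge `e` is the interval `(0, len e)`, which runs from the vertex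
`src e` to the vertex `tgt e`. -/
structure MetricGraph (E V : Type*) where
  len : E → ℝ
  src : E → V
  tgt : E → V

namespace MetricGraph

/-- Arc length on the edge `e`. -/
def edgeMeasure {E V : Type*} (G : MetricGraph E V) (e : E) : Measure ℝ :=
  volume.restrict (Ioo 0 (G.len e))

instance {E V : Type*} (G : MetricGraph E V) (e : E) : IsFiniteMeasure (G.edgeMeasure e) := by
  unfold edgeMeasure; infer_instance

/-- The Hilbert space `L²(G)`, with `‖u‖² = ∑ₑ ∫ₑ |u|² ds`. -/
abbrev L2 {E V : Type*} [Fintype E] (G : MetricGraph E V) :=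
  PiLp 2 (fun e : E => Lp ℝ 2 (G.edgeMeasure e))

/-- Any two endpoints of edges are joined by a path that may pass edges in either direction. -/
def Connected {E V : Type*} (G : MetricGraph E V) : Prop :=
  ∀ e e' : E, Relation.EqvGen (fun p q => ∃ d, G.src d = p ∧ G.tgt d = q) (G.src e) (G.src e')

lemma intervalIntegrable_of_Lp {E V : Type*} {G : MetricGraph E V} {e : E}
    (g : Lp ℝ 2 (G.edgeMeasure e)) {s : ℝ} (hs : s ≤ G.len e) (hs0 : 0 ≤ s) :
    IntervalIntegrable (fun r => g r) volume 0 s := by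
  have h : Integrable (fun r => g r) (G.edgeMeasure e) :=
    (Lp.memLp g).integrable (by norm_num)
  have h' : IntegrableOn (fun r => g r) (Ioo 0 (G.len e)) volume := h
  rw [intervalIntegrable_iff_integrableOn_Ioo_of_le hs0]
  exact h'.mono_set (Ioo_subset_Ioo_right hs)

lemma integral_congr_of_ae {E V : Type*} {G : MetricGraph E V} {e : E} {f g : ℝ → ℝ}
    (h : f =ᵐ[G.edgeMeasure e] g) {s : ℝ} (hs : s ≤ G.len e) (hs0 : 0 ≤ s) :
    ∫ r in 0..s, f r = ∫ r in 0..s, g r := by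
  rw [intervalIntegral.integral_of_le hs0, intervalIntegral.integral_of_le hs0,
    integral_Ioc_eq_integral_Ioo, integral_Ioc_eq_integral_Ioo]
  apply integral_congr_ae
  exact ae_mono (Measure.restrict_mono (Ioo_subset_Ioo_right hs) le_rfl) h

/-- `g` is the derivative along the edges of `u`, and `u` is continuous on `G` (in particular
single-valued in the vertices) with the values `a` in the vertices: on each edge
`u(s) = a(src e) + ∫₀ˢ g`, and this function takes the value `a(tgt e)` at the other end. -/
def HasDerivWithVertexValues {E V : Type*} [Fintype E] (G : MetricGraph E V) (u g : G.L2)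
    (a : V → ℝ) : Prop :=
  ∀ e : E, (∀ᵐ s ∂(G.edgeMeasure e), u e s = a (G.src e) + ∫ r in 0..s, g e r) ∧
    (0 ≤ G.len e → a (G.tgt e) = a (G.src e) + ∫ r in 0..(G.len e), g e r)

lemma ae_mem {E V : Type*} (G : MetricGraph E V) (e : E) :
    ∀ᵐ s ∂(G.edgeMeasure e), s ∈ Ioo 0 (G.len e) :=
  ae_restrict_mem measurableSet_Ioo

/-- The Hilbert space `H¹(G)`, as the space of pairs `(u, ∂_Γ u)` in `L²(G) × L²(G)`, such that
`u` is continuous on `G`; its norm is `(‖u‖² + ‖∂_Γ u‖²)^(1/2)`. -/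
def H1 {E V : Type*} [Fintype E] (G : MetricGraph E V) : Submodule ℝ (WithLp 2 (G.L2 × G.L2)) where
  carrier := {f | ∃ a : V → ℝ, G.HasDerivWithVertexValues f.fst f.snd a}
  zero_mem' := by
    refine ⟨0, fun e => ?_⟩
    have h0 : ((0 : Lp ℝ 2 (G.edgeMeasure e)) : ℝ → ℝ) =ᵐ[G.edgeMeasure e] fun _ => 0 :=
      Lp.coeFn_zero _ _ _
    refine ⟨?_, fun hl => ?_⟩
    · filter_upwards [h0, G.ae_mem e] with s hs hm
      have := integral_congr_of_ae h0 hm.2.le hm.1.le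
      simp only [WithLp.zero_fst, WithLp.zero_snd, PiLp.zero_apply, Pi.zero_apply]
      rw [hs, this]; simp
    · have := integral_congr_of_ae h0 le_rfl hl
      simp only [WithLp.zero_snd, PiLp.zero_apply, Pi.zero_apply]
      rw [this]; simp
  add_mem' := by
    rintro f f' ⟨a, ha⟩ ⟨a', ha'⟩
    refine ⟨a + a', fun e => ?_⟩
    have key : ∀ s, s ≤ G.len e → 0 ≤ s → ∫ r in 0..s, (f.snd e + f'.snd e : Lp ℝ 2 _) r =
        (∫ r in 0..s, f.snd e r) + ∫ r in 0..s, f'.snd e r := fun s hs h0 => by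
      rw [integral_congr_of_ae (Lp.coeFn_add (f.snd e) (f'.snd e)) hs h0]
      exact intervalIntegral.integral_add (intervalIntegrable_of_Lp _ hs h0)
        (intervalIntegrable_of_Lp _ hs h0)
    refine ⟨?_, fun hl => ?_⟩
    · filter_upwards [Lp.coeFn_add (f.fst e) (f'.fst e), G.ae_mem e, (ha e).1, (ha' e).1]
        with s hs hm h1 h2
      simp only [WithLp.add_fst, WithLp.add_snd, PiLp.add_apply, Pi.add_apply] at hs ⊢
      rw [hs, key s hm.2.le hm.1.le, h1, h2]; ring
    · simp only [WithLp.add_snd, PiLp.add_apply, Pi.add_apply]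
      rw [key _ le_rfl hl, (ha e).2 hl, (ha' e).2 hl]; ring
  smul_mem' := by
    rintro c f ⟨a, ha⟩
    refine ⟨c • a, fun e => ?_⟩
    have key : ∀ s, s ≤ G.len e → 0 ≤ s → ∫ r in 0..s, (c • f.snd e : Lp ℝ 2 _) r =
        c * ∫ r in 0..s, f.snd e r := fun s hs h0 => by
      rw [integral_congr_of_ae (Lp.coeFn_smul c (f.snd e)) hs h0]
      simp
    refine ⟨?_, fun hl => ?_⟩
    · filter_upwards [Lp.coeFn_smul c (f.fst e), G.ae_mem e, (ha e).1] with s hs hm h1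
      simp only [WithLp.smul_fst, WithLp.smul_snd, PiLp.smul_apply, Pi.smul_apply,
        smul_eq_mul] at hs ⊢
      rw [hs, key s hm.2.le hm.1.le, h1]; ring
    · simp only [WithLp.smul_snd, PiLp.smul_apply, Pi.smul_apply, smul_eq_mul]
      rw [key _ le_rfl hl, (ha e).2 hl]; ring

/-- The function in `L²(G)` that belongs to an element of `H¹(G)`. -/
def H1.toL2 {E V : Type*} [Fintype E] {G : MetricGraph E V} : G.H1 →L[ℝ] G.L2 :=
  (WithLp.fstL 2 ℝ G.L2 G.L2).comp G.H1.subtypeL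

/-- The derivative `∂_Γ : H¹(G) → L²(G)` along the edges. -/
def H1.deriv {E V : Type*} [Fintype E] {G : MetricGraph E V} : G.H1 →L[ℝ] G.L2 :=
  (WithLp.sndL 2 ℝ G.L2 G.L2).comp G.H1.subtypeL

/-- The pointwise values of the continuous representative of `f ∈ H¹(G)`: its value in the point
with arc length parameter `s ∈ [0, len e]` on the edge `e`. (On a graph with edges of positive
length, the values in endpoints of edges are determined by `f`.) -/
def H1.eval {E V : Type*} [Fintype E] {G : MetricGraph E V} (f : G.H1) (e : E) (s : ℝ) : ℝ :=
  Classical.choose f.2 (G.src e) + ∫ r in 0..s, H1.deriv f e r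

end MetricGraph

/-! ### The unit mesh and the scaled meshes -/

/-- The plane. -/
abbrev Pt := EuclideanSpace ℝ (Fin 2)

/-- The unit mesh `Γ_Y ⊆ [0,1]²`: finitely many edges, the edge `e` being the image of `(0, len e)`
under the arc length parametrization `γ e` of class `W^{1,∞}`; the vertices are the endpoints. -/
structure UnitMesh (E : Type*) where
  len : E → ℝ
  γ : E → ℝ → Pt
  len_pos : ∀ e, 0 < len e
  lipschitz : ∀ e, ∃ K : ℝ≥0, LipschitzOnWith K (γ e) (Icc 0 (len e))
  unit_speed : ∀ e, ∀ᵐ s, s ∈ Ioo 0 (len e) → ‖deriv (γ e) s‖ = 1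
  mem_cell : ∀ e, ∀ s ∈ Icc 0 (len e), ∀ i, γ e s i ∈ Icc (0 : ℝ) 1
  /-- The parametrizations are injective on the open edges, different open edges are disjoint, and
  no vertex lies on an open edge; all of this modulo `ℤ²`, since points of `Γ_Y` that differ by an
  element of `ℤ²` are identified to one vertex of the periodic graph, so are not on open edges. -/
  separated : ∀ e, ∀ s ∈ Ioo 0 (len e), ∀ e', ∀ s' ∈ Icc 0 (len e'),
    (∀ i, (γ e s i : UnitAddCircle) = (γ e' s' i : UnitAddCircle)) → e = e' ∧ s = s'

namespace UnitMesh

/-- The set `Γ_Y`. -/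
def carrier {E : Type*} (Y : UnitMesh E) : Set Pt := ⋃ e, Y.γ e '' Icc 0 (Y.len e)

/-- `Γ_Y` as a metric graph with vertices in the plane. -/
def graph {E : Type*} (Y : UnitMesh E) : MetricGraph E Pt where
  len := Y.len
  src e := Y.γ e 0
  tgt e := Y.γ e (Y.len e)

/-- The periodic graph `Γ_{Y,♯}`: vertices that differ by an element of `ℤ²`, that is, opposite
points and corners of the unit square, are identified. -/
def periodic {E : Type*} (Y : UnitMesh E) : MetricGraph E (Fin 2 → UnitAddCircle) where
  len := Y.len
  src e := fun i => (Y.γ e 0 i : UnitAddCircle)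
  tgt e := fun i => (Y.γ e (Y.len e) i : UnitAddCircle)

/-- The mesh touches opposite sides of the unit square in opposite points. -/
def TouchesOpposite {E : Type*} (Y : UnitMesh E) : Prop :=
  ∀ i : Fin 2, ∃ y ∈ Y.carrier, y + EuclideanSpace.single i (1 : ℝ) ∈ Y.carrier

/-- The point `δ (y + n)`. -/
def cellPoint (δ : ℝ) {N : Fin 2 → ℕ} (n : ∀ i, Fin (N i)) (y : Pt) : Pt :=
  δ • (y + WithLp.toLp 2 (fun i => ((n i : ℕ) : ℝ)))

/-- The mesh `Γ^δ`, the union of the copies `δ (Γ_Y + n)`, `0 ≤ nᵢ < Nᵢ`. Endpoints of edges that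
coincide in the plane are the same vertex. -/
def mesh {E : Type*} (Y : UnitMesh E) (δ : ℝ) (N : Fin 2 → ℕ) :
    MetricGraph ((∀ i, Fin (N i)) × E) Pt where
  len p := δ * Y.len p.2
  src p := cellPoint δ p.1 (Y.γ p.2 0)
  tgt p := cellPoint δ p.1 (Y.γ p.2 (Y.len p.2))

/-- The arc length parametrization of the edge `p` of `Γ^δ`, on `[0, δ len]`. -/
def meshParam {E : Type*} (Y : UnitMesh E) (δ : ℝ) {N : Fin 2 → ℕ} (p : (∀ i, Fin (N i)) × E)
    (s : ℝ) : Pt :=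
  cellPoint δ p.1 (Y.γ p.2 (s / δ))

lemma memLp_tangent {E : Type*} (Y : UnitMesh E) (i : Fin 2) (e : E) :
    MemLp (fun s => deriv (Y.γ e) s i) 2 (Y.periodic.edgeMeasure e) := by
  have hm : Measurable (fun s => deriv (Y.γ e) s i) :=
    (show Measurable (fun x : Pt => x i) from (by fun_prop : Continuous fun x : Pt => x i).measurable).comp
      (measurable_deriv (Y.γ e))
  refine MemLp.of_bound hm.aestronglyMeasurable 1 ?_
  filter_upwards [ae_restrict_of_ae (Y.unit_speed e), Y.periodic.ae_mem e] with s hs hm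
  exact (PiLp.norm_apply_le _ i).trans (hs hm).le

/-- The `i`-th component of the unit tangent field `t` on `Γ_Y`. -/
def tangent {E : Type*} [Fintype E] (Y : UnitMesh E) (i : Fin 2) : Y.periodic.L2 :=
  WithLp.toLp 2 (fun e => (Y.memLp_tangent i e).toLp)

/-- The function `1` on `Γ_Y`. -/
def one {E : Type*} [Fintype E] (Y : UnitMesh E) : Y.periodic.L2 :=
  WithLp.toLp 2 (fun e => (memLp_const (μ := Y.periodic.edgeMeasure e) (1 : ℝ)).toLp)

end UnitMesh

/-! ### The rectangle -/

/-- The open rectangle `Ω = (0, L₁) × (0, L₂)`. -/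
def rect (L : Fin 2 → ℝ) : Set Pt := {x | ∀ i, x i ∈ Ioo 0 (L i)}

/-- The closed rectangle. -/
def closedRect (L : Fin 2 → ℝ) : Set Pt := {x | ∀ i, x i ∈ Icc 0 (L i)}

/-- Lebesgue measure on `Ω`. -/
def rectMeasure (L : Fin 2 → ℝ) : Measure Pt := volume.restrict (rect L)

/-- `L²(Ω; X)`. -/
abbrev L2Rect (L : Fin 2 → ℝ) (X : Type*) [NormedAddCommGroup X] := Lp X 2 (rectMeasure L)

/-- `∂φ/∂xᵢ` for smooth `φ`. -/
def partialDeriv (i : Fin 2) (φ : Pt → ℝ) (x : Pt) : ℝ :=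
  fderiv ℝ φ x (EuclideanSpace.single i (1 : ℝ))

/-- `φ ∈ C_c^∞(Ω)`. -/
def IsTestFunction (L : Fin 2 → ℝ) (φ : Pt → ℝ) : Prop :=
  ContDiff ℝ ∞ φ ∧ HasCompactSupport φ ∧ tsupport φ ⊆ rect L

/-- `g` is the weak gradient of `u` in `Ω`. -/
def HasWeakGradient (L : Fin 2 → ℝ) (u : L2Rect L ℝ) (g : PiLp 2 (fun _ : Fin 2 => L2Rect L ℝ)) :
    Prop :=
  ∀ φ, IsTestFunction L φ → ∀ i,
    ∫ x, u x * partialDeriv i φ x ∂(rectMeasure L) = - ∫ x, g i x * φ x ∂(rectMeasure L)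

lemma integral_Lp_add_mul {L : Fin 2 → ℝ} (u v : L2Rect L ℝ) {φ : Pt → ℝ} (hφ : Continuous φ)
    (hc : HasCompactSupport φ) :
    ∫ x, (u + v : L2Rect L ℝ) x * φ x ∂(rectMeasure L) =
      ∫ x, u x * φ x ∂(rectMeasure L) + ∫ x, v x * φ x ∂(rectMeasure L) := by
  have hφ' : MemLp φ 2 (rectMeasure L) := (hφ.memLp_of_hasCompactSupport hc).restrict _
  have hu : Integrable (fun x => u x * φ x) (rectMeasure L) := (Lp.memLp u).integrable_mul hφ'
  have hv : Integrable (fun x => v x * φ x) (rectMeasure L) := (Lp.memLp v).integrable_mul hφ'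
  rw [← integral_add hu hv]
  apply integral_congr_ae
  filter_upwards [Lp.coeFn_add u v] with x hx
  simp only [hx, Pi.add_apply]; ring

lemma integral_Lp_smul_mul {L : Fin 2 → ℝ} (c : ℝ) (u : L2Rect L ℝ) (φ : Pt → ℝ) :
    ∫ x, (c • u : L2Rect L ℝ) x * φ x ∂(rectMeasure L) = c * ∫ x, u x * φ x ∂(rectMeasure L) := by
  rw [← integral_const_mul]
  apply integral_congr_ae
  filter_upwards [Lp.coeFn_smul c u] with x hx
  simp only [hx, Pi.smul_apply, smul_eq_mul]; ring

lemma integral_Lp_zero_mul {L : Fin 2 → ℝ} (φ : Pt → ℝ) :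
    ∫ x, (0 : L2Rect L ℝ) x * φ x ∂(rectMeasure L) = 0 := by
  simpa using integral_Lp_smul_mul (L := L) 0 0 φ

lemma IsTestFunction.continuous_partialDeriv {L : Fin 2 → ℝ} {φ : Pt → ℝ} (h : IsTestFunction L φ)
    (i : Fin 2) : Continuous (partialDeriv i φ) ∧ HasCompactSupport (partialDeriv i φ) := by
  refine ⟨(h.1.continuous_fderiv (by simp)).clm_apply continuous_const, ?_⟩
  exact (h.2.1.fderiv (𝕜 := ℝ)).comp_left
    (g := fun A : Pt →L[ℝ] ℝ => A (EuclideanSpace.single i (1 : ℝ))) (by simp)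

/-- The Sobolev space `H¹(Ω)`, as the space of pairs `(u, ∇u)`; its norm is
`(‖u‖² + ‖∇u‖²)^(1/2)`. -/
def H1Rect (L : Fin 2 → ℝ) :
    Submodule ℝ (WithLp 2 (L2Rect L ℝ × PiLp 2 (fun _ : Fin 2 => L2Rect L ℝ))) where
  carrier := {f | HasWeakGradient L f.fst f.snd}
  zero_mem' := by
    intro φ _ i
    simp only [WithLp.zero_fst, WithLp.zero_snd, PiLp.zero_apply, integral_Lp_zero_mul, neg_zero]
  add_mem' := by
    intro f f' hf hf' φ hφ i
    simp only [WithLp.add_fst, WithLp.add_snd, PiLp.add_apply]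
    rw [integral_Lp_add_mul _ _ (hφ.continuous_partialDeriv i).1 (hφ.continuous_partialDeriv i).2,
      integral_Lp_add_mul _ _ hφ.1.continuous hφ.2.1, hf φ hφ i, hf' φ hφ i]; ring
  smul_mem' := by
    intro c f hf φ hφ i
    simp only [WithLp.smul_fst, WithLp.smul_snd, PiLp.smul_apply]
    rw [integral_Lp_smul_mul, integral_Lp_smul_mul, hf φ hφ i]; ring

/-- The function in `L²(Ω)` that belongs to an element of `H¹(Ω)`. -/
def H1Rect.toL2 {L : Fin 2 → ℝ} (u : H1Rect L) : L2Rect L ℝ := u.1.fst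

/-- The `i`-th weak partial derivative of an element of `H¹(Ω)`. -/
def H1Rect.grad {L : Fin 2 → ℝ} (u : H1Rect L) (i : Fin 2) : L2Rect L ℝ := u.1.snd i

/-- `ΓD ⊆ ∂Ω` is a finite union of line segments of positive length (with or without their
endpoints). -/
def IsBoundaryPart (L : Fin 2 → ℝ) (ΓD : Set Pt) : Prop :=
  ΓD ⊆ frontier (rect L) ∧ ∃ (k : ℕ) (p q : Fin k → Pt), (∀ j, p j ≠ q j) ∧
    (⋃ j, openSegment ℝ (p j) (q j)) ⊆ ΓD ∧ ΓD ⊆ ⋃ j, segment ℝ (p j) (q j)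

/-- `u ∈ H¹(Ω)` has the trace `g` on `ΓD`: the trace is the continuous extension of the restriction
to the boundary from functions that are smooth up to the boundary, so that `φₖ → u` in `H¹(Ω)` and
`φₖ → g` in `L²(ΓD)` for some smooth `φₖ`. -/
def HasTrace {L : Fin 2 → ℝ} (ΓD : Set Pt) (u : H1Rect L) (g : Pt → ℝ) : Prop :=
  ∃ φ : ℕ → Pt → ℝ, (∀ k, ContDiff ℝ ∞ (φ k)) ∧
    Tendsto (fun k => eLpNorm (fun x => φ k x - H1Rect.toL2 u x) 2 (rectMeasure L)) atTop (𝓝 0) ∧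
    (∀ i, Tendsto (fun k => eLpNorm (fun x => partialDeriv i (φ k) x - H1Rect.grad u i x) 2
      (rectMeasure L)) atTop (𝓝 0)) ∧
    Tendsto (fun k => eLpNorm (fun x => φ k x - g x) 2 ((Measure.hausdorffMeasure 1).restrict ΓD))
      atTop (𝓝 0)

/-- The space `𝓗` of the `u ∈ H¹(Ω)` with vanishing trace on `ΓD`. -/
def DirichletRect (L : Fin 2 → ℝ) (ΓD : Set Pt) : Set (H1Rect L) := {u | HasTrace ΓD u 0}

/-- The space `𝓗^δ` of the `v ∈ H¹(Γ^δ)` that vanish in the points of `Γ^δ` on `ΓD`. -/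
def UnitMesh.dirichletMesh {E : Type*} [Fintype E] (Y : UnitMesh E) (δ : ℝ) (N : Fin 2 → ℕ)
    (ΓD : Set Pt) : Set (Y.mesh δ N).H1 :=
  {v | ∀ p, ∀ s ∈ Icc 0 ((Y.mesh δ N).len p), Y.meshParam δ p s ∈ ΓD →
    MetricGraph.H1.eval v p s = 0}

/-! ### Time -/

/-- Lebesgue measure on the time interval `(0, T)`. -/
def timeMeasure (T : ℝ) : Measure ℝ := volume.restrict (Ioo 0 T)

/-- `w` is the weak time derivative of `u` on `(0, T)`. -/
def HasWeakTimeDeriv {X : Type*} [NormedAddCommGroup X] [NormedSpace ℝ X] (T : ℝ) (u w : ℝ → X) :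
    Prop :=
  ∀ φ : ℝ → ℝ, ContDiff ℝ ∞ φ → HasCompactSupport φ → tsupport φ ⊆ Ioo 0 T →
    ∫ t, deriv φ t • u t ∂(timeMeasure T) = - ∫ t, φ t • w t ∂(timeMeasure T)

/-- `a = u|_{t=0}`, the value at `0` of the continuous representative of `u`. -/
def IsInitialValue {X : Type*} [NormedAddCommGroup X] (T : ℝ) (u : ℝ → X) (a : X) : Prop :=
  ∃ U : ℝ → X, ContinuousOn U (Icc 0 T) ∧ (∀ᵐ t ∂(timeMeasure T), u t = U t) ∧ U 0 = a

/-! ### Mesh two-scale convergence -/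

namespace UnitMesh

/-- `∫_{Γ^δ} v(x) ψ(x, x/δ) ds(x)`. -/
def meshPairing {E : Type*} [Fintype E] (Y : UnitMesh E) (δ : ℝ) (N : Fin 2 → ℕ)
    (v : (Y.mesh δ N).L2) (ψ : Pt → Y.periodic.H1) : ℝ :=
  ∑ p, ∫ s, v p s * MetricGraph.H1.eval (ψ (Y.meshParam δ p s)) p.2 (s / δ) ∂((Y.mesh δ N).edgeMeasure p)

/-- `∫_Ω ∫_{Γ_Y} z(x, y) ψ(x, y) ds(y) dx`. -/
def limitPairing {E : Type*} [Fintype E] (Y : UnitMesh E) (L : Fin 2 → ℝ)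
    (z : L2Rect L Y.periodic.L2) (ψ : Pt → Y.periodic.H1) : ℝ :=
  ∫ x, ∑ e, ∫ s, z x e s * MetricGraph.H1.eval (ψ x) e s ∂(Y.periodic.edgeMeasure e) ∂(rectMeasure L)

/-- Mesh two-scale convergence of `vₖ ∈ L²(0,T; L²(Γ^{δₖ}))` to `z ∈ L²(0,T; L²(Ω; L²(Γ_Y)))`. -/
def MeshTwoScale {E : Type*} [Fintype E] (Y : UnitMesh E) (L : Fin 2 → ℝ) (T : ℝ) (δ : ℕ → ℝ)
    (N : ℕ → Fin 2 → ℕ) (v : ∀ k, ℝ → (Y.mesh (δ k) (N k)).L2)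
    (z : ℝ → L2Rect L Y.periodic.L2) : Prop :=
  (∀ k, MemLp (v k) 2 (timeMeasure T)) ∧ MemLp z 2 (timeMeasure T) ∧
  ∀ ψ : ℝ × Pt → Y.periodic.H1, ContDiffOn ℝ ∞ ψ (Icc 0 T ×ˢ closedRect L) →
    Tendsto (fun k => δ k * ∫ t, Y.meshPairing (δ k) (N k) (v k t) (fun x => ψ (t, x))
      ∂(timeMeasure T)) atTop
      (𝓝 (∫ t, Y.limitPairing L (z t) (fun x => ψ (t, x)) ∂(timeMeasure T)))

/-- Mesh two-scale convergence of functions that do not depend on time. -/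
def MeshTwoScaleStatic {E : Type*} [Fintype E] (Y : UnitMesh E) (L : Fin 2 → ℝ) (δ : ℕ → ℝ)
    (N : ℕ → Fin 2 → ℕ) (v : ∀ k, (Y.mesh (δ k) (N k)).L2) (z : L2Rect L Y.periodic.L2) : Prop :=
  ∀ ψ : Pt → Y.periodic.H1, ContDiffOn ℝ ∞ ψ (closedRect L) →
    Tendsto (fun k => δ k * Y.meshPairing (δ k) (N k) (v k) ψ) atTop (𝓝 (Y.limitPairing L z ψ))

/-- The function `(x, y) ↦ u(x) m(y)`. -/
def tensor {E : Type*} [Fintype E] (Y : UnitMesh E) {L : Fin 2 → ℝ} (u : L2Rect L ℝ)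
    (m : Y.periodic.L2) : L2Rect L Y.periodic.L2 :=
  (ContinuousLinearMap.toSpanSingleton ℝ m).compLp u

/-- The function `(x, y) ↦ u(x)`. -/
def slow {E : Type*} [Fintype E] (Y : UnitMesh E) {L : Fin 2 → ℝ} (u : L2Rect L ℝ) :
    L2Rect L Y.periodic.L2 :=
  Y.tensor u Y.one

/-- The slow derivative `(x, y) ↦ ∇u(x) · t(y)`. -/
def slowDeriv {E : Type*} [Fintype E] (Y : UnitMesh E) {L : Fin 2 → ℝ} (u : H1Rect L) :
    L2Rect L Y.periodic.L2 :=
  ∑ i, Y.tensor (H1Rect.grad u i) (Y.tangent i)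

/-- The fast derivative `(x, y) ↦ ∂_{Γ,y} u(x, y)`. -/
def fastDeriv {E : Type*} [Fintype E] (Y : UnitMesh E) {L : Fin 2 → ℝ}
    (u : L2Rect L Y.periodic.H1) : L2Rect L Y.periodic.L2 :=
  (MetricGraph.H1.deriv (G := Y.periodic)).compLp u

end UnitMesh

end

/-! The proof uses periodic unfolding. A function on the mesh is cut into its restrictions to the
cells, each restriction is rescaled to the unit mesh, and the result is read as a step function on
`Ω` with values in `L²(Γ_Y)`. This operator `unfold` satisfies `‖unfold v‖ ≤ √δ ‖v‖`, so the
hypotheses bound the unfoldings of `v`, of its derivative along edges and of its time derivative in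
`L²(0,T; L²(Ω; L²(Γ_Y)))`. A common subsequence converges weakly, to `Z`, `Zg`, `Zw`. By
`meshPairing_eq` the mesh pairing is an inner product of the unfolding with a sampled test function,
and the samples converge strongly. Hence weak convergence of unfoldings gives mesh two-scale
convergence (`meshTwoScale_of_weakTendsto`), and it remains to find the structure of the weak
limits.

On one cell, a function is a nodal value plus `δ` times a primitive of the unfolded derivative. Its
deviation from the cell mean is therefore `O(δ)`, and `Z` does not depend on `y`
(`IsUnfoldedLimit.eq_slow`). The time derivative inherits this.

For the gradient, let `q` and `q + m` be vertices of the unit mesh, `m` a lattice vector. The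
difference of the nodal values at `q + m` and `q` in a cell is `δ` times a continuous functional of
the unfolded derivative, the integral along a path from `q` to `q + m`. But `q + m` in the cell `n`
is the same point as `q` in the cell `n + m`, so this is also a discrete difference in `x`.
Summation by parts moves it to the test function, and the limit says that the path functional of
`Zg` is the weak derivative of the limit in direction `m` (`shift_limit`). Since the mesh touches
opposite sides, `m` can be either unit vector, and the limit `v0` lies in `H¹(Ω)` (`exists_slow`).
The path functional of the tangent field is `m` itself, so `Zg - ∇v0 · t` integrates to zero along
cycles and between identified vertices. It is therefore the derivative of a function on the periodic
graph, which a bounded right inverse of the derivative selects measurably (`exists_fast`).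

If the functions vanish on `ΓD`, the boundary terms of the summation by parts vanish also for test
functions that reach `ΓD`. The limit then satisfies Green's formula without boundary integral there.
Together with density of smooth functions in `H¹(Ω)`, proved by expansion into Neumann
eigenfunctions, this forces zero trace (`hasTrace_zero`).

Time enters in two ways. Identities at almost every time come from the time independent ones for
averages over measurable sets of times (`shift_limit_ae`), and separability makes the exceptional
null set independent of the test function. The initial value is a bounded linear function of `u` and
its weak derivative (`smul_initialValue_eq`), so initial values converge weakly too. -/

/-! ### Weak convergence in Hilbert spaces -/

/-- Weak convergence of a sequence in a real Hilbert space. -/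
def WeakTendsto {H : Type*} [NormedAddCommGroup H] [InnerProductSpace ℝ H] (x : ℕ → H) (x₀ : H) :
    Prop :=
  ∀ y, Tendsto (fun k => inner ℝ (x k) y) atTop (𝓝 (inner ℝ x₀ y))

namespace WeakTendsto

variable {H K : Type*} [NormedAddCommGroup H] [InnerProductSpace ℝ H]
  [NormedAddCommGroup K] [InnerProductSpace ℝ K] {x y : ℕ → H} {x₀ y₀ : H}

lemma clm [CompleteSpace H] [CompleteSpace K] (h : WeakTendsto x x₀) (A : H →L[ℝ] K) :
    WeakTendsto (fun k => A (x k)) (A x₀) := fun z => by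
  simpa only [ContinuousLinearMap.adjoint_inner_right] using h (A.adjoint z)

lemma add (h : WeakTendsto x x₀) (h' : WeakTendsto y y₀) :
    WeakTendsto (fun k => x k + y k) (x₀ + y₀) := fun z => by
  simpa only [inner_add_left] using (h z).add (h' z)

lemma comp (h : WeakTendsto x x₀) {σ : ℕ → ℕ} (hσ : StrictMono σ) :
    WeakTendsto (fun k => x (σ k)) x₀ := fun z => (h z).comp hσ.tendsto_atTop

lemma smul_of_bounded {c : ℕ → ℝ} (hc : Tendsto c atTop (𝓝 0)) {C : ℝ} (hC : ∀ k, ‖x k‖ ≤ C) :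
    Tendsto (fun k => c k • x k) atTop (𝓝 0) := by
  refine squeeze_zero_norm (a := fun k => |c k| * C) (fun k => ?_) ?_
  · rw [norm_smul, Real.norm_eq_abs]
    exact mul_le_mul_of_nonneg_left (hC k) (abs_nonneg _)
  · simpa using hc.abs.mul_const C

lemma of_tendsto (h : Tendsto x atTop (𝓝 x₀)) : WeakTendsto x x₀ := fun _ =>
  h.inner tendsto_const_nhds

lemma unique (h : WeakTendsto x x₀) (h' : WeakTendsto x y₀) : x₀ = y₀ :=
  ext_inner_right ℝ fun z => tendsto_nhds_unique (h z) (h' z)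

lemma inner_strong (h : WeakTendsto x x₀) {C : ℝ} (hC : ∀ k, ‖x k‖ ≤ C)
    (h' : Tendsto y atTop (𝓝 y₀)) :
    Tendsto (fun k => inner ℝ (x k) (y k)) atTop (𝓝 (inner ℝ x₀ y₀)) := by
  have h1 : Tendsto (fun k => inner ℝ (x k) (y k - y₀)) atTop (𝓝 0) := by
    refine squeeze_zero_norm (a := fun k => C * ‖y k - y₀‖) (fun k => ?_) ?_
    · exact (norm_inner_le_norm _ _).trans (mul_le_mul_of_nonneg_right (hC k) (norm_nonneg _))
    · simpa using (tendsto_iff_norm_sub_tendsto_zero.1 h').const_mul C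
  simpa [inner_sub_right] using h1.add (h y₀)

/-- Banach–Alaoglu, carried over by the Riesz isometry; separability of `H` turns compactness of the
dual ball into sequential compactness. -/
lemma exists_subseq [CompleteSpace H] [TopologicalSpace.SeparableSpace H] {C : ℝ}
    (hC : ∀ k, ‖x k‖ ≤ C) : ∃ x₀, ∃ σ : ℕ → ℕ, StrictMono σ ∧ WeakTendsto (fun k => x (σ k)) x₀ := by
  have hs := WeakDual.isSeqCompact_closedBall ℝ H 0 C
  obtain ⟨a, -, σ, hσ, ha⟩ := hs (x := fun k => StrongDual.toWeakDual (InnerProductSpace.toDual ℝ H (x k)))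
    (fun k => by simpa using hC k)
  refine ⟨(InnerProductSpace.toDual ℝ H).symm (WeakDual.toStrongDual a), σ, hσ, fun y => ?_⟩
  have := ((WeakDual.eval_continuous (𝕜 := ℝ) (E := H) y).tendsto a).comp ha
  simpa [Function.comp_def] using this

end WeakTendsto

/-- A countable dense subset of `S` has one common null set, and the identity is closed in `c`. This
lets identities proved for each test function separately hold for all of them at almost every time.
-/
lemma ae_forall_inner_eq_zero {α H : Type*} [MeasurableSpace α] {μ : Measure α}
    [NormedAddCommGroup H] [InnerProductSpace ℝ H] [SecondCountableTopology H] (S : Set H) {f : α → H}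
    (h : ∀ c ∈ S, ∀ᵐ t ∂μ, inner ℝ (f t) c = 0) : ∀ᵐ t ∂μ, ∀ c ∈ S, inner ℝ (f t) c = 0 := by
  obtain ⟨D, hDS, hDc, hD⟩ := TopologicalSpace.IsSeparable.exists_countable_dense_subset
    (TopologicalSpace.IsSeparable.of_separableSpace S)
  have : ∀ᵐ t ∂μ, ∀ c ∈ D, inner ℝ (f t) c = 0 := (ae_ball_iff hDc).2 fun c hc => h c (hDS hc)
  filter_upwards [this] with t ht c hc
  have hcl : IsClosed {c | inner ℝ (f t) c = 0} :=
    isClosed_eq (by fun_prop) continuous_const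
  exact hcl.closure_subset_iff.2 ht (hD hc)

/-! ### Primitives along edges -/

namespace MetricGraph

instance {E V : Type*} (G : MetricGraph E V) (e : E) : NullSingletonClass (G.edgeMeasure e) := by
  unfold edgeMeasure; infer_instance

variable {E V : Type*} {G : MetricGraph E V} {e : E}

/-- The functional `g ↦ ∫₀ˢ g` on an edge. -/
noncomputable def primitive (G : MetricGraph E V) (e : E) (s : ℝ) :
    Lp ℝ 2 (G.edgeMeasure e) →L[ℝ] ℝ :=
  innerSL ℝ (indicatorConstLp 2 (measurableSet_Ioc (a := 0) (b := s))
    (measure_ne_top (G.edgeMeasure e) _) (1 : ℝ))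

lemma primitive_apply (g : Lp ℝ 2 (G.edgeMeasure e)) (s : ℝ) :
    G.primitive e s g = ∫ r in Ioc 0 s, g r ∂(G.edgeMeasure e) := by
  simp [primitive, L2.inner_indicatorConstLp_one]

lemma primitive_eq (g : Lp ℝ 2 (G.edgeMeasure e)) {s : ℝ} (hs : s ≤ G.len e) (hs0 : 0 ≤ s) :
    G.primitive e s g = ∫ r in 0..s, g r := by
  have h : (G.edgeMeasure e).restrict (Ioo 0 s) = volume.restrict (Ioo 0 s) := by
    rw [edgeMeasure, Measure.restrict_restrict measurableSet_Ioo,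
      inter_eq_left.2 (Ioo_subset_Ioo_right hs)]
  rw [primitive_apply, intervalIntegral.integral_of_le hs0, integral_Ioc_eq_integral_Ioo,
    integral_Ioc_eq_integral_Ioo, h]

lemma continuous_primitive (g : Lp ℝ 2 (G.edgeMeasure e)) :
    Continuous (fun s => G.primitive e s g) := by
  have hg : Integrable (fun r => g r) (G.edgeMeasure e) := (Lp.memLp g).integrable (by norm_num)
  have h := intervalIntegral.continuous_primitive (μ := G.edgeMeasure e) (f := fun r => g r)
    (fun a b => hg.intervalIntegrable) 0
  -- For negative `s` the set `Ioc 0 s` is empty and the functional is zero, whereas the interval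
  -- integral would change sign; hence the `max`.
  have h2 : (fun s => G.primitive e s g) =
      (fun s => ∫ r in 0..s, g r ∂(G.edgeMeasure e)) ∘ (fun s => max s 0) := by
    funext s
    simp only [primitive_apply, Function.comp]
    rw [intervalIntegral.integral_of_le (le_max_right _ _)]
    rcases le_total 0 s with h | h
    · rw [max_eq_left h]
    · rw [max_eq_right h, Ioc_eq_empty (by simpa using h), Ioc_eq_empty (by simp)]
  rw [h2]
  exact h.comp (by fun_prop)

/-- A bound for the primitives on an edge. -/
noncomputable def primitiveBound (G : MetricGraph E V) (e : E) : ℝ :=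
  (G.edgeMeasure e).real univ ^ (1 / 2 : ℝ)

lemma primitiveBound_nonneg : 0 ≤ G.primitiveBound e :=
  Real.rpow_nonneg measureReal_nonneg _

lemma abs_primitive_le (g : Lp ℝ 2 (G.edgeMeasure e)) (s : ℝ) :
    |G.primitive e s g| ≤ G.primitiveBound e * ‖g‖ := by
  have h : ‖indicatorConstLp 2 (measurableSet_Ioc (a := 0) (b := s))
      (measure_ne_top (G.edgeMeasure e) _) (1 : ℝ)‖ ≤ G.primitiveBound e := by
    rw [norm_indicatorConstLp (by norm_num) (by norm_num), primitiveBound]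
    simp only [norm_one, one_mul, ENNReal.toReal_ofNat]
    exact Real.rpow_le_rpow measureReal_nonneg (measureReal_mono (subset_univ _)) (by norm_num)
  exact (abs_real_inner_le_norm _ _).trans (mul_le_mul_of_nonneg_right h (norm_nonneg _))

lemma memLp_primitive (g : Lp ℝ 2 (G.edgeMeasure e)) :
    MemLp (fun s => G.primitive e s g) 2 (G.edgeMeasure e) :=
  MemLp.of_bound (continuous_primitive g).aestronglyMeasurable _
    (Eventually.of_forall fun s => abs_primitive_le g s)

/-- The operator that maps `g` to its primitive that vanishes at the source of the edge. -/
noncomputable def volterra (G : MetricGraph E V) (e : E) :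
    Lp ℝ 2 (G.edgeMeasure e) →L[ℝ] Lp ℝ 2 (G.edgeMeasure e) :=
  LinearMap.mkContinuous
    { toFun := fun g => (memLp_primitive g).toLp
      map_add' := fun g g' => by
        rw [← MemLp.toLp_add]; congr 1; funext s; simp
      map_smul' := fun c g => by
        rw [RingHom.id_apply, ← MemLp.toLp_const_smul]; congr 1; funext s; simp }
    ((G.edgeMeasure e).real univ ^ (2 : ℝ≥0∞).toReal⁻¹ * G.primitiveBound e)
    (fun g => by
      rw [mul_assoc]
      refine Lp.norm_le_of_ae_bound (mul_nonneg primitiveBound_nonneg (norm_nonneg _)) ?_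
      filter_upwards [(memLp_primitive g).coeFn_toLp] with s hs
      simp only [LinearMap.coe_mk, AddHom.coe_mk]
      rw [hs]; exact abs_primitive_le g s)

lemma coeFn_volterra (g : Lp ℝ 2 (G.edgeMeasure e)) :
    ∀ᵐ s ∂(G.edgeMeasure e), G.volterra e g s = G.primitive e s g :=
  (memLp_primitive g).coeFn_toLp

/-- The constant function `1` on an edge. -/
noncomputable def edgeOne (G : MetricGraph E V) (e : E) : Lp ℝ 2 (G.edgeMeasure e) :=
  (memLp_const (1 : ℝ)).toLp

lemma coeFn_edgeOne : ∀ᵐ s ∂(G.edgeMeasure e), G.edgeOne e s = 1 :=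
  (memLp_const (1 : ℝ)).coeFn_toLp

lemma primitive_edgeOne (h : 0 ≤ G.len e) : G.primitive e (G.len e) (G.edgeOne e) = G.len e := by
  rw [primitive_eq _ le_rfl h, integral_congr_of_ae coeFn_edgeOne le_rfl h]; simp

variable [Fintype E]

/-- Turns the pointwise relations into equations between bounded operators on `L²`, a form that
survives limits and rescaling. -/
lemma hasDerivWithVertexValues_iff (hlen : ∀ e, 0 ≤ G.len e) {u g : G.L2} {a : V → ℝ} :
    G.HasDerivWithVertexValues u g a ↔ ∀ e : E,
      u e = a (G.src e) • G.edgeOne e + G.volterra e (g e) ∧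
      a (G.tgt e) = a (G.src e) + G.primitive e (G.len e) (g e) := by
  refine forall_congr' fun e => and_congr ?_ ?_
  · have h : ∀ᵐ s ∂(G.edgeMeasure e), (a (G.src e) • G.edgeOne e + G.volterra e (g e) :
        Lp ℝ 2 (G.edgeMeasure e)) s = a (G.src e) + ∫ r in 0..s, g e r := by
      filter_upwards [Lp.coeFn_add (a (G.src e) • G.edgeOne e) (G.volterra e (g e)),
        Lp.coeFn_smul (a (G.src e)) (G.edgeOne e), coeFn_volterra (g e), coeFn_edgeOne (G := G),
        G.ae_mem e] with s h1 h2 h3 h4 h5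
      rw [h1, Pi.add_apply, h2, h3, Pi.smul_apply, h4, primitive_eq _ h5.2.le h5.1.le]; simp
    constructor
    · intro h'
      apply Lp.ext
      filter_upwards [h, h'] with s h1 h2
      rw [h1, h2]
    · intro h'
      rw [h']; exact h
  · rw [primitive_eq _ le_rfl (hlen e)]
    exact ⟨fun h => h (hlen e), fun h _ => h⟩

/-- The value of `f ∈ H¹(G)` at the source of an edge, as a continuous functional. -/
noncomputable def srcValue (G : MetricGraph E V) (e : E) : WithLp 2 (G.L2 × G.L2) →L[ℝ] ℝ :=
  (G.len e)⁻¹ • (G.primitive e (G.len e)).comp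
    ((PiLp.proj 2 (𝕜 := ℝ) (fun e : E => Lp ℝ 2 (G.edgeMeasure e)) e).comp (WithLp.fstL 2 ℝ G.L2 G.L2) -
    (G.volterra e).comp
    ((PiLp.proj 2 (𝕜 := ℝ) (fun e : E => Lp ℝ 2 (G.edgeMeasure e)) e).comp (WithLp.sndL 2 ℝ G.L2 G.L2)))

/-- On each edge, `u` minus the primitive of its derivative is the constant source value, so
averaging over the edge recovers it. The average makes sense for every pair in `L² × L²`, which is
why the value becomes a continuous functional. -/
lemma srcValue_eq (hlen : ∀ e, 0 < G.len e) {f : WithLp 2 (G.L2 × G.L2)} {a : V → ℝ}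
    (h : G.HasDerivWithVertexValues f.fst f.snd a) (e : E) : G.srcValue e f = a (G.src e) := by
  have h1 := (((hasDerivWithVertexValues_iff fun e => (hlen e).le).1 h) e).1
  simp only [srcValue, smul_apply, ContinuousLinearMap.comp_apply,
    sub_apply, WithLp.fstL_apply, WithLp.sndL_apply, PiLp.proj_apply]
  rw [h1, add_sub_cancel_right, map_smul, primitive_edgeOne (hlen e).le, smul_eq_mul, smul_eq_mul,
    mul_comm (a _), inv_mul_cancel_left₀ (hlen e).ne']

/-- Point evaluation on `H¹(G)` as a continuous functional. -/
noncomputable def evalL (G : MetricGraph E V) (e : E) (s : ℝ) : G.H1 →L[ℝ] ℝ :=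
  (G.srcValue e).comp G.H1.subtypeL +
    ((G.primitive e s).comp (PiLp.proj 2 (𝕜 := ℝ) (fun e : E => Lp ℝ 2 (G.edgeMeasure e)) e)).comp
      H1.deriv

lemma evalL_apply (f : G.H1) (s : ℝ) :
    G.evalL e s f = G.srcValue e f.1 + G.primitive e s (H1.deriv f e) := rfl

lemma eval_eq (hlen : ∀ e, 0 < G.len e) (f : G.H1) {s : ℝ} (hs : s ∈ Icc 0 (G.len e)) :
    H1.eval f e s = G.evalL e s f := by
  rw [evalL_apply, primitive_eq _ hs.2 hs.1, srcValue_eq hlen (Classical.choose_spec f.2), H1.eval]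

lemma evalL_eq_of_hasDeriv (hlen : ∀ e, 0 < G.len e) (f : G.H1) {a : V → ℝ}
    (h : G.HasDerivWithVertexValues f.1.fst f.1.snd a) (s : ℝ) :
    G.evalL e s f = a (G.src e) + G.primitive e s (f.1.snd e) := by
  rw [evalL_apply, srcValue_eq hlen h]; rfl

lemma continuous_evalL (f : G.H1) : Continuous (fun s => G.evalL e s f) := by
  simp only [evalL_apply]
  exact continuous_const.add (continuous_primitive _)

/-- The embedding of `H¹` into bounded functions in dimension one; the constant is uniform in the
point because primitives are bounded by Cauchy–Schwarz. -/
lemma exists_evalL_bound (G : MetricGraph E V) :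
    ∃ C : ℝ, 0 ≤ C ∧ ∀ e s (f : G.H1), |G.evalL e s f| ≤ C * ‖f‖ := by
  have : ∀ e, ∃ C : ℝ, 0 ≤ C ∧ ∀ s (f : G.H1), |G.evalL e s f| ≤ C * ‖f‖ := fun e => by
    refine ⟨‖(G.srcValue e).comp G.H1.subtypeL‖ + G.primitiveBound e *
      ‖(PiLp.proj 2 (𝕜 := ℝ) (fun e : E => Lp ℝ 2 (G.edgeMeasure e)) e).comp
        (H1.deriv (G := G))‖, ?_, fun s f => ?_⟩
    · exact add_nonneg (ContinuousLinearMap.opNorm_nonneg _)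
        (mul_nonneg primitiveBound_nonneg (ContinuousLinearMap.opNorm_nonneg _))
    rw [add_mul, mul_assoc]
    refine (abs_add_le _ _).trans (add_le_add ?_ ?_)
    · exact ContinuousLinearMap.le_opNorm ((G.srcValue e).comp G.H1.subtypeL) f
    · refine (abs_primitive_le _ s).trans (mul_le_mul_of_nonneg_left ?_ primitiveBound_nonneg)
      exact ContinuousLinearMap.le_opNorm ((PiLp.proj 2 (𝕜 := ℝ)
        (fun e : E => Lp ℝ 2 (G.edgeMeasure e)) e).comp (H1.deriv (G := G))) f
  choose C hC0 hC using this
  refine ⟨∑ e, C e, Finset.sum_nonneg fun e _ => hC0 e, fun e s f => (hC e s f).trans ?_⟩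
  exact mul_le_mul_of_nonneg_right (Finset.single_le_sum (fun e _ => hC0 e) (Finset.mem_univ e))
    (norm_nonneg _)

end MetricGraph

/-! ### Functions on the unit mesh -/

namespace UnitMesh

variable {E : Type*} (Y : UnitMesh E)

lemma periodic_len_nonneg (e : E) : 0 ≤ Y.periodic.len e := (Y.len_pos e).le

/-- The set of vertices of the unit mesh. -/
def vertices : Set Pt := {q | ∃ e, q = Y.γ e 0 ∨ q = Y.γ e (Y.len e)}

variable {Y} in
lemma src_mem_vertices (e : E) : Y.γ e 0 ∈ Y.vertices := ⟨e, .inl rfl⟩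

variable {Y} in
lemma tgt_mem_vertices (e : E) : Y.γ e (Y.len e) ∈ Y.vertices := ⟨e, .inr rfl⟩

variable [Fintype E]

/-- `u` is a function on the unit mesh with derivative `g` and values `a` in the vertices. -/
def IsCellFunction (u g : Y.periodic.L2) (a : Pt → ℝ) : Prop :=
  ∀ e, u e = a (Y.γ e 0) • Y.periodic.edgeOne e + Y.periodic.volterra e (g e) ∧
    a (Y.γ e (Y.len e)) = a (Y.γ e 0) + Y.periodic.primitive e (Y.len e) (g e)

/-- The integral along the whole edge `e`. -/
noncomputable def edgeIntegral (e : E) : Y.periodic.L2 →L[ℝ] ℝ :=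
  (Y.periodic.primitive e (Y.len e)).comp
    (PiLp.proj 2 (𝕜 := ℝ) (fun e : E => Lp ℝ 2 (Y.periodic.edgeMeasure e)) e)

/-- Induction along a path: an edge passed forward contributes its edge integral, an edge passed
backward the negative. The functional depends on the path only and not on the cell function. -/
lemma exists_path_functional {p q : Pt}
    (h : Relation.EqvGen (fun p q => ∃ d, Y.graph.src d = p ∧ Y.graph.tgt d = q) p q) :
    ∃ ρ : Y.periodic.L2 →L[ℝ] ℝ, ∀ u g a, Y.IsCellFunction u g a → a q - a p = ρ g := by
  induction h with
  | rel x y h =>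
    obtain ⟨d, rfl, rfl⟩ := h
    exact ⟨Y.edgeIntegral d, fun u g a h => by
      rw [sub_eq_iff_eq_add']; exact (h d).2⟩
  | refl x => exact ⟨0, fun u g a _ => by simp⟩
  | symm x y _ ih =>
    obtain ⟨ρ, hρ⟩ := ih
    exact ⟨-ρ, fun u g a h => by rw [neg_apply, ← hρ u g a h]; ring⟩
  | trans x y z _ _ ih ih' =>
    obtain ⟨ρ, hρ⟩ := ih
    obtain ⟨ρ', hρ'⟩ := ih'
    exact ⟨ρ + ρ', fun u g a h => by rw [add_apply, ← hρ u g a h, ← hρ' u g a h]; ring⟩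

open Classical in
/-- The integral of a derivative along some path from the source of `e₀` to `q`. -/
noncomputable def pathFunctional (e₀ : E) (q : Pt) : Y.periodic.L2 →L[ℝ] ℝ :=
  if h : ∃ ρ : Y.periodic.L2 →L[ℝ] ℝ, ∀ u g a, Y.IsCellFunction u g a →
    a q - a (Y.γ e₀ 0) = ρ g then h.choose else 0

variable {Y}

lemma pathFunctional_eq (hconn : Y.graph.Connected) (e₀ : E) {q : Pt} (hq : q ∈ Y.vertices)
    {u g : Y.periodic.L2} {a : Pt → ℝ} (h : Y.IsCellFunction u g a) :
    a q - a (Y.γ e₀ 0) = Y.pathFunctional e₀ q g := by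
  have hex : ∃ ρ : Y.periodic.L2 →L[ℝ] ℝ, ∀ u g a, Y.IsCellFunction u g a →
      a q - a (Y.γ e₀ 0) = ρ g := by
    apply exists_path_functional
    obtain ⟨e, rfl | rfl⟩ := hq
    · exact hconn e₀ e
    · exact (hconn e₀ e).trans _ _ _ (.rel _ _ ⟨e, rfl, rfl⟩)
  rw [pathFunctional, dif_pos hex]
  exact hex.choose_spec u g a h

variable (Y) in
/-- The primitive on the unit mesh that vanishes at the source of `e₀`. -/
noncomputable def meshPrimitive (e₀ : E) : Y.periodic.L2 →L[ℝ] Y.periodic.L2 :=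
  ((PiLp.continuousLinearEquiv 2 ℝ
    (fun e : E => Lp ℝ 2 (Y.periodic.edgeMeasure e))).symm : _ →L[ℝ] _).comp
    (ContinuousLinearMap.pi fun e =>
      (Y.pathFunctional e₀ (Y.γ e 0)).smulRight (Y.periodic.edgeOne e) +
      (Y.periodic.volterra e).comp
        (PiLp.proj 2 (𝕜 := ℝ) (fun e : E => Lp ℝ 2 (Y.periodic.edgeMeasure e)) e))

lemma meshPrimitive_apply (e₀ : E) (g : Y.periodic.L2) (e : E) :
    Y.meshPrimitive e₀ g e = Y.pathFunctional e₀ (Y.γ e 0) g • Y.periodic.edgeOne e +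
      Y.periodic.volterra e (g e) := rfl

/-- Plays the part of Poincaré's inequality on the connected cell: up to one constant, a function is
a bounded linear image of its derivative. -/
lemma IsCellFunction.eq_add_meshPrimitive (hconn : Y.graph.Connected) (e₀ : E)
    {u g : Y.periodic.L2} {a : Pt → ℝ} (h : Y.IsCellFunction u g a) :
    u = a (Y.γ e₀ 0) • Y.one + Y.meshPrimitive e₀ g := by
  refine PiLp.ext fun e => ?_
  rw [(h e).1, PiLp.add_apply, PiLp.smul_apply, meshPrimitive_apply,
    ← pathFunctional_eq hconn e₀ (src_mem_vertices e) h, ← add_assoc]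
  congr 1
  rw [show Y.one e = Y.periodic.edgeOne e from rfl, ← add_smul]
  congr 1; ring

lemma edgeIntegral_tangent (i : Fin 2) (e : E) :
    Y.edgeIntegral e (Y.tangent i) = Y.γ e (Y.len e) i - Y.γ e 0 i := by
  obtain ⟨K, hK⟩ := Y.lipschitz e
  have h0 : (0 : ℝ) ≤ Y.len e := (Y.len_pos e).le
  have hlip : LipschitzOnWith K (fun s => Y.γ e s i) (uIcc 0 (Y.len e)) := by
    rw [uIcc_of_le h0]
    refine LipschitzOnWith.of_dist_le_mul fun x hx y hy => ?_
    refine le_trans ?_ (hK.dist_le_mul x hx y hy)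
    rw [Real.dist_eq, dist_eq_norm]
    exact PiLp.norm_apply_le (Y.γ e x - Y.γ e y) i
  rw [← hlip.absolutelyContinuousOnInterval.integral_deriv_eq_sub]
  refine (MetricGraph.primitive_eq (G := Y.periodic) (Y.tangent i e) le_rfl h0).trans ?_
  have h1 : (Y.tangent i e : ℝ → ℝ) =ᵐ[Y.periodic.edgeMeasure e] fun s => deriv (Y.γ e) s i :=
    (Y.memLp_tangent i e).coeFn_toLp
  refine MetricGraph.integral_congr_of_ae (h1.trans ?_) le_rfl h0
  filter_upwards [ae_restrict_of_ae (Y.unit_speed e), Y.periodic.ae_mem e] with s hs hm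
  -- `deriv` takes the value zero where the curve is not differentiable, which unit speed excludes.
  have hd : DifferentiableAt ℝ (Y.γ e) s := by
    by_contra hn
    have := hs hm
    rw [deriv_zero_of_not_differentiableAt hn] at this
    simp at this
  exact ((EuclideanSpace.proj i : Pt →L[ℝ] ℝ).hasFDerivAt.comp_hasDerivAt s hd.hasDerivAt).deriv.symm

/-- The coordinate `q ↦ q i` is itself a function on the mesh, and its derivative along the edges is
the `i`-th component of the tangent. -/
lemma pathFunctional_tangent (hconn : Y.graph.Connected) (e₀ : E) {q : Pt} (hq : q ∈ Y.vertices)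
    (i : Fin 2) : Y.pathFunctional e₀ q (Y.tangent i) = q i - Y.γ e₀ 0 i := by
  have h : Y.IsCellFunction (WithLp.toLp 2 fun e => (Y.γ e 0 i) • Y.periodic.edgeOne e +
      Y.periodic.volterra e (Y.tangent i e)) (Y.tangent i) (fun q => q i) := fun e => by
    refine ⟨rfl, ?_⟩
    have := edgeIntegral_tangent (Y := Y) i e
    rw [edgeIntegral, ContinuousLinearMap.comp_apply, PiLp.proj_apply] at this
    rw [this]; ring
  exact (pathFunctional_eq hconn e₀ hq h).symm

variable (Y) in
/-- Derivatives of functions on the periodic graph. -/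
def periodicDerivs (e₀ : E) : Submodule ℝ Y.periodic.L2 where
  -- The first condition makes the path integrals a potential on `Γ_Y`, so circulations along cycles
  -- vanish; the second makes the potential agree in vertices that the periodic graph identifies.
  carrier := {h | (∀ e, Y.pathFunctional e₀ (Y.γ e (Y.len e)) h =
      Y.pathFunctional e₀ (Y.γ e 0) h + Y.edgeIntegral e h) ∧
    ∀ q ∈ Y.vertices, ∀ q' ∈ Y.vertices, (∀ i, (q i : UnitAddCircle) = (q' i : UnitAddCircle)) →
      Y.pathFunctional e₀ q h = Y.pathFunctional e₀ q' h}
  zero_mem' := by simp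
  add_mem' := by
    rintro h h' ⟨h1, h2⟩ ⟨h1', h2'⟩
    refine ⟨fun e => ?_, fun q hq q' hq' hqq => ?_⟩
    · simp only [map_add, h1 e, h1' e]; ring
    · simp only [map_add, h2 q hq q' hq' hqq, h2' q hq q' hq' hqq]
  smul_mem' := by
    rintro c h ⟨h1, h2⟩
    refine ⟨fun e => ?_, fun q hq q' hq' hqq => ?_⟩
    · simp only [map_smul, h1 e, smul_add]
    · simp only [map_smul, h2 q hq q' hq' hqq]

lemma isClosed_periodicDerivs (e₀ : E) : IsClosed (Y.periodicDerivs e₀ : Set Y.periodic.L2) := by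
  have : (Y.periodicDerivs e₀ : Set Y.periodic.L2) = {h | (∀ e, Y.pathFunctional e₀ (Y.γ e (Y.len e)) h =
      Y.pathFunctional e₀ (Y.γ e 0) h + Y.edgeIntegral e h) ∧
    ∀ q ∈ Y.vertices, ∀ q' ∈ Y.vertices, (∀ i, (q i : UnitAddCircle) = (q' i : UnitAddCircle)) →
      Y.pathFunctional e₀ q h = Y.pathFunctional e₀ q' h} := rfl
  rw [this]
  simp only [ofPred_and, ofPred_forall]
  refine IsClosed.inter (isClosed_iInter fun e => isClosed_eq (by fun_prop) (by fun_prop)) ?_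
  exact isClosed_iInter fun q => isClosed_iInter fun _ => isClosed_iInter fun q' =>
    isClosed_iInter fun _ => isClosed_iInter fun _ => isClosed_eq (by fun_prop) (by fun_prop)

open Classical in
lemma meshPrimitive_mem (e₀ : E) {h : Y.periodic.L2} (hh : h ∈ Y.periodicDerivs e₀) :
    WithLp.toLp 2 (Y.meshPrimitive e₀ h, h) ∈ Y.periodic.H1 := by
  obtain ⟨b, hb⟩ : ∃ b : (Fin 2 → UnitAddCircle) → ℝ, ∀ q ∈ Y.vertices,
      b (fun i => (q i : UnitAddCircle)) = Y.pathFunctional e₀ q h := by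
    -- The value at a class of vertices is read off at a chosen representative; the second condition
    -- of `periodicDerivs` makes the choice immaterial. The default value is never used.
    refine ⟨fun c => if hex : ∃ q' ∈ Y.vertices, ∀ i, (q' i : UnitAddCircle) = c i then
      Y.pathFunctional e₀ hex.choose h else 0, fun q hq => ?_⟩
    have hex : ∃ q' ∈ Y.vertices, ∀ i, (q' i : UnitAddCircle) = (q i : UnitAddCircle) :=
      ⟨q, hq, fun i => rfl⟩
    simp only [dif_pos hex]
    exact hh.2 _ hex.choose_spec.1 _ hq hex.choose_spec.2
  refine ⟨b, (MetricGraph.hasDerivWithVertexValues_iff Y.periodic_len_nonneg).2 fun e => ?_⟩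
  have h1 : b (Y.periodic.src e) = _ := hb _ (src_mem_vertices e)
  have h2 : b (Y.periodic.tgt e) = _ := hb _ (tgt_mem_vertices e)
  rw [h1, h2]
  exact ⟨meshPrimitive_apply e₀ h e, hh.1 e⟩

/-- The derivative on the periodic graph has a continuous right inverse. -/
lemma exists_right_inverse (e₀ : E) : ∃ A : Y.periodic.L2 →L[ℝ] Y.periodic.H1,
    ∀ h ∈ Y.periodicDerivs e₀, MetricGraph.H1.deriv (A h) = h := by
  have : CompleteSpace (Y.periodicDerivs e₀) := (isClosed_periodicDerivs e₀).completeSpace_coe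
  let M : Y.periodic.L2 →L[ℝ] WithLp 2 (Y.periodic.L2 × Y.periodic.L2) :=
    ((WithLp.prodContinuousLinearEquiv 2 ℝ Y.periodic.L2 Y.periodic.L2).symm : _ →L[ℝ] _).comp
      ((Y.meshPrimitive e₀).prod (ContinuousLinearMap.id ℝ _))
  have hM : ∀ h, M h = WithLp.toLp 2 (Y.meshPrimitive e₀ h, h) := fun _ => rfl
  have hM' : ∀ h : Y.periodicDerivs e₀, (M.comp (Y.periodicDerivs e₀).subtypeL) h ∈ Y.periodic.H1 :=
    fun h => (hM h.1) ▸ meshPrimitive_mem e₀ h.2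
  -- The orthogonal projection extends the inverse to all of `L²`. Being a bounded operator on the
  -- whole space, it can be applied pointwise in `x` and `t` without any measurable selection.
  refine ⟨((M.comp (Y.periodicDerivs e₀).subtypeL).codRestrict Y.periodic.H1 hM').comp
    (Y.periodicDerivs e₀).orthogonalProjectionOnto, fun h hh => ?_⟩
  have : (Y.periodicDerivs e₀).orthogonalProjectionOnto h = ⟨h, hh⟩ :=
    Submodule.orthogonalProjectionOnto_mem_subspace_eq_self (K := Y.periodicDerivs e₀) ⟨h, hh⟩
  rw [ContinuousLinearMap.comp_apply, this]
  change (M h).snd = h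
  rw [hM]; rfl

end UnitMesh

/-! ### Step functions on the cells of a rectangle -/

lemma isOpen_rect (L : Fin 2 → ℝ) : IsOpen (rect L) := by
  have : rect L = ⋂ i, (fun x : Pt => x i) ⁻¹' Ioo 0 (L i) := by ext x; simp [rect]
  rw [this]
  exact isOpen_iInter_of_finite fun i => isOpen_Ioo.preimage (by fun_prop)

lemma volume_box (a b : Fin 2 → ℝ) :
    volume {x : Pt | ∀ i, x i ∈ Ico (a i) (b i)} = ∏ i, ENNReal.ofReal (b i - a i) := by
  rw [← Real.volume_pi_Ico, ← (PiLp.volume_preserving_ofLp (Fin 2)).measure_preimage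
    (MeasurableSet.univ_pi fun i => measurableSet_Ico).nullMeasurableSet]
  congr 1; ext x; simp

lemma volume_open_box (a b : Fin 2 → ℝ) :
    volume {x : Pt | ∀ i, x i ∈ Ioo (a i) (b i)} = ∏ i, ENNReal.ofReal (b i - a i) := by
  rw [← Real.volume_pi_Ioo, ← (PiLp.volume_preserving_ofLp (Fin 2)).measure_preimage
    (MeasurableSet.univ_pi fun i => measurableSet_Ioo).nullMeasurableSet]
  congr 1; ext x; simp

instance (L : Fin 2 → ℝ) : IsFiniteMeasure (rectMeasure L) := by
  refine ⟨?_⟩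
  have h := volume_open_box (fun _ => 0) L
  rw [rectMeasure, Measure.restrict_apply_univ]
  change volume {x : Pt | ∀ i, x i ∈ Ioo 0 (L i)} < ⊤
  rw [h]
  exact ENNReal.prod_lt_top fun i _ => ENNReal.ofReal_lt_top

instance (T : ℝ) : IsFiniteMeasure (timeMeasure T) := by
  unfold timeMeasure; infer_instance

lemma ae_mem_rect (L : Fin 2 → ℝ) : ∀ᵐ x ∂(rectMeasure L), x ∈ rect L :=
  ae_restrict_mem (isOpen_rect L).measurableSet

/-- The cell `δ ([0,1)² + n)`. -/
def cell (δ : ℝ) {N : Fin 2 → ℕ} (n : ∀ i, Fin (N i)) : Set Pt :=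
  {x | ∀ i, x i ∈ Ico (δ * (n i : ℕ)) (δ * ((n i : ℕ) + 1))}

section Step

variable {δ : ℝ} {N : Fin 2 → ℕ} {L : Fin 2 → ℝ}

lemma measurableSet_cell (n : ∀ i, Fin (N i)) : MeasurableSet (cell δ n) := by
  have : cell δ n = ⋂ i, (fun x : Pt => x i) ⁻¹' Ico (δ * (n i : ℕ)) (δ * ((n i : ℕ) + 1)) := by
    ext x; simp [cell]
  rw [this]
  exact MeasurableSet.iInter fun i => measurableSet_Ico.preimage (by fun_prop)

lemma natFloor_eq_of_mem_cell (hδ : 0 < δ) {n : ∀ i, Fin (N i)} {x : Pt} (hx : x ∈ cell δ n)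
    (i : Fin 2) : ⌊x i / δ⌋₊ = n i := by
  have h := hx i
  rw [Nat.floor_eq_iff (div_nonneg (le_trans (by positivity) h.1) hδ.le), le_div_iff₀ hδ,
    div_lt_iff₀ hδ]
  exact ⟨by linarith [h.1], by linarith [h.2]⟩

lemma cell_unique (hδ : 0 < δ) {n n' : ∀ i, Fin (N i)} {x : Pt} (hx : x ∈ cell δ n)
    (hx' : x ∈ cell δ n') : n = n' := by
  funext i
  exact Fin.ext ((natFloor_eq_of_mem_cell hδ hx i).symm.trans (natFloor_eq_of_mem_cell hδ hx' i))

lemma exists_mem_cell (hδ : 0 < δ) (hN : ∀ i, (N i : ℝ) * δ = L i) {x : Pt} (hx : x ∈ rect L) :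
    ∃ n : ∀ i, Fin (N i), x ∈ cell δ n := by
  have h : ∀ i, ⌊x i / δ⌋₊ < N i := fun i => by
    rw [Nat.floor_lt (div_nonneg (hx i).1.le hδ.le), div_lt_iff₀ hδ, hN i]
    exact (hx i).2
  refine ⟨fun i => ⟨_, h i⟩, fun i => ?_⟩
  have h1 := Nat.floor_le (div_nonneg (hx i).1.le hδ.le)
  have h2 := Nat.lt_floor_add_one (x i / δ)
  rw [le_div_iff₀ hδ] at h1
  rw [div_lt_iff₀ hδ] at h2
  exact ⟨by linarith, by linarith⟩

lemma rectMeasure_real_cell (hδ : 0 < δ) (hN : ∀ i, (N i : ℝ) * δ = L i) (n : ∀ i, Fin (N i)) :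
    (rectMeasure L).real (cell δ n) = δ ^ 2 := by
  have h1 : rectMeasure L (cell δ n) ≤ ∏ _i : Fin 2, ENNReal.ofReal δ := by
    refine (Measure.restrict_apply_le _ _).trans ?_
    rw [cell, volume_box]
    exact le_of_eq (Finset.prod_congr rfl fun i _ => by congr 1; ring)
  -- Cells are half open, so those at the lower and left sides contain points outside the open
  -- rectangle. The lower bound uses the open box, which lies inside.
  have h2 : ∏ _i : Fin 2, ENNReal.ofReal δ ≤ rectMeasure L (cell δ n) := by
    rw [rectMeasure, Measure.restrict_apply (measurableSet_cell n)]
    calc ∏ _i : Fin 2, ENNReal.ofReal δ = volume {x : Pt | ∀ i, x i ∈ Ioo (δ * (n i : ℕ))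
          (δ * ((n i : ℕ) + 1))} := by
          rw [volume_open_box]
          exact Finset.prod_congr rfl fun i _ => by congr 1; ring
      _ ≤ _ := by
          refine measure_mono fun x hx => ⟨fun i => Ioo_subset_Ico_self (hx i), fun i => ⟨?_, ?_⟩⟩
          · exact lt_of_le_of_lt (by positivity) (hx i).1
          · refine (hx i).2.trans_le ?_
            rw [← hN i, mul_comm]
            gcongr
            exact_mod_cast (n i).2
  rw [measureReal_def, le_antisymm h1 h2, ENNReal.toReal_prod]
  simp [ENNReal.toReal_ofReal hδ.le]

variable {X : Type*} [NormedAddCommGroup X]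

/-- The function on the rectangle with the value `F n` on the cell `n`. -/
noncomputable def step (δ : ℝ) (L : Fin 2 → ℝ) (F : (∀ i, Fin (N i)) → X) : L2Rect L X :=
  ∑ n, indicatorConstLp 2 (measurableSet_cell (δ := δ) n) (measure_ne_top (rectMeasure L) _) (F n)

lemma coeFn_step (hδ : 0 < δ) (F : (∀ i, Fin (N i)) → X) :
    ∀ᵐ x ∂(rectMeasure L), ∀ n, x ∈ cell δ n → step δ L F x = F n := by
  have h1 : ∀ᵐ x ∂(rectMeasure L), ∀ n, indicatorConstLp 2 (measurableSet_cell (δ := δ) n)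
      (measure_ne_top (rectMeasure L) _) (F n) x = (cell δ n).indicator (fun _ => F n) x :=
    ae_all_iff.2 fun n => indicatorConstLp_coeFn
  filter_upwards [h1, Lp.coeFn_finsetSum Finset.univ (fun n : ∀ i, Fin (N i) => indicatorConstLp 2
    (measurableSet_cell (δ := δ) n) (measure_ne_top (rectMeasure L) _) (F n))] with x h1 h2 n hn
  rw [step, h2, Finset.sum_apply, Finset.sum_eq_single n]
  · rw [h1, indicator_of_mem hn]
  · intro n' _ hne
    rw [h1, indicator_of_notMem fun h => hne (cell_unique hδ h hn)]
  · simp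

lemma step_add (F G : (∀ i, Fin (N i)) → X) : step δ L (F + G) = step δ L F + step δ L G := by
  simp only [step, Pi.add_apply, ← Finset.sum_add_distrib]
  exact Finset.sum_congr rfl fun n _ => indicatorConstLp_add.symm

lemma step_smul [NormedSpace ℝ X] (c : ℝ) (F : (∀ i, Fin (N i)) → X) :
    step δ L (c • F) = c • step δ L F := by
  simp only [step, Finset.smul_sum]
  refine Finset.sum_congr rfl fun n _ => ?_
  rw [indicatorConstLp, indicatorConstLp, ← MemLp.toLp_const_smul]
  congr 1
  funext x
  by_cases h : x ∈ cell δ n <;> simp [h]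

lemma inner_step_step [InnerProductSpace ℝ X] [CompleteSpace X] (hδ : 0 < δ)
    (hN : ∀ i, (N i : ℝ) * δ = L i) (F G : (∀ i, Fin (N i)) → X) :
    inner ℝ (step δ L F) (step δ L G) = δ ^ 2 * ∑ n, inner ℝ (F n) (G n) := by
  rw [step, step, sum_inner, Finset.mul_sum]
  refine Finset.sum_congr rfl fun n _ => ?_
  rw [inner_sum, Finset.sum_eq_single n]
  · rw [L2.inner_indicatorConstLp_indicatorConstLp, inter_self, rectMeasure_real_cell hδ hN,
      smul_eq_mul]
  · intro n' _ hne
    rw [L2.inner_indicatorConstLp_indicatorConstLp]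
    have : cell δ n ∩ cell δ n' = ∅ :=
      eq_empty_of_forall_notMem fun x hx => hne (cell_unique hδ hx.2 hx.1)
    simp [this]
  · simp

end Step

/-! ### Unfolding -/

namespace UnitMesh

variable {E : Type*} {Y : UnitMesh E} {δ : ℝ} {N : Fin 2 → ℕ}

lemma map_edgeMeasure (hδ : 0 < δ) (n : ∀ i, Fin (N i)) (e : E) :
    (Y.periodic.edgeMeasure e).map (δ * ·) =
      ENNReal.ofReal δ⁻¹ • (Y.mesh δ N).edgeMeasure (n, e) := by
  have hemb : MeasurableEmbedding (δ * · : ℝ → ℝ) := measurableEmbedding_mulLeft₀ hδ.ne'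
  have h : (δ * · : ℝ → ℝ) ⁻¹' (Ioo 0 (δ * Y.len e)) = Ioo 0 (Y.len e) := by
    ext s; simp only [mem_preimage, mem_Ioo, mul_pos_iff_of_pos_left hδ, mul_lt_mul_iff_right₀ hδ]
  rw [MetricGraph.edgeMeasure, MetricGraph.edgeMeasure]
  change (volume.restrict (Ioo 0 (Y.len e))).map _ = _ • volume.restrict (Ioo 0 (δ * Y.len e))
  rw [← h, ← hemb.restrict_map, Real.map_volume_mul_left hδ.ne', Measure.restrict_smul,
    abs_of_pos (inv_pos.2 hδ)]

lemma ae_dilation (hδ : 0 < δ) (n : ∀ i, Fin (N i)) (e : E) {P : ℝ → Prop}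
    (h : ∀ᵐ s ∂((Y.mesh δ N).edgeMeasure (n, e)), P s) :
    ∀ᵐ s ∂(Y.periodic.edgeMeasure e), P (δ * s) := by
  refine ae_of_ae_map (f := (δ * ·)) (by fun_prop) ?_
  rw [map_edgeMeasure hδ n e]
  exact Measure.ae_smul_measure h _

lemma integral_dilation (hδ : 0 < δ) (n : ∀ i, Fin (N i)) (e : E) (F : ℝ → ℝ) :
    ∫ s, F (δ * s) ∂(Y.periodic.edgeMeasure e) =
      δ⁻¹ * ∫ s, F s ∂((Y.mesh δ N).edgeMeasure (n, e)) := by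
  have hemb : MeasurableEmbedding (δ * · : ℝ → ℝ) := measurableEmbedding_mulLeft₀ hδ.ne'
  rw [← hemb.integral_map (μ := Y.periodic.edgeMeasure e), map_edgeMeasure hδ n e,
    integral_smul_measure, ENNReal.toReal_ofReal (inv_pos.2 hδ).le, smul_eq_mul]

lemma memLp_dilation (hδ : 0 < δ) (n : ∀ i, Fin (N i)) (e : E)
    (f : Lp ℝ 2 ((Y.mesh δ N).edgeMeasure (n, e))) :
    MemLp (fun s => f (δ * s)) 2 (Y.periodic.edgeMeasure e) := by
  have h : MemLp f 2 ((Y.periodic.edgeMeasure e).map (δ * ·)) := by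
    rw [map_edgeMeasure hδ n e]
    exact (Lp.memLp f).smul_measure ENNReal.ofReal_ne_top
  exact h.comp_of_map (by fun_prop)

lemma L2_norm_sq {α : Type*} [MeasurableSpace α] {μ : Measure α} (f : Lp ℝ 2 μ) :
    ‖f‖ ^ 2 = ∫ s, f s * f s ∂μ := by
  rw [← real_inner_self_eq_norm_sq, L2.inner_def]
  simp [pow_two]

/-- The rescaling `f ↦ f (δ ·)` of functions on an edge. -/
noncomputable def dilation (hδ : 0 < δ) (n : ∀ i, Fin (N i)) (e : E) :
    Lp ℝ 2 ((Y.mesh δ N).edgeMeasure (n, e)) →L[ℝ] Lp ℝ 2 (Y.periodic.edgeMeasure e) :=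
  LinearMap.mkContinuous
    { toFun := fun f => (memLp_dilation hδ n e f).toLp
      map_add' := fun f f' => by
        rw [← MemLp.toLp_add]
        refine MemLp.toLp_congr _ _ ?_
        filter_upwards [ae_dilation hδ n e (Lp.coeFn_add f f')] with s hs
        simpa using hs
      map_smul' := fun c f => by
        rw [RingHom.id_apply, ← MemLp.toLp_const_smul]
        refine MemLp.toLp_congr _ _ ?_
        filter_upwards [ae_dilation hδ n e (Lp.coeFn_smul c f)] with s hs
        simpa using hs }
    √δ⁻¹
    (fun f => by
      refine abs_le_of_sq_le_sq' ?_ (by positivity) |>.2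
      rw [mul_pow, Real.sq_sqrt (inv_pos.2 hδ).le, L2_norm_sq, L2_norm_sq,
        ← integral_dilation hδ n e]
      refine le_of_eq (integral_congr_ae ?_)
      filter_upwards [(memLp_dilation hδ n e f).coeFn_toLp] with s hs
      simp only [LinearMap.coe_mk, AddHom.coe_mk]
      rw [hs])

lemma coeFn_dilation (hδ : 0 < δ) (n : ∀ i, Fin (N i)) (e : E)
    (f : Lp ℝ 2 ((Y.mesh δ N).edgeMeasure (n, e))) :
    ∀ᵐ s ∂(Y.periodic.edgeMeasure e), dilation hδ n e f s = f (δ * s) :=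
  (memLp_dilation hδ n e f).coeFn_toLp

lemma norm_dilation_sq (hδ : 0 < δ) (n : ∀ i, Fin (N i)) (e : E)
    (f : Lp ℝ 2 ((Y.mesh δ N).edgeMeasure (n, e))) :
    ‖dilation hδ n e f‖ ^ 2 = δ⁻¹ * ‖f‖ ^ 2 := by
  rw [L2_norm_sq, L2_norm_sq, ← integral_dilation hδ n e]
  refine integral_congr_ae ?_
  filter_upwards [coeFn_dilation hδ n e f] with s hs
  rw [hs]

lemma primitive_dilation (hδ : 0 < δ) (n : ∀ i, Fin (N i)) (e : E)
    (f : Lp ℝ 2 ((Y.mesh δ N).edgeMeasure (n, e))) {s : ℝ} (hs : s ∈ Icc 0 (Y.len e)) :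
    δ * Y.periodic.primitive e s (dilation hδ n e f) = (Y.mesh δ N).primitive (n, e) (δ * s) f := by
  rw [MetricGraph.primitive_eq (G := Y.periodic) _ hs.2 hs.1, MetricGraph.primitive_eq
    (G := Y.mesh δ N) (e := (n, e)) f (s := δ * s) (mul_le_mul_of_nonneg_left hs.2 hδ.le)
      (mul_nonneg hδ.le hs.1),
    MetricGraph.integral_congr_of_ae (coeFn_dilation hδ n e f) hs.2 hs.1,
    intervalIntegral.integral_comp_mul_left _ hδ.ne', mul_zero, smul_eq_mul,
    mul_inv_cancel_left₀ hδ.ne']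

variable [Fintype E]

/-- The restriction of a function on the mesh to the cell `n`, as a function on the unit mesh. -/
noncomputable def cellPart (hδ : 0 < δ) (n : ∀ i, Fin (N i)) :
    (Y.mesh δ N).L2 →L[ℝ] Y.periodic.L2 :=
  ((PiLp.continuousLinearEquiv 2 ℝ
    (fun e : E => Lp ℝ 2 (Y.periodic.edgeMeasure e))).symm : _ →L[ℝ] _).comp
    (ContinuousLinearMap.pi fun e => (dilation hδ n e).comp
      (PiLp.proj 2 (𝕜 := ℝ) (fun p : (∀ i, Fin (N i)) × E =>
        Lp ℝ 2 ((Y.mesh δ N).edgeMeasure p)) (n, e)))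

lemma cellPart_apply (hδ : 0 < δ) (n : ∀ i, Fin (N i)) (v : (Y.mesh δ N).L2) (e : E) :
    cellPart hδ n v e = dilation hδ n e (v (n, e)) := rfl

lemma sum_norm_cellPart_sq (hδ : 0 < δ) (v : (Y.mesh δ N).L2) :
    ∑ n, ‖cellPart hδ n v‖ ^ 2 = δ⁻¹ * ‖v‖ ^ 2 := by
  simp only [PiLp.norm_sq_eq_of_L2]
  rw [Fintype.sum_prod_type, Finset.mul_sum]
  refine Finset.sum_congr rfl fun n _ => ?_
  rw [Finset.mul_sum]
  exact Finset.sum_congr rfl fun e _ => norm_dilation_sq hδ n e (v (n, e))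

/-- The area `δ²` of a cell times the factor `δ⁻¹` from rescaling arc length leaves `δ` in the
squared norm. This is the weight `√δ` in the a priori bounds. -/
lemma norm_step_cellPart_le (hδ : 0 < δ) {L : Fin 2 → ℝ} (hN : ∀ i, (N i : ℝ) * δ = L i)
    (v : (Y.mesh δ N).L2) : ‖step δ L fun n => cellPart hδ n v‖ ≤ √δ * ‖v‖ := by
  refine abs_le_of_sq_le_sq' ?_ (by positivity) |>.2
  rw [mul_pow, Real.sq_sqrt hδ.le, ← real_inner_self_eq_norm_sq, inner_step_step hδ hN]
  simp only [real_inner_self_eq_norm_sq]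
  rw [sum_norm_cellPart_sq]
  refine le_of_eq ?_
  field_simp

/-- The unfolding of a function on the mesh. -/
noncomputable def unfold (hδ : 0 < δ) {L : Fin 2 → ℝ} (hN : ∀ i, (N i : ℝ) * δ = L i) :
    (Y.mesh δ N).L2 →L[ℝ] L2Rect L Y.periodic.L2 :=
  LinearMap.mkContinuous
    { toFun := fun v => step δ L fun n => cellPart hδ n v
      map_add' := fun v v' => by
        rw [← step_add]; congr 1; funext n; simp
      map_smul' := fun c v => by
        rw [RingHom.id_apply, ← step_smul]; congr 1; funext n; simp }
    √δ
    (norm_step_cellPart_le hδ hN)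

lemma unfold_apply (hδ : 0 < δ) {L : Fin 2 → ℝ} (hN : ∀ i, (N i : ℝ) * δ = L i)
    (v : (Y.mesh δ N).L2) : unfold hδ hN v = step δ L fun n => cellPart hδ n v := rfl

lemma norm_unfold_le (hδ : 0 < δ) {L : Fin 2 → ℝ} (hN : ∀ i, (N i : ℝ) * δ = L i)
    (v : (Y.mesh δ N).L2) : ‖unfold hδ hN v‖ ≤ √δ * ‖v‖ :=
  norm_step_cellPart_le hδ hN v

/-- Chain rule: rescaling by `δ` multiplies the derivative by `δ`. This factor is the source of all
smallness in the limit. -/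
lemma isCellFunction_cellPart (hδ : 0 < δ) {u g : (Y.mesh δ N).L2} {a : Pt → ℝ}
    (h : (Y.mesh δ N).HasDerivWithVertexValues u g a) (n : ∀ i, Fin (N i)) :
    Y.IsCellFunction (cellPart hδ n u) (δ • cellPart hδ n g) (fun q => a (cellPoint δ n q)) := by
  intro e
  obtain ⟨h1, h2⟩ := h (n, e)
  refine ⟨Lp.ext ?_, ?_⟩
  · filter_upwards [Lp.coeFn_add (a (cellPoint δ n (Y.γ e 0)) • Y.periodic.edgeOne e)
      (Y.periodic.volterra e ((δ • cellPart hδ n g) e)),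
      Lp.coeFn_smul (a (cellPoint δ n (Y.γ e 0))) (Y.periodic.edgeOne e),
      MetricGraph.coeFn_volterra ((δ • cellPart hδ n g) e),
      MetricGraph.coeFn_edgeOne (G := Y.periodic) (e := e), coeFn_dilation hδ n e (u (n, e)),
      Y.periodic.ae_mem e, ae_dilation hδ n e h1] with s h3 h4 h5 h6 h7 h8 h9
    rw [h3, Pi.add_apply, h4, h5, Pi.smul_apply, h6, cellPart_apply, h7, h9, PiLp.smul_apply,
      map_smul, smul_eq_mul, smul_eq_mul, mul_one, cellPart_apply,
      primitive_dilation hδ n e _ (Ioo_subset_Icc_self h8), MetricGraph.primitive_eq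
        (G := Y.mesh δ N) (e := (n, e)) _ (s := δ * s) (mul_le_mul_of_nonneg_left h8.2.le hδ.le)
        (mul_nonneg hδ.le h8.1.le)]
    rfl
  · have h0 : (0 : ℝ) ≤ (Y.mesh δ N).len (n, e) := mul_nonneg hδ.le (Y.len_pos e).le
    have h3 := h2 h0
    rw [PiLp.smul_apply, map_smul, smul_eq_mul, cellPart_apply, primitive_dilation hδ n e _
      (right_mem_Icc.2 (Y.len_pos e).le)]
    refine h3.trans ?_
    rw [← MetricGraph.primitive_eq (G := Y.mesh δ N) (e := (n, e)) _ le_rfl h0]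
    rfl

end UnitMesh

/-! ### Mesh two-scale convergence and weak convergence of the unfolded functions -/

/-- Pointwise continuity of `s ↦ A s x` and a bound uniform in `s` suffice to let point and function
vary together. The use is `s ↦ ψ(x(s), y(s))`, where the `H¹`-valued function is evaluated at a
moving point. -/
lemma continuousOn_family_apply {X : Type*} [NormedAddCommGroup X] [NormedSpace ℝ X]
    {A : ℝ → X →L[ℝ] ℝ} (hA : ∀ x, Continuous fun s => A s x) {C : ℝ}
    (hC : ∀ s x, |A s x| ≤ C * ‖x‖) {S : Set ℝ} {f : ℝ → X} (hf : ContinuousOn f S) :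
    ContinuousOn (fun s => A s (f s)) S := by
  intro s₀ hs₀
  rw [ContinuousWithinAt, tendsto_iff_dist_tendsto_zero]
  have h1 : Tendsto (fun s => C * ‖f s - f s₀‖ + dist (A s (f s₀)) (A s₀ (f s₀)))
      (𝓝[S] s₀) (𝓝 0) := by
    have h2 := ((((hf s₀ hs₀).tendsto.sub_const (f s₀)).norm).const_mul C).add
      ((((hA (f s₀)).tendsto s₀).mono_left nhdsWithin_le_nhds).dist
        (tendsto_const_nhds (x := A s₀ (f s₀))))
    simpa using h2
  refine squeeze_zero (fun _ => dist_nonneg) (fun s => ?_) h1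
  refine (dist_triangle _ (A s (f s₀)) _).trans (add_le_add_left ?_ _)
  rw [Real.dist_eq, ← map_sub]
  exact hC s _

namespace UnitMesh

variable {E : Type*} {Y : UnitMesh E} {δ : ℝ} {N : Fin 2 → ℕ} {L : Fin 2 → ℝ}

lemma continuous_γ (e : E) : ContinuousOn (Y.γ e) (Icc 0 (Y.len e)) :=
  (Y.lipschitz e).choose_spec.continuousOn

lemma cellPoint_apply (n : ∀ i, Fin (N i)) (y : Pt) (i : Fin 2) :
    cellPoint δ n y i = δ * (y i + (n i : ℕ)) := by
  simp [cellPoint, mul_add]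

lemma cellPoint_mem (hδ : 0 < δ) (hN : ∀ i, (N i : ℝ) * δ = L i) (n : ∀ i, Fin (N i)) (e : E)
    {s : ℝ} (hs : s ∈ Icc 0 (Y.len e)) : cellPoint δ n (Y.γ e s) ∈ closedRect L := by
  intro i
  have h := Y.mem_cell e s hs i
  have h2 : ((n i : ℕ) : ℝ) + 1 ≤ N i := by exact_mod_cast (n i).2
  rw [cellPoint_apply, ← hN i, mul_comm _ δ]
  exact ⟨mul_nonneg hδ.le (add_nonneg h.1 (Nat.cast_nonneg _)),
    mul_le_mul_of_nonneg_left (by linarith [h.2]) hδ.le⟩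

lemma dist_cellPoint_le (hδ : 0 < δ) (n : ∀ i, Fin (N i)) (e : E)
    {s : ℝ} (hs : s ∈ Icc 0 (Y.len e)) {x : Pt} (hx : x ∈ cell δ n) :
    dist (cellPoint δ n (Y.γ e s)) x ≤ 2 * δ := by
  rw [EuclideanSpace.dist_eq]
  have : ∀ i, dist (cellPoint δ n (Y.γ e s) i) (x i) ^ 2 ≤ δ ^ 2 := fun i => by
    have h := Y.mem_cell e s hs i
    have h2 := hx i
    rw [cellPoint_apply, Real.dist_eq, sq_abs]
    refine sq_le_sq' ?_ ?_ <;> nlinarith [h.1, h.2, h2.1, h2.2]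
  refine Real.sqrt_le_iff.2 ⟨by positivity, ?_⟩
  rw [Fin.sum_univ_two]
  nlinarith [this 0, this 1]

lemma continuousOn_cellPoint (n : ∀ i, Fin (N i)) (e : E) :
    ContinuousOn (fun s => cellPoint δ n (Y.γ e s)) (Icc 0 (Y.len e)) :=
  ((continuous_γ e).add continuousOn_const).const_smul δ

variable [Fintype E]

open Classical in
/-- The function in `L²(Γ_Y)` with the value `f e s` evaluated in the point `s` of the edge `e`. -/
noncomputable def assemble (f : E → ℝ → Y.periodic.H1) : Y.periodic.L2 :=
  WithLp.toLp 2 fun e => if h : MemLp (fun s => Y.periodic.evalL e s (f e s)) 2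
    (Y.periodic.edgeMeasure e) then h.toLp else 0

lemma coeFn_assemble {f : E → ℝ → Y.periodic.H1} (hf : ∀ e, ContinuousOn (f e) (Icc 0 (Y.len e)))
    (e : E) : ∀ᵐ s ∂(Y.periodic.edgeMeasure e), assemble f e s = Y.periodic.evalL e s (f e s) := by
  have hc : ContinuousOn (fun s => Y.periodic.evalL e s (f e s)) (Icc 0 (Y.len e)) :=
    continuousOn_family_apply (A := fun s => Y.periodic.evalL e s)
      (fun x => MetricGraph.continuous_evalL x) (Y.periodic.exists_evalL_bound.choose_spec.2 e) (hf e)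
  have h : MemLp (fun s => Y.periodic.evalL e s (f e s)) 2 (Y.periodic.edgeMeasure e) := by
    obtain ⟨C, hC⟩ := isCompact_Icc.exists_bound_of_continuousOn hc
    refine MemLp.of_bound ((hc.mono Ioo_subset_Icc_self).aestronglyMeasurable measurableSet_Ioo) C ?_
    filter_upwards [Y.periodic.ae_mem e] with s hs
    exact hC s (Ioo_subset_Icc_self hs)
  have : assemble f e = h.toLp := dif_pos h
  rw [this]
  exact h.coeFn_toLp

lemma assemble_const (f : Y.periodic.H1) : assemble (fun _ _ => f) = MetricGraph.H1.toL2 f := by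
  refine PiLp.ext fun e => Lp.ext ?_
  obtain ⟨a, ha⟩ := f.2
  filter_upwards [coeFn_assemble (Y := Y) (f := fun _ _ => f) (fun e => continuousOn_const) e,
    (ha e).1, Y.periodic.ae_mem e] with s h1 h2 h3
  rw [h1, MetricGraph.evalL_eq_of_hasDeriv Y.len_pos f ha,
    MetricGraph.primitive_eq (G := Y.periodic) _ h3.2.le h3.1.le]
  exact h2.symm

variable (Y) in
-- Point evaluation is bounded uniformly on `H¹`, and the graph has finite length, so closeness in
-- `H¹` at every point gives closeness of the diagonal values in `L²`.
lemma exists_norm_assemble_sub_le : ∃ C : ℝ, 0 ≤ C ∧ ∀ (f f' : E → ℝ → Y.periodic.H1),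
    (∀ e, ContinuousOn (f e) (Icc 0 (Y.len e))) → (∀ e, ContinuousOn (f' e) (Icc 0 (Y.len e))) →
    ∀ r : ℝ, 0 ≤ r → (∀ e, ∀ s ∈ Icc 0 (Y.len e), ‖f e s - f' e s‖ ≤ r) →
    ‖assemble f - assemble f'‖ ≤ C * r := by
  obtain ⟨C, hC0, hC⟩ := Y.periodic.exists_evalL_bound
  refine ⟨√(∑ e, ((Y.periodic.edgeMeasure e).real univ ^ (2 : ℝ≥0∞).toReal⁻¹ * C) ^ 2),
    Real.sqrt_nonneg _, fun f f' hf hf' r hr h => ?_⟩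
  refine abs_le_of_sq_le_sq' ?_ (by positivity) |>.2
  rw [PiLp.norm_sq_eq_of_L2, mul_pow, Real.sq_sqrt (Finset.sum_nonneg fun e _ => by positivity),
    Finset.sum_mul]
  refine Finset.sum_le_sum fun e _ => ?_
  rw [← mul_pow]
  refine pow_le_pow_left₀ (norm_nonneg _) ?_ 2
  rw [mul_assoc]
  refine Lp.norm_le_of_ae_bound (by positivity) ?_
  filter_upwards [coeFn_assemble hf e, coeFn_assemble hf' e, Y.periodic.ae_mem e,
    Lp.coeFn_sub (assemble f e) (assemble f' e)] with s h1 h2 h3 h4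
  rw [PiLp.sub_apply, h4, Pi.sub_apply, h1, h2, ← map_sub, Real.norm_eq_abs]
  exact (hC e s _).trans (mul_le_mul_of_nonneg_left (h e s (Ioo_subset_Icc_self h3)) hC0)

/-- The values `ψ(x, x/δ)` in the cell `n`. -/
noncomputable def sample (δ : ℝ) (ψ : Pt → Y.periodic.H1) (n : ∀ i, Fin (N i)) : Y.periodic.L2 :=
  assemble fun e s => ψ (cellPoint δ n (Y.γ e s))

lemma continuousOn_sample (hδ : 0 < δ) (hN : ∀ i, (N i : ℝ) * δ = L i) {ψ : Pt → Y.periodic.H1}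
    (hψ : ContinuousOn ψ (closedRect L)) (n : ∀ i, Fin (N i)) (e : E) :
    ContinuousOn (fun s => ψ (cellPoint δ n (Y.γ e s))) (Icc 0 (Y.len e)) :=
  hψ.comp (continuousOn_cellPoint n e) fun _ hs => cellPoint_mem hδ hN n e hs

/-- The link between the two notions of convergence. The powers match since cells have area `δ²` and
the substitution `s = δ r` on an edge produces `δ⁻¹`. -/
lemma meshPairing_eq (hδ : 0 < δ) (hN : ∀ i, (N i : ℝ) * δ = L i) {ψ : Pt → Y.periodic.H1}
    (hψ : ContinuousOn ψ (closedRect L)) (v : (Y.mesh δ N).L2) :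
    δ * Y.meshPairing δ N v ψ = inner ℝ (unfold hδ hN v) (step δ L (sample (N := N) δ ψ)) := by
  rw [unfold_apply, inner_step_step hδ hN, meshPairing, Fintype.sum_prod_type, Finset.mul_sum,
    Finset.mul_sum]
  refine Finset.sum_congr rfl fun n _ => ?_
  rw [PiLp.inner_apply, Finset.mul_sum, Finset.mul_sum]
  refine Finset.sum_congr rfl fun e _ => ?_
  rw [L2.inner_def, pow_two, mul_assoc]
  congr 1
  rw [← mul_inv_cancel_left₀ hδ.ne' (∫ s, v (n, e) s * _ ∂_), ← integral_dilation hδ n e]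
  congr 1
  refine integral_congr_ae ?_
  filter_upwards [coeFn_dilation hδ n e (v (n, e)), Y.periodic.ae_mem e,
    coeFn_assemble (continuousOn_sample hδ hN hψ n) e] with s h1 h2 h3
  simp only [cellPart_apply, sample, meshParam]
  rw [h1, h3, mul_div_cancel_left₀ _ hδ.ne', MetricGraph.eval_eq (G := Y.periodic) Y.len_pos _
    (Ioo_subset_Icc_self h2), real_inner_comm]
  simp [mul_comm]

lemma closedRect_compact (L : Fin 2 → ℝ) : IsCompact (closedRect L) := by
  have h : closedRect L = (fun x : Pt => x.ofLp) ⁻¹' (pi univ fun i => Icc 0 (L i)) := by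
    ext x; simp [closedRect, -pi_univ_Icc]
  rw [h]
  exact (PiLp.homeomorph 2 (fun _ : Fin 2 => ℝ)).isCompact_preimage.2
    (isCompact_univ_pi fun i => isCompact_Icc)

lemma rect_subset_closedRect (L : Fin 2 → ℝ) : rect L ⊆ closedRect L := fun _ hx i =>
  Ioo_subset_Icc_self (hx i)

lemma memLp_of_continuousOn {X : Type*} [NormedAddCommGroup X] {f : Pt → X}
    (hf : ContinuousOn f (closedRect L)) : MemLp f 2 (rectMeasure L) := by
  obtain ⟨C, hC⟩ := (closedRect_compact L).exists_bound_of_continuousOn hf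
  refine MemLp.of_bound ?_ C ?_
  · exact (hf.mono (rect_subset_closedRect L)).aestronglyMeasurable (isOpen_rect L).measurableSet
  · filter_upwards [ae_mem_rect L] with x hx
    exact hC x (rect_subset_closedRect L hx)

open Classical in
/-- A test function as an element of `L²(Ω; L²(Γ_Y))`. -/
noncomputable def testL2 (L : Fin 2 → ℝ) (ψ : Pt → Y.periodic.H1) : L2Rect L Y.periodic.L2 :=
  if h : MemLp (fun x => MetricGraph.H1.toL2 (ψ x)) 2 (rectMeasure L) then h.toLp else 0

lemma coeFn_testL2 {ψ : Pt → Y.periodic.H1} (hψ : ContinuousOn ψ (closedRect L)) :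
    ∀ᵐ x ∂(rectMeasure L), testL2 L ψ x = MetricGraph.H1.toL2 (ψ x) := by
  have h : MemLp (fun x => MetricGraph.H1.toL2 (ψ x)) 2 (rectMeasure L) :=
    memLp_of_continuousOn (MetricGraph.H1.toL2.continuous.comp_continuousOn hψ)
  rw [testL2, dif_pos h]
  exact h.coeFn_toLp

lemma limitPairing_eq {ψ : Pt → Y.periodic.H1} (hψ : ContinuousOn ψ (closedRect L))
    (z : L2Rect L Y.periodic.L2) : Y.limitPairing L z ψ = inner ℝ z (testL2 L ψ) := by
  rw [limitPairing, L2.inner_def]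
  refine integral_congr_ae ?_
  filter_upwards [coeFn_testL2 hψ] with x hx
  rw [hx, PiLp.inner_apply]
  refine Finset.sum_congr rfl fun e _ => ?_
  rw [L2.inner_def]
  refine integral_congr_ae ?_
  filter_upwards [coeFn_assemble (Y := Y) (f := fun _ _ => ψ x) (fun e => continuousOn_const) e,
    Y.periodic.ae_mem e] with s h1 h2
  rw [← assemble_const, h1, MetricGraph.eval_eq (G := Y.periodic) Y.len_pos _
    (Ioo_subset_Icc_self h2)]
  simp [mul_comm]

/-- In a cell, the samples are taken at points at distance at most `2δ` from `x`, so the modulus of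
continuity `r` of `ψ` at that scale controls the error. -/
lemma testL2_sub_le {C : ℝ} (hC0 : 0 ≤ C) (hC : ∀ (f f' : E → ℝ → Y.periodic.H1),
    (∀ e, ContinuousOn (f e) (Icc 0 (Y.len e))) → (∀ e, ContinuousOn (f' e) (Icc 0 (Y.len e))) →
    ∀ r : ℝ, 0 ≤ r → (∀ e, ∀ s ∈ Icc 0 (Y.len e), ‖f e s - f' e s‖ ≤ r) →
    ‖assemble f - assemble f'‖ ≤ C * r)
    (hδ : 0 < δ) (hN : ∀ i, (N i : ℝ) * δ = L i) {ψ : Pt → Y.periodic.H1}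
    (hψ : ContinuousOn ψ (closedRect L)) {r : ℝ} (hr0 : 0 ≤ r)
    (hr : ∀ x ∈ closedRect L, ∀ x' ∈ closedRect L, dist x x' ≤ 2 * δ → ‖ψ x - ψ x'‖ ≤ r) :
    ‖step δ L (sample (N := N) δ ψ) - testL2 L ψ‖ ≤
      (rectMeasure L).real univ ^ (2 : ℝ≥0∞).toReal⁻¹ * (C * r) := by
  refine Lp.norm_le_of_ae_bound (by positivity) ?_
  filter_upwards [coeFn_testL2 hψ, Lp.coeFn_sub (step δ L (sample (N := N) δ ψ)) (testL2 L ψ),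
    coeFn_step (L := L) hδ (sample (N := N) δ ψ), ae_mem_rect L] with x h1 h2 h3 h4
  obtain ⟨n, hn⟩ := exists_mem_cell hδ hN h4
  rw [h2, Pi.sub_apply, h3 n hn, h1, ← assemble_const, sample]
  refine hC _ _ (continuousOn_sample hδ hN hψ n) (fun e => continuousOn_const) r hr0
    fun e s hs => hr _ (cellPoint_mem hδ hN n e hs) _ (rect_subset_closedRect L h4)
      (dist_cellPoint_le hδ n e hs hn)

end UnitMesh

/-! ### Strong convergence of sampled test functions, in time and in space -/

namespace UnitMesh

lemma norm_step_sub_le {X : Type*} [NormedAddCommGroup X] {δ : ℝ} {N : Fin 2 → ℕ} {L : Fin 2 → ℝ}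
    (hδ : 0 < δ) (hN : ∀ i, (N i : ℝ) * δ = L i) (F G : (∀ i, Fin (N i)) → X) {r : ℝ} (hr0 : 0 ≤ r)
    (hr : ∀ n, ‖F n - G n‖ ≤ r) :
    ‖step δ L F - step δ L G‖ ≤ (rectMeasure L).real univ ^ (2 : ℝ≥0∞).toReal⁻¹ * r := by
  refine Lp.norm_le_of_ae_bound hr0 ?_
  filter_upwards [Lp.coeFn_sub (step δ L F) (step δ L G), coeFn_step (L := L) hδ F,
    coeFn_step (L := L) hδ G, ae_mem_rect L] with x h2 h3 h3' h4
  obtain ⟨n, hn⟩ := exists_mem_cell hδ hN h4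
  rw [h2, Pi.sub_apply, h3 n hn, h3' n hn]
  exact hr n

variable {E : Type*} {Y : UnitMesh E} {L : Fin 2 → ℝ} {T : ℝ}

/-- Uniform continuity of `ψ` on the compact space-time cylinder makes its time slices continuous in
the supremum norm, and `Φ` is Lipschitz for that norm. -/
lemma continuousOn_time_family {X Z : Type*} [NormedAddCommGroup X] [NormedAddCommGroup Z]
    (Φ : (Pt → Z) → X) {K : ℝ} (hK : 0 ≤ K)
    (hΦ : ∀ ψ ψ', ContinuousOn ψ (closedRect L) → ContinuousOn ψ' (closedRect L) → ∀ r, 0 ≤ r →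
      (∀ x ∈ closedRect L, ‖ψ x - ψ' x‖ ≤ r) → ‖Φ ψ - Φ ψ'‖ ≤ K * r)
    {ψ : ℝ × Pt → Z} (hψ : ContinuousOn ψ (Icc 0 T ×ˢ closedRect L)) :
    ContinuousOn (fun t => Φ fun x => ψ (t, x)) (Icc 0 T) := by
  have hsec : ∀ t ∈ Icc 0 T, ContinuousOn (fun x => ψ (t, x)) (closedRect L) := fun t ht =>
    hψ.comp (by fun_prop) fun x hx => ⟨ht, hx⟩
  have hu := (isCompact_Icc.prod (closedRect_compact L)).uniformContinuousOn_of_continuous hψ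
  rw [Metric.uniformContinuousOn_iff] at hu
  rw [Metric.continuousOn_iff]
  intro t ht ε hε
  obtain ⟨d, hd, h⟩ := hu (ε / (K + 1)) (by positivity)
  refine ⟨d, hd, fun t' ht' htt => ?_⟩
  rw [dist_eq_norm]
  refine (hΦ _ _ (hsec t' ht') (hsec t ht) (ε / (K + 1)) (by positivity) fun x hx => ?_).trans_lt ?_
  · rw [← dist_eq_norm]
    exact (h _ ⟨ht', hx⟩ _ ⟨ht, hx⟩ (by rw [Prod.dist_eq, dist_self]; exact max_lt htt hd)).le
  · rw [mul_div_assoc', div_lt_iff₀ (by positivity)]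
    nlinarith

lemma memLp_time_of_continuousOn {X : Type*} [NormedAddCommGroup X] {f : ℝ → X}
    (hf : ContinuousOn f (Icc 0 T)) : MemLp f 2 (timeMeasure T) := by
  obtain ⟨C, hC⟩ := isCompact_Icc.exists_bound_of_continuousOn hf
  refine MemLp.of_bound ((hf.mono Ioo_subset_Icc_self).aestronglyMeasurable measurableSet_Ioo) C ?_
  filter_upwards [ae_restrict_mem (μ := volume) measurableSet_Ioo] with t ht
  exact hC t (Ioo_subset_Icc_self ht)

/-- Uniform continuity on a compact set gives one modulus for all times in `S`. The time set is left
general so that a single point covers the static case. -/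
lemma tendsto_of_modulus {X Z : Type*} [NormedAddCommGroup X] [NormedAddCommGroup Z]
    {Φ : ℕ → (Pt → Z) → X} {Φ₀ : (Pt → Z) → X} {δ : ℕ → ℝ} (hδ : ∀ k, 0 < δ k)
    (hδ0 : Tendsto δ atTop (𝓝 0)) {K : ℝ} (hK : 0 ≤ K)
    (hΦ : ∀ k ψ, ContinuousOn ψ (closedRect L) → ∀ r, 0 ≤ r →
      (∀ x ∈ closedRect L, ∀ x' ∈ closedRect L, dist x x' ≤ 2 * δ k → ‖ψ x - ψ x'‖ ≤ r) →
        ‖Φ k ψ - Φ₀ ψ‖ ≤ K * r)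
    {S : Set ℝ} (hS : IsCompact S) {ψ : ℝ × Pt → Z} (hψ : ContinuousOn ψ (S ×ˢ closedRect L)) {ε : ℝ}
    (hε : 0 < ε) : ∃ k₀, ∀ k ≥ k₀, ∀ t ∈ S,
      ‖Φ k (fun x => ψ (t, x)) - Φ₀ (fun x => ψ (t, x))‖ ≤ ε := by
  have hu := (hS.prod (closedRect_compact L)).uniformContinuousOn_of_continuous hψ
  rw [Metric.uniformContinuousOn_iff] at hu
  have hr0 : 0 < ε / (K + 1) := by positivity
  obtain ⟨d, hd, h⟩ := hu _ hr0
  obtain ⟨k₀, hk₀⟩ := Metric.tendsto_atTop.1 hδ0 (d / 2) (by positivity)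
  refine ⟨k₀, fun k hk t ht => ?_⟩
  have hdk : 2 * δ k < d := by
    have := hk₀ k hk
    rw [Real.dist_eq, sub_zero, abs_of_pos (hδ k)] at this
    linarith
  refine (hΦ k _ (hψ.comp (by fun_prop) fun x hx => ⟨ht, hx⟩) _ hr0.le
    fun x hx x' hx' hxx => ?_).trans ?_
  · rw [← dist_eq_norm]
    exact (h _ ⟨ht, hx⟩ _ ⟨ht, hx'⟩
      (by rw [Prod.dist_eq, dist_self]; exact max_lt hd (hxx.trans_lt hdk))).le
  · rw [mul_div_assoc', div_le_iff₀ (by positivity)]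
    nlinarith

lemma tendsto_toLp_of_uniform {X : Type*} [NormedAddCommGroup X] {F : ℕ → ℝ → X} {F₀ : ℝ → X}
    (h : ∀ ε > 0, ∃ k₀, ∀ k ≥ k₀, ∀ t ∈ Icc 0 T, ‖F k t - F₀ t‖ ≤ ε)
    (hF : ∀ k, MemLp (F k) 2 (timeMeasure T)) (hF₀ : MemLp F₀ 2 (timeMeasure T)) :
    Tendsto (fun k => (hF k).toLp) atTop (𝓝 hF₀.toLp) := by
  rw [tendsto_iff_norm_sub_tendsto_zero, Metric.tendsto_atTop]
  intro ε hε
  set W := (timeMeasure T).real univ ^ (2 : ℝ≥0∞).toReal⁻¹ with hW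
  have hW0 : 0 ≤ W := by positivity
  obtain ⟨k₀, hk₀⟩ := h (ε / (W + 1)) (by positivity)
  refine ⟨k₀, fun k hk => ?_⟩
  rw [Real.dist_eq, sub_zero, abs_of_nonneg (norm_nonneg _)]
  have hb : ‖(hF k).toLp - hF₀.toLp‖ ≤ W * (ε / (W + 1)) := by
    refine Lp.norm_le_of_ae_bound (by positivity) ?_
    filter_upwards [(hF k).coeFn_toLp, hF₀.coeFn_toLp, Lp.coeFn_sub (hF k).toLp hF₀.toLp,
      ae_restrict_mem (μ := volume) measurableSet_Ioo] with t h1 h2 h3 h4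
    rw [h3, Pi.sub_apply, h1, h2]
    exact hk₀ k hk t (Ioo_subset_Icc_self h4)
  refine hb.trans_lt ?_
  rw [mul_div_assoc', div_lt_iff₀ (by positivity)]
  nlinarith

variable [Fintype E]

/-- Mesh two-scale convergence follows from weak convergence of the unfolded functions. -/
lemma meshTwoScale_of_weakTendsto {δ : ℕ → ℝ} {N : ℕ → Fin 2 → ℕ} (hδ : ∀ k, 0 < δ k)
    (hN : ∀ k i, (N k i : ℝ) * δ k = L i) (hδ0 : Tendsto δ atTop (𝓝 0))
    {v : ∀ k, ℝ → (Y.mesh (δ k) (N k)).L2} (hv : ∀ k, MemLp (v k) 2 (timeMeasure T))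
    {U : ℕ → Lp (L2Rect L Y.periodic.L2) 2 (timeMeasure T)}
    (hU : ∀ k, ∀ᵐ t ∂(timeMeasure T), U k t = unfold (hδ k) (hN k) (v k t)) {C : ℝ}
    (hC : ∀ k, ‖U k‖ ≤ C) {Z : Lp (L2Rect L Y.periodic.L2) 2 (timeMeasure T)}
    (hZ : WeakTendsto U Z) {z : ℝ → L2Rect L Y.periodic.L2} (hz : ∀ᵐ t ∂(timeMeasure T), z t = Z t) :
    Y.MeshTwoScale L T δ N v z := by
  refine ⟨hv, (memLp_congr_ae hz).2 (Lp.memLp Z), fun ψ hψ => ?_⟩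
  replace hψ := hψ.continuousOn
  have hsec : ∀ t ∈ Icc 0 T, ContinuousOn (fun x => ψ (t, x)) (closedRect L) := fun t ht =>
    hψ.comp (by fun_prop) fun x hx => ⟨ht, hx⟩
  obtain ⟨M, hM0, hM⟩ := Y.exists_norm_assemble_sub_le
  set V := (rectMeasure L).real univ ^ (2 : ℝ≥0∞).toReal⁻¹ with hV
  have hV0 : 0 ≤ V := by positivity
  have hcont : ∀ k, ContinuousOn (fun t => step (δ k) L (sample (N := N k) (δ k) fun x => ψ (t, x)))
      (Icc 0 T) := fun k => by
    refine continuousOn_time_family (L := L) (fun ψ => step (δ k) L (sample (N := N k) (δ k) ψ))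
      (K := V * M) (by positivity) (fun ψ ψ' h h' r hr0 hr => ?_) hψ
    rw [mul_assoc]
    refine norm_step_sub_le (hδ k) (hN k) _ _ (by positivity) fun n => ?_
    exact hM _ _ (continuousOn_sample (hδ k) (hN k) h n) (continuousOn_sample (hδ k) (hN k) h' n) r
      hr0 fun e s hs => hr _ (cellPoint_mem (hδ k) (hN k) n e hs)
  have hcont' : ContinuousOn (fun t => testL2 L fun x => ψ (t, x)) (Icc 0 T) := by
    refine continuousOn_time_family (L := L) (fun ψ => testL2 L ψ)
      (K := V * M) (by positivity) (fun ψ ψ' h h' r hr0 hr => ?_) hψ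
    rw [mul_assoc]
    refine Lp.norm_le_of_ae_bound (by positivity) ?_
    filter_upwards [coeFn_testL2 h, coeFn_testL2 h', Lp.coeFn_sub (testL2 L ψ) (testL2 L ψ'),
      ae_mem_rect L] with x h1 h2 h3 h4
    rw [h3, Pi.sub_apply, h1, h2, ← assemble_const, ← assemble_const]
    exact hM _ _ (fun e => continuousOn_const) (fun e => continuousOn_const) r hr0
      fun e s hs => hr _ (rect_subset_closedRect L h4)
  -- The sampled test functions converge strongly, which is what the pairing with a weakly
  -- convergent bounded sequence requires.
  have hlim := tendsto_toLp_of_uniform (fun ε hε => tendsto_of_modulus (L := L)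
    (Φ := fun k ψ => step (δ k) L (sample (N := N k) (δ k) ψ)) (Φ₀ := fun ψ => testL2 L ψ) hδ hδ0
    (K := V * M) (by positivity) (fun k ψ h r hr0 hr => by
      rw [mul_assoc]; exact testL2_sub_le hM0 hM (hδ k) (hN k) h hr0 hr) isCompact_Icc hψ hε)
    (fun k => memLp_time_of_continuousOn (hcont k)) (memLp_time_of_continuousOn hcont')
  have hmain := hZ.inner_strong hC hlim
  have e1 : ∀ k, δ k * ∫ t, Y.meshPairing (δ k) (N k) (v k t) (fun x => ψ (t, x)) ∂(timeMeasure T) =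
      inner ℝ (U k) (memLp_time_of_continuousOn (hcont k)).toLp := fun k => by
    rw [L2.inner_def, ← integral_const_mul]
    refine integral_congr_ae ?_
    filter_upwards [(memLp_time_of_continuousOn (hcont k)).coeFn_toLp, hU k,
      ae_restrict_mem (μ := volume) measurableSet_Ioo] with t h1 h2 h3
    rw [h1, h2, meshPairing_eq (hδ k) (hN k) (hsec t (Ioo_subset_Icc_self h3))]
  have e2 : ∫ t, Y.limitPairing L (z t) (fun x => ψ (t, x)) ∂(timeMeasure T) =
      inner ℝ Z (memLp_time_of_continuousOn hcont').toLp := by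
    rw [L2.inner_def]
    refine integral_congr_ae ?_
    filter_upwards [(memLp_time_of_continuousOn hcont').coeFn_toLp, hz,
      ae_restrict_mem (μ := volume) measurableSet_Ioo] with t h1 h2 h3
    rw [h1, h2, limitPairing_eq (hsec t (Ioo_subset_Icc_self h3))]
  rw [e2]
  exact hmain.congr fun k => (e1 k).symm

/-- A weak limit of the unfolded functions agrees with a static mesh two-scale limit on test
functions. -/
lemma inner_testL2_eq {δ : ℕ → ℝ} {N : ℕ → Fin 2 → ℕ} (hδ : ∀ k, 0 < δ k)
    (hN : ∀ k i, (N k i : ℝ) * δ k = L i) (hδ0 : Tendsto δ atTop (𝓝 0))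
    {a : ∀ k, (Y.mesh (δ k) (N k)).L2} {z c : L2Rect L Y.periodic.L2}
    (hz : Y.MeshTwoScaleStatic L δ N a z) {C : ℝ} (hC : ∀ k, ‖unfold (hδ k) (hN k) (a k)‖ ≤ C)
    (hc : WeakTendsto (fun k => unfold (hδ k) (hN k) (a k)) c)
    {ψ : Pt → Y.periodic.H1} (hψ : ContDiffOn ℝ ∞ ψ (closedRect L)) :
    inner ℝ z (testL2 L ψ) = inner ℝ c (testL2 L ψ) := by
  have hψc := hψ.continuousOn
  obtain ⟨M, hM0, hM⟩ := Y.exists_norm_assemble_sub_le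
  set V := (rectMeasure L).real univ ^ (2 : ℝ≥0∞).toReal⁻¹ with hV
  have hV0 : 0 ≤ V := by positivity
  have hlim : Tendsto (fun k => step (δ k) L (sample (N := N k) (δ k) ψ)) atTop
      (𝓝 (testL2 L ψ)) := by
    rw [tendsto_iff_norm_sub_tendsto_zero, Metric.tendsto_atTop]
    intro ε hε
    -- The static case: a test function constant in time, over the one-point time set `{0}`.
    obtain ⟨k₀, hk₀⟩ := tendsto_of_modulus (L := L)
      (Φ := fun k ψ => step (δ k) L (sample (N := N k) (δ k) ψ)) (Φ₀ := fun ψ => testL2 L ψ) hδ hδ0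
      (K := V * M) (by positivity) (fun k ψ h r hr0 hr => by
        rw [mul_assoc]; exact testL2_sub_le hM0 hM (hδ k) (hN k) h hr0 hr)
      (isCompact_singleton (x := (0 : ℝ))) (ψ := fun p => ψ p.2)
      (hψc.comp (by fun_prop) fun p hp => hp.2) (half_pos hε)
    refine ⟨k₀, fun k hk => ?_⟩
    rw [Real.dist_eq, sub_zero, abs_of_nonneg (norm_nonneg _)]
    exact (hk₀ k hk 0 rfl).trans_lt (half_lt_self hε)
  have h1 := hc.inner_strong hC hlim
  have h2 := hz ψ hψ
  rw [limitPairing_eq hψc] at h2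
  refine tendsto_nhds_unique (h2.congr fun k => ?_) h1
  rw [meshPairing_eq (hδ k) (hN k) hψc]

end UnitMesh

instance : Fact ((2 : ℝ≥0∞) ≠ ⊤) := ⟨by norm_num⟩

/-! ### Density of test functions -/

lemma eq_zero_of_integral_test_eq_zero {L : Fin 2 → ℝ} {X : Type*} [NormedAddCommGroup X]
    [NormedSpace ℝ X] [CompleteSpace X] {f : Pt → X} (hf : MemLp f 2 (rectMeasure L))
    (h : ∀ φ, IsTestFunction L φ → ∫ x, φ x • f x ∂(rectMeasure L) = 0) :
    f =ᵐ[rectMeasure L] 0 := by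
  have h1 : ∀ᵐ x, x ∈ rect L → f x = 0 := by
    refine (isOpen_rect L).ae_eq_zero_of_integral_contDiff_smul_eq_zero ?_ fun g hg hc hs => ?_
    · exact IntegrableOn.locallyIntegrableOn (hf.integrable (by norm_num))
    · rw [← h g ⟨hg, hc, hs⟩, rectMeasure, setIntegral_eq_integral_of_forall_compl_eq_zero]
      intro x hx
      rw [image_eq_zero_of_notMem_tsupport fun h => hx (hs h), zero_smul]
  exact (ae_restrict_iff' (isOpen_rect L).measurableSet).2 h1

/-- A continuous function as an element of `L²(Ω)`. -/
noncomputable def contL2 (L : Fin 2 → ℝ) (η : Pt → ℝ) (hη : Continuous η) : L2Rect L ℝ :=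
  (UnitMesh.memLp_of_continuousOn (L := L) hη.continuousOn).toLp

lemma coeFn_contL2 {L : Fin 2 → ℝ} {η : Pt → ℝ} (hη : Continuous η) :
    ∀ᵐ x ∂(rectMeasure L), contL2 L η hη x = η x :=
  (UnitMesh.memLp_of_continuousOn (L := L) hη.continuousOn).coeFn_toLp

lemma inner_contL2 {L : Fin 2 → ℝ} {η : Pt → ℝ} (hη : Continuous η) (u : L2Rect L ℝ) :
    inner ℝ u (contL2 L η hη) = ∫ x, u x * η x ∂(rectMeasure L) := by
  rw [L2.inner_def]
  refine integral_congr_ae ?_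
  filter_upwards [coeFn_contL2 (L := L) hη] with x hx
  rw [hx]; simp [mul_comm]

lemma L2Rect_eq_zero {L : Fin 2 → ℝ} {u : L2Rect L ℝ}
    (h : ∀ φ (hφ : IsTestFunction L φ), inner ℝ u (contL2 L φ hφ.1.continuous) = 0) : u = 0 := by
  refine Lp.ext ((eq_zero_of_integral_test_eq_zero (Lp.memLp u) fun φ hφ => ?_).trans
    (Lp.coeFn_zero _ _ _).symm)
  rw [← h φ hφ, inner_contL2]
  exact integral_congr_ae (Eventually.of_forall fun x => mul_comm _ _)

namespace UnitMesh

variable {E : Type*} [Fintype E] {Y : UnitMesh E} {L : Fin 2 → ℝ}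

/-- A function that is smooth with compact support in the open edges, as an element of `H¹`. -/
lemma exists_H1_of_smooth (Φ : E → ℝ → ℝ) (hs : ∀ e, ContDiff ℝ ∞ (Φ e))
    (hc : ∀ e, HasCompactSupport (Φ e)) (hsupp : ∀ e, tsupport (Φ e) ⊆ Ioo 0 (Y.len e)) :
    ∃ f : Y.periodic.H1, ∀ e, (MetricGraph.H1.toL2 f e : ℝ → ℝ) =ᵐ[Y.periodic.edgeMeasure e] Φ e := by
  have hm : ∀ e, MemLp (Φ e) 2 (Y.periodic.edgeMeasure e) := fun e =>
    ((hs e).continuous.memLp_of_hasCompactSupport (hc e)).restrict _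
  have hd : ∀ e, Continuous (deriv (Φ e)) := fun e => (hs e).continuous_deriv (by simp)
  have hm' : ∀ e, MemLp (deriv (Φ e)) 2 (Y.periodic.edgeMeasure e) := fun e =>
    ((hd e).memLp_of_hasCompactSupport (hc e).deriv).restrict _
  have hz : ∀ e s, s ∉ Ioo 0 (Y.len e) → Φ e s = 0 := fun e s h =>
    image_eq_zero_of_notMem_tsupport fun h' => h (hsupp e h')
  have hint : ∀ e s, s ≤ Y.len e → 0 ≤ s →
      ∫ r in 0..s, ((hm' e).toLp (deriv (Φ e)) : ℝ → ℝ) r = Φ e s := fun e s h1 h2 => by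
    rw [MetricGraph.integral_congr_of_ae (G := Y.periodic) (hm' e).coeFn_toLp h1 h2,
      intervalIntegral.integral_deriv_eq_sub
        (fun x _ => (hs e).differentiable (by simp) x) ((hd e).intervalIntegrable _ _),
      hz e 0 (by simp), sub_zero]
  refine ⟨⟨WithLp.toLp 2 (WithLp.toLp 2 fun e => (hm e).toLp, WithLp.toLp 2 fun e => (hm' e).toLp),
    0, fun e => ⟨?_, fun _ => ?_⟩⟩, fun e => (hm e).coeFn_toLp⟩
  · filter_upwards [(hm e).coeFn_toLp, Y.periodic.ae_mem e] with s h1 h2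
    rw [Pi.zero_apply, zero_add]
    exact h1.trans (hint e s h2.2.le h2.1.le).symm
  · rw [Pi.zero_apply, Pi.zero_apply, zero_add]
    exact ((hint e (Y.len e) le_rfl (Y.len_pos e).le).trans (hz e _ (by simp))).symm

open Classical in
-- Smooth functions supported in a single open edge vanish in all vertices, hence belong to `H¹` of
-- the periodic graph, and they already determine an `L²` function on that edge.
lemma eq_zero_of_inner_H1 {h : Y.periodic.L2}
    (hh : ∀ f : Y.periodic.H1, inner ℝ h (MetricGraph.H1.toL2 f) = 0) : h = 0 := by
  refine PiLp.ext fun e => Lp.ext ?_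
  have h1 : ∀ᵐ s, s ∈ Ioo 0 (Y.len e) → h e s = 0 := by
    refine isOpen_Ioo.ae_eq_zero_of_integral_contDiff_smul_eq_zero ?_ fun g hg hc hs => ?_
    · exact IntegrableOn.locallyIntegrableOn ((Lp.memLp (h e)).integrable (by norm_num))
    · obtain ⟨f, hf⟩ := exists_H1_of_smooth (Y := Y) (fun e' => if e' = e then g else 0)
        (fun e' => by split_ifs; exacts [hg, contDiff_const])
        (fun e' => by split_ifs; exacts [hc, HasCompactSupport.zero])
        (fun e' => by
          split_ifs with h
          · exact h ▸ hs
          · simp [tsupport])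
      have h2 := hh f
      rw [PiLp.inner_apply, Finset.sum_eq_single e, L2.inner_def] at h2
      · have h4 : ∀ x, x ∉ Ioo 0 (Y.len e) → g x • h e x = 0 := fun x hx => by
          rw [image_eq_zero_of_notMem_tsupport fun h => hx (hs h), zero_smul]
        have h5 : ∫ x, g x • h e x ∂(Y.periodic.edgeMeasure e) = ∫ x, g x • h e x :=
          setIntegral_eq_integral_of_forall_compl_eq_zero h4
        rw [← h5, ← h2]
        refine integral_congr_ae ?_
        filter_upwards [hf e] with s h3
        rw [h3, if_pos rfl]; simp
      · intro e' _ hne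
        rw [L2.inner_def]
        refine integral_eq_zero_of_ae ?_
        filter_upwards [hf e'] with s h3
        rw [h3, if_neg hne]; simp
      · simp
  refine EventuallyEq.trans ?_ (Lp.coeFn_zero _ _ _).symm
  exact (ae_restrict_iff' measurableSet_Ioo).2 h1

/-- Products `φ(x) f(y)` suffice: varying `φ` localizes in `x`, and then the `f` in `H¹` of the
periodic graph determine the value in `L²(Γ_Y)`. The quantifiers over `f` and `x` are exchanged by
separability. -/
lemma eq_of_inner_testL2_eq {z c : L2Rect L Y.periodic.L2}
    (h : ∀ ψ : Pt → Y.periodic.H1, ContDiffOn ℝ ∞ ψ (closedRect L) →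
      inner ℝ z (testL2 L ψ) = inner ℝ c (testL2 L ψ)) : z = c := by
  rw [← sub_eq_zero]
  set w := z - c
  have hw : ∀ ψ : Pt → Y.periodic.H1, ContDiffOn ℝ ∞ ψ (closedRect L) →
      inner ℝ w (testL2 L ψ) = 0 := fun ψ hψ => by rw [inner_sub_left, h ψ hψ, sub_self]
  have h1 : ∀ d ∈ range (MetricGraph.H1.toL2 (G := Y.periodic)),
      ∀ᵐ x ∂(rectMeasure L), inner ℝ (w x) d = 0 := by
    rintro _ ⟨f, rfl⟩
    refine eq_zero_of_integral_test_eq_zero ((Lp.memLp w).inner_const _) fun φ hφ => ?_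
    have hψ : ContDiff ℝ ∞ (fun x => φ x • f) := hφ.1.smul contDiff_const
    rw [← hw _ hψ.contDiffOn, L2.inner_def]
    refine integral_congr_ae ?_
    filter_upwards [coeFn_testL2 (L := L) hψ.continuous.continuousOn] with x hx
    rw [hx, map_smul, inner_smul_right, smul_eq_mul]
  refine Lp.ext ?_
  filter_upwards [ae_forall_inner_eq_zero _ h1, Lp.coeFn_zero Y.periodic.L2 2 (rectMeasure L)]
    with x hx h0
  rw [h0]
  exact eq_zero_of_inner_H1 fun f => hx _ ⟨f, rfl⟩

end UnitMesh

/-! ### Difference quotients -/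

/-- The lattice vector `m`. -/
noncomputable def latticeVec (m : Fin 2 → ℤ) : Pt := WithLp.toLp 2 fun i => (m i : ℝ)

lemma latticeVec_apply (m : Fin 2 → ℤ) (i : Fin 2) : latticeVec m i = m i := rfl

/-- The point `δ (q + n)`, where `n` is the cell that contains `x`. -/
noncomputable def nearPoint (δ : ℝ) (q x : Pt) : Pt := δ • (q + latticeVec fun i => ⌊x i / δ⌋)

lemma nearPoint_apply (δ : ℝ) (q x : Pt) (i : Fin 2) :
    nearPoint δ q x i = δ * (q i + ⌊x i / δ⌋) := by
  simp [nearPoint, latticeVec, mul_add]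

/-- The geometric core of the gradient identity: moving the vertex by a lattice vector inside a
fixed cell is the same as moving the cell. -/
lemma nearPoint_add {δ : ℝ} (hδ : 0 < δ) (q x : Pt) (m : Fin 2 → ℤ) :
    nearPoint δ (q + latticeVec m) x = nearPoint δ q (x + δ • latticeVec m) := by
  ext i
  have : (x + δ • latticeVec m) i / δ = x i / δ + m i := by
    simp only [PiLp.add_apply, PiLp.smul_apply, latticeVec_apply, smul_eq_mul]
    field_simp
  rw [nearPoint_apply, nearPoint_apply, this, Int.floor_add_intCast]
  simp only [PiLp.add_apply, latticeVec_apply]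
  push_cast
  ring

lemma nearPoint_of_mem_cell {δ : ℝ} (hδ : 0 < δ) {N : Fin 2 → ℕ} {n : ∀ i, Fin (N i)} {x : Pt}
    (hx : x ∈ cell δ n) (q : Pt) : nearPoint δ q x = UnitMesh.cellPoint δ n q := by
  ext i
  have h := hx i
  have hf : ⌊x i / δ⌋ = ((n i : ℕ) : ℤ) := by
    rw [Int.floor_eq_iff, le_div_iff₀ hδ, div_lt_iff₀ hδ]
    push_cast
    exact ⟨by linarith [h.1], by linarith [h.2]⟩
  rw [nearPoint_apply, UnitMesh.cellPoint_apply, hf]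
  simp

lemma compLp_step {X Z : Type*} [NormedAddCommGroup X] [NormedSpace ℝ X] [NormedAddCommGroup Z]
    [NormedSpace ℝ Z] {δ : ℝ} {N : Fin 2 → ℕ} {L : Fin 2 → ℝ} (hδ : 0 < δ)
    (hN : ∀ i, (N i : ℝ) * δ = L i) (A : X →L[ℝ] Z) (F : (∀ i, Fin (N i)) → X) :
    A.compLp (step δ L F) = step δ L fun n => A (F n) := by
  refine Lp.ext ?_
  filter_upwards [coeFn_step (L := L) hδ F, coeFn_step (L := L) hδ (fun n => A (F n)),
    A.coeFn_compLp (step δ L F), ae_mem_rect L] with x h1 h2 h3 h4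
  obtain ⟨n, hn⟩ := exists_mem_cell hδ hN h4
  rw [h3, h1 n hn, h2 n hn]

/-- Difference quotients of smooth functions converge to the derivative. -/
lemma tendsto_diffQuot {L : Fin 2 → ℝ} {η : Pt → ℝ} (hη : ContDiff ℝ ∞ η) (hc : HasCompactSupport η)
    (m : Pt) {δ : ℕ → ℝ} (hδ : ∀ k, 0 < δ k) (hδ0 : Tendsto δ atTop (𝓝 0))
    (h1 : ∀ k, Continuous fun x => (δ k)⁻¹ * (η (x - δ k • m) - η x))
    (h2 : Continuous fun x => -fderiv ℝ η x m) :
    Tendsto (fun k => contL2 L (fun x => (δ k)⁻¹ * (η (x - δ k • m) - η x)) (h1 k)) atTop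
      (𝓝 (contL2 L (fun x => -fderiv ℝ η x m) h2)) := by
  have hd : Continuous (fderiv ℝ η) := hη.continuous_fderiv (by simp)
  have hu := hd.uniformContinuous_of_tendsto_cocompact (hc.fderiv (𝕜 := ℝ)).is_zero_at_infty
  rw [Metric.uniformContinuous_iff] at hu
  rw [tendsto_iff_norm_sub_tendsto_zero, Metric.tendsto_atTop]
  intro ε hε
  set V := (rectMeasure L).real univ ^ (2 : ℝ≥0∞).toReal⁻¹ with hV
  have hV0 : 0 ≤ V := by positivity
  set r := ε / (V * ‖m‖ + 1) with hr
  have hr0 : 0 < r := by positivity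
  obtain ⟨d, hd0, h⟩ := hu r hr0
  obtain ⟨k₀, hk₀⟩ := Metric.tendsto_atTop.1 hδ0 (d / (‖m‖ + 1)) (by positivity)
  refine ⟨k₀, fun k hk => ?_⟩
  have hdk : δ k * ‖m‖ < d := by
    have := hk₀ k hk
    rw [Real.dist_eq, sub_zero, abs_of_pos (hδ k), lt_div_iff₀ (by positivity)] at this
    nlinarith [hδ k]
  rw [Real.dist_eq, sub_zero, abs_of_nonneg (norm_nonneg _)]
  have hb : ‖contL2 L (fun x => (δ k)⁻¹ * (η (x - δ k • m) - η x)) (h1 k) -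
      contL2 L (fun x => -fderiv ℝ η x m) h2‖ ≤ V * (r * ‖m‖) := by
    refine Lp.norm_le_of_ae_bound (by positivity) ?_
    filter_upwards [coeFn_contL2 (L := L) (h1 k), coeFn_contL2 (L := L) h2, Lp.coeFn_sub
      (contL2 L (fun x => (δ k)⁻¹ * (η (x - δ k • m) - η x)) (h1 k))
      (contL2 L (fun x => -fderiv ℝ η x m) h2)] with x e1 e2 e3
    rw [e3, Pi.sub_apply, e1, e2]
    -- Mean value inequality for `η` minus its linearization at `x`, on the ball that contains the
    -- shifted point.
    have hmv := (convex_closedBall x (δ k * ‖m‖)).norm_image_sub_le_of_norm_hasFDerivWithin_le'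
      (f := η) (f' := fderiv ℝ η) (φ := fderiv ℝ η x) (C := r) (x := x) (y := x - δ k • m)
      (fun z _ => ((hη.differentiable (by simp)) z).hasFDerivAt.hasFDerivWithinAt)
      (fun z hz => by
        rw [← dist_eq_norm]
        exact (h (lt_of_le_of_lt hz hdk)).le)
      (Metric.mem_closedBall_self (by have := hδ k; positivity))
      (by simp [norm_smul, abs_of_pos (hδ k)])
    have hsub : x - δ k • m - x = -(δ k • m) := by abel
    rw [hsub, norm_neg, norm_smul, Real.norm_eq_abs (δ k), abs_of_pos (hδ k), map_neg, map_smul,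
      smul_eq_mul] at hmv
    have e4 : (δ k)⁻¹ * (η (x - δ k • m) - η x) - -fderiv ℝ η x m =
        (δ k)⁻¹ * (η (x - δ k • m) - η x - -(δ k * fderiv ℝ η x m)) := by
      have := (hδ k).ne'
      field_simp
    rw [e4, norm_mul, Real.norm_eq_abs (δ k)⁻¹, abs_of_pos (inv_pos.2 (hδ k)),
      inv_mul_le_iff₀ (hδ k)]
    linarith
  refine hb.trans_lt ?_
  rw [hr, ← mul_assoc, mul_right_comm, mul_div_assoc', div_lt_iff₀ (by positivity)]
  nlinarith

/-! ### Discrete summation by parts -/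

namespace UnitMesh

variable {E : Type*} [Fintype E] {Y : UnitMesh E} {L : Fin 2 → ℝ}

/-- The shift of test functions by a lattice vector. -/
lemma inner_step_shift {δ : ℝ} {N : Fin 2 → ℕ} (hδ : 0 < δ) (hN : ∀ i, (N i : ℝ) * δ = L i)
    (A : Pt → ℝ) (q : Pt) (m : Fin 2 → ℤ) {η : Pt → ℝ} (hη : Continuous η)
    (hη' : Continuous fun x => η (x - δ • latticeVec m))
    (h1 : ∀ᵐ x : Pt, x ∈ rect L → x - δ • latticeVec m ∉ rect L →
      A (nearPoint δ q x) = 0 ∨ η (x - δ • latticeVec m) = 0)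
    (h2 : ∀ x ∈ rect L, x + δ • latticeVec m ∉ rect L →
      A (nearPoint δ (q + latticeVec m) x) = 0 ∨ η x = 0) :
    inner ℝ (step δ L fun n : ∀ i, Fin (N i) => A (cellPoint δ n (q + latticeVec m)))
        (contL2 L η hη) =
      inner ℝ (step δ L fun n : ∀ i, Fin (N i) => A (cellPoint δ n q))
        (contL2 L (fun x => η (x - δ • latticeVec m)) hη') := by
  -- Written as an integral over the whole plane, so that translation invariance applies.
  have key : ∀ (q : Pt) {η : Pt → ℝ} (hη : Continuous η),
      inner ℝ (step δ L fun n : ∀ i, Fin (N i) => A (cellPoint δ n q)) (contL2 L η hη) =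
        ∫ x, (rect L).indicator (fun x => A (nearPoint δ q x) * η x) x := fun q η hη => by
    rw [inner_contL2, integral_indicator (isOpen_rect L).measurableSet]
    refine integral_congr_ae ?_
    filter_upwards [coeFn_step (L := L) hδ fun n : ∀ i, Fin (N i) => A (cellPoint δ n q),
      ae_mem_rect L] with x h3 h4
    obtain ⟨n, hn⟩ := exists_mem_cell hδ hN h4
    rw [h3 n hn, nearPoint_of_mem_cell hδ hn]
  rw [key, key, ← integral_sub_right_eq_self _ (δ • latticeVec m)]
  refine integral_congr_ae ?_
  filter_upwards [h1] with x h1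
  have hnp : nearPoint δ (q + latticeVec m) (x - δ • latticeVec m) = nearPoint δ q x := by
    rw [nearPoint_add hδ, sub_add_cancel]
  -- The integrands can differ only where exactly one of `x` and `x - δ m` lies in the rectangle;
  -- there `h1` and `h2` make the remaining one vanish.
  by_cases ha : x ∈ rect L <;> by_cases hb : x - δ • latticeVec m ∈ rect L
  · rw [indicator_of_mem ha, indicator_of_mem hb, hnp]
  · rw [indicator_of_mem ha, indicator_of_notMem hb]
    rcases h1 ha hb with h | h <;> simp [h]
  · rw [indicator_of_notMem ha, indicator_of_mem hb]
    rcases h2 _ hb (by rwa [sub_add_cancel]) with h | h <;> simp [h]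
  · rw [indicator_of_notMem ha, indicator_of_notMem hb]

end UnitMesh

/-! ### Nodal values and the derivative identity in the limit -/

namespace UnitMesh

variable {E : Type*} [Fintype E] {Y : UnitMesh E} {L : Fin 2 → ℝ}

variable (Y) in
/-- The mean over the unit mesh. -/
noncomputable def mean : Y.periodic.L2 →L[ℝ] ℝ := (‖Y.one‖ ^ 2)⁻¹ • innerSL ℝ Y.one

lemma one_ne_zero' (e₀ : E) : Y.one ≠ 0 := fun h => by
  have h1 : Y.periodic.edgeOne e₀ = 0 := congrArg (fun u : Y.periodic.L2 => u e₀) h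
  have h2 := MetricGraph.primitive_edgeOne (G := Y.periodic) (Y.len_pos e₀).le
  rw [h1, map_zero] at h2
  exact (Y.len_pos e₀).ne h2

lemma mean_one (e₀ : E) : Y.mean Y.one = 1 := by
  have : ‖Y.one‖ ≠ 0 := norm_ne_zero_iff.2 (one_ne_zero' e₀)
  simp only [mean, smul_apply, innerSL_apply_apply, real_inner_self_eq_norm_sq, smul_eq_mul]
  field_simp

lemma mean_compLp_tensor_one (e₀ : E) (u : L2Rect L ℝ) : Y.mean.compLp (Y.slow u) = u := by
  refine Lp.ext ?_
  filter_upwards [Y.mean.coeFn_compLp (Y.slow u),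
    (ContinuousLinearMap.toSpanSingleton ℝ Y.one).coeFn_compLp u] with x h1 h2
  rw [h1, slow, tensor, h2, ContinuousLinearMap.toSpanSingleton_apply, map_smul, mean_one e₀,
    smul_eq_mul, mul_one]

variable {δ : ℝ} {N : Fin 2 → ℕ}

/-- The operator on `L²(Ω; ·)` that acts pointwise in `Ω`. -/
noncomputable abbrev lift (L : Fin 2 → ℝ) {X Z : Type*} [NormedAddCommGroup X] [NormedSpace ℝ X]
    [NormedAddCommGroup Z] [NormedSpace ℝ Z] (A : X →L[ℝ] Z) : L2Rect L X →L[ℝ] L2Rect L Z :=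
  A.compLpL 2 (rectMeasure L)

lemma lift_apply {X Z : Type*} [NormedAddCommGroup X] [NormedSpace ℝ X]
    [NormedAddCommGroup Z] [NormedSpace ℝ Z] (A : X →L[ℝ] Z) (f : L2Rect L X) :
    lift L A f = A.compLp f := rfl

lemma coeFn_lift {X Z : Type*} [NormedAddCommGroup X] [NormedSpace ℝ X]
    [NormedAddCommGroup Z] [NormedSpace ℝ Z] (A : X →L[ℝ] Z) (f : L2Rect L X) :
    ∀ᵐ x ∂(rectMeasure L), lift L A f x = A (f x) := A.coeFn_compLp f

/-- The nodal values at the point `q` of the cells in terms of unfolded functions. -/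
lemma step_nodal (hconn : Y.graph.Connected) (e₀ : E) (hδ : 0 < δ)
    (hN : ∀ i, (N i : ℝ) * δ = L i) {u g : (Y.mesh δ N).L2} {a : Pt → ℝ}
    (h : (Y.mesh δ N).HasDerivWithVertexValues u g a) {q : Pt} (hq : q ∈ Y.vertices) :
    step δ L (fun n : ∀ i, Fin (N i) => a (cellPoint δ n q)) =
      lift L Y.mean (unfold hδ hN u) +
        δ • lift L (Y.pathFunctional e₀ q - Y.mean.comp (Y.meshPrimitive e₀)) (unfold hδ hN g) := by
  change _ = Y.mean.compLp _ + δ • (Y.pathFunctional e₀ q -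
    Y.mean.comp (Y.meshPrimitive e₀)).compLp _
  rw [unfold_apply, unfold_apply, compLp_step hδ hN, compLp_step hδ hN, ← step_smul, ← step_add]
  congr 1
  funext n
  have hc := isCellFunction_cellPart hδ h n
  have h1 := pathFunctional_eq hconn e₀ hq hc
  have h2 := hc.eq_add_meshPrimitive hconn e₀
  simp only [Pi.add_apply, Pi.smul_apply, sub_apply, ContinuousLinearMap.comp_apply, smul_eq_mul]
  -- Taking the mean of `u = a(q₀) + δ P g` expresses the nodal value at the base point by `u` and
  -- `g`, and the path functional then carries it to `q`.
  rw [h2, map_add, map_smul, mean_one e₀, map_smul, map_smul]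
  rw [map_smul] at h1
  simp only [smul_eq_mul] at h1 ⊢
  linarith

/-- The cell mean and the mean of the primitive cancel, and only path integrals of the derivative
remain. -/
lemma step_nodal_sub (hconn : Y.graph.Connected) (e₀ : E) (hδ : 0 < δ)
    (hN : ∀ i, (N i : ℝ) * δ = L i) {u g : (Y.mesh δ N).L2} {a : Pt → ℝ}
    (h : (Y.mesh δ N).HasDerivWithVertexValues u g a) {q q' : Pt} (hq : q ∈ Y.vertices)
    (hq' : q' ∈ Y.vertices) :
    step δ L (fun n : ∀ i, Fin (N i) => a (cellPoint δ n q')) -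
      step δ L (fun n : ∀ i, Fin (N i) => a (cellPoint δ n q)) =
      δ • lift L (Y.pathFunctional e₀ q' - Y.pathFunctional e₀ q) (unfold hδ hN g) := by
  rw [step_nodal hconn e₀ hδ hN h hq, step_nodal hconn e₀ hδ hN h hq', add_sub_add_left_eq_sub,
    ← smul_sub, lift_apply, lift_apply,
    lift_apply, unfold_apply, compLp_step hδ hN, compLp_step hδ hN,
    compLp_step hδ hN]
  congr 1
  rw [sub_eq_iff_eq_add, ← step_add]
  congr 1
  funext n
  simp only [Pi.add_apply, sub_apply]
  ring

/-- In the limit, differences of path functionals are derivatives. -/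
lemma shift_limit (hconn : Y.graph.Connected) (e₀ : E) {δ : ℕ → ℝ} {N : ℕ → Fin 2 → ℕ}
    (hδ : ∀ k, 0 < δ k) (hN : ∀ k i, (N k i : ℝ) * δ k = L i) (hδ0 : Tendsto δ atTop (𝓝 0))
    {u g : ∀ k, (Y.mesh (δ k) (N k)).L2} {a : ℕ → Pt → ℝ}
    (ha : ∀ k, (Y.mesh (δ k) (N k)).HasDerivWithVertexValues (u k) (g k) (a k))
    {C : ℝ} (hCu : ∀ k, ‖unfold (hδ k) (hN k) (u k)‖ ≤ C)
    (hCg : ∀ k, ‖unfold (hδ k) (hN k) (g k)‖ ≤ C) {u₀ : L2Rect L ℝ} {g₀ : L2Rect L Y.periodic.L2}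
    (hu : WeakTendsto (fun k => unfold (hδ k) (hN k) (u k)) (Y.slow u₀))
    (hg : WeakTendsto (fun k => unfold (hδ k) (hN k) (g k)) g₀)
    {q : Pt} {m : Fin 2 → ℤ} (hq : q ∈ Y.vertices) (hq' : q + latticeVec m ∈ Y.vertices)
    {η : Pt → ℝ} (hη : ContDiff ℝ ∞ η) (hc : HasCompactSupport η)
    (hηd : Continuous fun x => fderiv ℝ η x (latticeVec m))
    (hS : ∀ᶠ k in atTop,
      (∀ᵐ x : Pt, x ∈ rect L → x - δ k • latticeVec m ∉ rect L →
        a k (nearPoint (δ k) q x) = 0 ∨ η (x - δ k • latticeVec m) = 0) ∧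
      (∀ x ∈ rect L, x + δ k • latticeVec m ∉ rect L →
        a k (nearPoint (δ k) (q + latticeVec m) x) = 0 ∨ η x = 0)) :
    inner ℝ (lift L (Y.pathFunctional e₀ (q + latticeVec m) - Y.pathFunctional e₀ q) g₀)
        (contL2 L η hη.continuous) +
      inner ℝ u₀ (contL2 L (fun x => fderiv ℝ η x (latticeVec m)) hηd) = 0 := by
  have hηc := hη.continuous
  have hsh : ∀ k, Continuous fun x => η (x - δ k • latticeVec m) := fun k => by fun_prop
  have hq1 : ∀ k, Continuous fun x => (δ k)⁻¹ * (η (x - δ k • latticeVec m) - η x) := fun k => by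
    fun_prop
  set β : ℕ → L2Rect L ℝ := fun k =>
    step (δ k) L (fun n : ∀ i, Fin (N k i) => a k (cellPoint (δ k) n q)) with hβ
  set A : Y.periodic.L2 →L[ℝ] ℝ := Y.pathFunctional e₀ q - Y.mean.comp (Y.meshPrimitive e₀) with hA
  have hβ' : ∀ k, β k = lift L Y.mean (unfold (hδ k) (hN k) (u k)) +
      δ k • lift L A (unfold (hδ k) (hN k) (g k)) := fun k =>
    step_nodal hconn e₀ (hδ k) (hN k) (ha k) hq
  have hAg : ∀ k, ‖lift L A (unfold (hδ k) (hN k) (g k))‖ ≤ ‖lift L A‖ * C := fun k =>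
    ((lift L A).le_opNorm _).trans (mul_le_mul_of_nonneg_left (hCg k) (norm_nonneg _))
  have hlim0 := WeakTendsto.smul_of_bounded hδ0 hAg
  have hβw : WeakTendsto β u₀ := by
    have h1 := (hu.clm (lift L Y.mean)).add (WeakTendsto.of_tendsto hlim0)
    rw [lift_apply, mean_compLp_tensor_one e₀, add_zero] at h1
    intro z
    exact (h1 z).congr fun k => by rw [hβ' k]
  obtain ⟨C', hC'⟩ : ∃ C', ∀ k, ‖β k‖ ≤ C' := by
    obtain ⟨M, hM⟩ := hlim0.norm.bddAbove_range
    refine ⟨‖lift L Y.mean‖ * C + M, fun k => ?_⟩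
    rw [hβ' k]
    refine (norm_add_le _ _).trans (add_le_add ?_ (hM ⟨k, rfl⟩))
    exact ((lift L Y.mean).le_opNorm _).trans (mul_le_mul_of_nonneg_left (hCu k) (norm_nonneg _))
  have hηn : Continuous fun x => -fderiv ℝ η x (latticeVec m) := hηd.neg
  have hlim1 := hβw.inner_strong hC'
    (tendsto_diffQuot (L := L) hη hc (latticeVec m) hδ hδ0 hq1 hηn)
  have hlim2 := (hg.clm (lift L (Y.pathFunctional e₀ (q + latticeVec m) - Y.pathFunctional e₀ q)))
    (contL2 L η hη.continuous)
  -- Summation by parts: the difference quotient of `η` against the values at `q` equals the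
  -- difference of the values at `q + m` and `q` against `η`, divided by `δ`; by `step_nodal_sub`
  -- the factor `δ` cancels. The two weak limits then give the identity, with a minus sign from the
  -- backward shift.
  have heq : ∀ᶠ k in atTop, inner ℝ (β k)
      (contL2 L (fun x => (δ k)⁻¹ * (η (x - δ k • latticeVec m) - η x)) (hq1 k)) =
      inner ℝ (lift L (Y.pathFunctional e₀ (q + latticeVec m) - Y.pathFunctional e₀ q)
        (unfold (hδ k) (hN k) (g k))) (contL2 L η hη.continuous) := by
    filter_upwards [hS] with k hk
    have e1 : contL2 L (fun x => (δ k)⁻¹ * (η (x - δ k • latticeVec m) - η x)) (hq1 k) =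
        (δ k)⁻¹ • (contL2 L (fun x => η (x - δ k • latticeVec m)) (hsh k) -
          contL2 L η hη.continuous) := by
      refine Lp.ext ?_
      filter_upwards [coeFn_contL2 (L := L) (hq1 k), Lp.coeFn_smul (δ k)⁻¹
        (contL2 L (fun x => η (x - δ k • latticeVec m)) (hsh k) - contL2 L η hη.continuous),
        Lp.coeFn_sub (contL2 L (fun x => η (x - δ k • latticeVec m)) (hsh k))
          (contL2 L η hη.continuous), coeFn_contL2 (L := L) (hsh k),
        coeFn_contL2 (L := L) hη.continuous] with x h1 h2 h3 h4 h5
      rw [h1, h2, Pi.smul_apply, h3, Pi.sub_apply, h4, h5, smul_eq_mul]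
    have e2 := inner_step_shift (L := L) (hδ k) (hN k) (a k) q m hη.continuous (hsh k) hk.1 hk.2
    have e3 := step_nodal_sub hconn e₀ (hδ k) (hN k) (ha k) hq hq'
    rw [e1, inner_smul_right, inner_sub_right, ← e2, ← inner_sub_left, e3, inner_smul_left,
      RCLike.conj_to_real, inv_mul_cancel_left₀ (hδ k).ne']
  have h3 := tendsto_nhds_unique (hlim1.congr' heq) hlim2
  have h4 : contL2 L (fun x => -fderiv ℝ η x (latticeVec m)) hηn =
      -contL2 L (fun x => fderiv ℝ η x (latticeVec m)) hηd := by
    refine Lp.ext ?_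
    filter_upwards [coeFn_contL2 (L := L) hηd, coeFn_contL2 (L := L) hηn,
      Lp.coeFn_neg (contL2 L (fun x => fderiv ℝ η x (latticeVec m)) hηd)] with x h1 h2 h3
    rw [h2, h3, Pi.neg_apply, h1]
  rw [h4, inner_neg_right] at h3
  linarith

end UnitMesh

/-! ### Completeness of `H¹` -/

namespace MetricGraph

variable {E V : Type*} [Fintype E] {G : MetricGraph E V}

/-- The value in the target of the edge `e`. -/
noncomputable def tgtValue (G : MetricGraph E V) (e : E) : WithLp 2 (G.L2 × G.L2) →L[ℝ] ℝ :=
  G.srcValue e + (G.primitive e (G.len e)).comp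
    ((PiLp.proj 2 (𝕜 := ℝ) (fun e : E => Lp ℝ 2 (G.edgeMeasure e)) e).comp
      (WithLp.sndL 2 ℝ G.L2 G.L2))

lemma tgtValue_apply (e : E) (f : WithLp 2 (G.L2 × G.L2)) :
    G.tgtValue e f = G.srcValue e f + G.primitive e (G.len e) (f.snd e) := rfl

lemma tgtValue_eq (hlen : ∀ e, 0 < G.len e) {f : WithLp 2 (G.L2 × G.L2)} {a : V → ℝ}
    (h : G.HasDerivWithVertexValues f.fst f.snd a) (e : E) : G.tgtValue e f = a (G.tgt e) := by
  rw [tgtValue_apply, srcValue_eq hlen h,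
    (((hasDerivWithVertexValues_iff fun e => (hlen e).le).1 h) e).2]

/-- The endpoints of edges. -/
def endpoint (G : MetricGraph E V) : E ⊕ E → V := Sum.elim G.src G.tgt

/-- The values in the endpoints of edges. -/
noncomputable def endValue (G : MetricGraph E V) : E ⊕ E → WithLp 2 (G.L2 × G.L2) →L[ℝ] ℝ :=
  Sum.elim G.srcValue G.tgtValue

/-- Replaces the existence of vertex values by equations between continuous functionals, so that the
space is visibly closed. -/
lemma mem_H1_iff (hlen : ∀ e, 0 < G.len e) (f : WithLp 2 (G.L2 × G.L2)) : f ∈ G.H1 ↔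
    (∀ e, f.fst e = G.srcValue e f • G.edgeOne e + G.volterra e (f.snd e)) ∧
    ∀ p p', G.endpoint p = G.endpoint p' → G.endValue p f = G.endValue p' f := by
  constructor
  · rintro ⟨a, ha⟩
    have h : ∀ p, G.endValue p f = a (G.endpoint p) := by
      rintro (e | e)
      · exact srcValue_eq hlen ha e
      · exact tgtValue_eq hlen ha e
    refine ⟨fun e => ?_, fun p p' hp => by rw [h, h, hp]⟩
    rw [srcValue_eq hlen ha]
    exact (((hasDerivWithVertexValues_iff fun e => (hlen e).le).1 ha) e).1
  · rintro ⟨h1, h2⟩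
    classical
    obtain ⟨a, ha⟩ : ∃ a : V → ℝ, ∀ p, a (G.endpoint p) = G.endValue p f := by
      refine ⟨fun q => if h : ∃ p, G.endpoint p = q then G.endValue h.choose f else 0, fun p => ?_⟩
      have h : ∃ p', G.endpoint p' = G.endpoint p := ⟨p, rfl⟩
      simp only [dif_pos h]
      exact h2 _ _ h.choose_spec
    refine ⟨a, (hasDerivWithVertexValues_iff fun e => (hlen e).le).2 fun e => ?_⟩
    have hs : a (G.src e) = G.srcValue e f := ha (Sum.inl e)
    have ht : a (G.tgt e) = G.tgtValue e f := ha (Sum.inr e)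
    rw [hs, ht]
    exact ⟨h1 e, tgtValue_apply e f⟩

lemma isClosed_H1 (hlen : ∀ e, 0 < G.len e) : IsClosed (G.H1 : Set (WithLp 2 (G.L2 × G.L2))) := by
  have h : (G.H1 : Set (WithLp 2 (G.L2 × G.L2))) =
      (⋂ e, {f | f.fst e = G.srcValue e f • G.edgeOne e + G.volterra e (f.snd e)}) ∩
      ⋂ p, ⋂ p', ⋂ _ : G.endpoint p = G.endpoint p', {f | G.endValue p f = G.endValue p' f} := by
    ext f
    rw [SetLike.mem_coe, mem_H1_iff hlen]
    simp only [mem_inter_iff, mem_iInter, mem_ofPred_eq]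
  rw [h]
  refine IsClosed.inter (isClosed_iInter fun e => isClosed_eq ?_ ?_) ?_
  · exact ((PiLp.proj 2 (𝕜 := ℝ) (fun e : E => Lp ℝ 2 (G.edgeMeasure e)) e).comp
      (WithLp.fstL 2 ℝ G.L2 G.L2)).continuous
  · exact ((G.srcValue e).continuous.smul continuous_const).add ((G.volterra e).comp
      ((PiLp.proj 2 (𝕜 := ℝ) (fun e : E => Lp ℝ 2 (G.edgeMeasure e)) e).comp
        (WithLp.sndL 2 ℝ G.L2 G.L2))).continuous
  · exact isClosed_iInter fun p => isClosed_iInter fun p' => isClosed_iInter fun _ =>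
      isClosed_eq (G.endValue p).continuous (G.endValue p').continuous

/-- Completeness lets continuous functionals on `H¹` of the mesh be interchanged with integrals over
time. -/
lemma completeSpace_H1 (hlen : ∀ e, 0 < G.len e) : CompleteSpace G.H1 :=
  (isClosed_H1 hlen).completeSpace_coe

end MetricGraph

lemma UnitMesh.completeSpace_mesh_H1 {E : Type*} [Fintype E] {Y : UnitMesh E} {δ : ℝ} (hδ : 0 < δ)
    (N : Fin 2 → ℕ) : CompleteSpace (Y.mesh δ N).H1 :=
  MetricGraph.completeSpace_H1 fun p => mul_pos hδ (Y.len_pos p.2)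

/-! ### Time averages -/

section TimeAverage

variable {X : Type*} [NormedAddCommGroup X] [InnerProductSpace ℝ X] [CompleteSpace X] {T : ℝ}

lemma inner_setIntegral_time (U : Lp X 2 (timeMeasure T)) {S : Set ℝ} (hS : MeasurableSet S) (y : X) :
    inner ℝ (∫ t in S, U t ∂(timeMeasure T)) y =
      inner ℝ U (indicatorConstLp 2 hS (measure_ne_top _ _) y) := by
  rw [real_inner_comm, real_inner_comm (indicatorConstLp 2 hS (measure_ne_top _ _) y),
    L2.inner_indicatorConstLp_eq_inner_setIntegral ℝ hS (measure_ne_top _ _) y U]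

lemma WeakTendsto.setIntegral {U : ℕ → Lp X 2 (timeMeasure T)} {Z : Lp X 2 (timeMeasure T)}
    (h : WeakTendsto U Z) {S : Set ℝ} (hS : MeasurableSet S) :
    WeakTendsto (fun k => ∫ t in S, U k t ∂(timeMeasure T)) (∫ t in S, Z t ∂(timeMeasure T)) :=
  fun y => by simpa only [inner_setIntegral_time _ hS] using h _

lemma norm_setIntegral_time_le (U : Lp X 2 (timeMeasure T)) {S : Set ℝ} (hS : MeasurableSet S) :
    ‖∫ t in S, U t ∂(timeMeasure T)‖ ≤ ‖U‖ * (timeMeasure T).real S ^ (1 / 2 : ℝ) := by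
  set y := ∫ t in S, U t ∂(timeMeasure T) with hy
  rcases eq_or_ne y 0 with h | h
  · rw [h, norm_zero]; positivity
  have h1 : ‖y‖ * ‖y‖ ≤ ‖U‖ * (timeMeasure T).real S ^ (1 / 2 : ℝ) * ‖y‖ := by
    rw [← real_inner_self_eq_norm_mul_norm]
    conv_lhs => rw [hy, ← hy]
    calc inner ℝ y y = inner ℝ U (indicatorConstLp 2 hS (measure_ne_top _ _) y) := by
          conv_lhs => enter [2]; rw [hy]
          rw [inner_setIntegral_time U hS]
      _ ≤ ‖U‖ * ‖indicatorConstLp 2 hS (measure_ne_top (timeMeasure T) _) y‖ :=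
          real_inner_le_norm _ _
      _ = _ := by
          rw [norm_indicatorConstLp (by norm_num) (by norm_num)]
          simp only [ENNReal.toReal_ofNat]
          ring
  exact le_of_mul_le_mul_right h1 (norm_pos_iff.2 h)

lemma integrable_time {Z : Type*} [NormedAddCommGroup Z] {f : ℝ → Z} (hf : MemLp f 2 (timeMeasure T)) :
    Integrable f (timeMeasure T) := hf.integrable (by norm_num)

end TimeAverage

/-! ### The derivative identity at almost every time -/

namespace UnitMesh

variable {E : Type*} [Fintype E] {Y : UnitMesh E} {L : Fin 2 → ℝ} {T : ℝ}

variable (Y L) in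
/-- The operator `u ↦ ((x, y) ↦ u(x))`. -/
noncomputable def slowL : L2Rect L ℝ →L[ℝ] L2Rect L Y.periodic.L2 :=
  lift L (ContinuousLinearMap.toSpanSingleton ℝ Y.one)

lemma slowL_apply (u : L2Rect L ℝ) : Y.slowL L u = Y.slow u := rfl

/-- The time dependent version of `shift_limit`. -/
lemma shift_limit_ae (hconn : Y.graph.Connected) (e₀ : E) {δ : ℕ → ℝ} {N : ℕ → Fin 2 → ℕ}
    (hδ : ∀ k, 0 < δ k) (hN : ∀ k i, (N k i : ℝ) * δ k = L i) (hδ0 : Tendsto δ atTop (𝓝 0))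
    {v : ∀ k, ℝ → (Y.mesh (δ k) (N k)).H1} (hv : ∀ k, MemLp (v k) 2 (timeMeasure T))
    {P : ∀ k, Set (Y.mesh (δ k) (N k)).H1}
    (hP : ∀ k S, MeasurableSet S → ∫ t in S, v k t ∂(timeMeasure T) ∈ P k)
    {U G : ℕ → Lp (L2Rect L Y.periodic.L2) 2 (timeMeasure T)}
    (hU : ∀ k, ∀ᵐ t ∂(timeMeasure T), U k t = unfold (hδ k) (hN k) (MetricGraph.H1.toL2 (v k t)))
    (hG : ∀ k, ∀ᵐ t ∂(timeMeasure T), G k t = unfold (hδ k) (hN k) (MetricGraph.H1.deriv (v k t)))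
    {C : ℝ} (hCU : ∀ k, ‖U k‖ ≤ C) (hCG : ∀ k, ‖G k‖ ≤ C)
    {Z Zg : Lp (L2Rect L Y.periodic.L2) 2 (timeMeasure T)} (hZ : WeakTendsto U Z)
    (hZg : WeakTendsto G Zg) {V : ℝ → L2Rect L ℝ} (hV : MemLp V 2 (timeMeasure T))
    (hVZ : ∀ᵐ t ∂(timeMeasure T), Z t = Y.slow (V t))
    {q : Pt} {m : Fin 2 → ℤ} (hq : q ∈ Y.vertices) (hq' : q + latticeVec m ∈ Y.vertices)
    {η : Pt → ℝ} (hη : ContDiff ℝ ∞ η) (hc : HasCompactSupport η)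
    (hηd : Continuous fun x => fderiv ℝ η x (latticeVec m))
    (hS : ∀ᶠ k in atTop, ∀ f ∈ P k, ∀ a,
      (Y.mesh (δ k) (N k)).HasDerivWithVertexValues f.1.fst f.1.snd a →
      (∀ᵐ x : Pt, x ∈ rect L → x - δ k • latticeVec m ∉ rect L →
        a (nearPoint (δ k) q x) = 0 ∨ η (x - δ k • latticeVec m) = 0) ∧
      (∀ x ∈ rect L, x + δ k • latticeVec m ∉ rect L →
        a (nearPoint (δ k) (q + latticeVec m) x) = 0 ∨ η x = 0)) :
    ∀ᵐ t ∂(timeMeasure T),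
      inner ℝ (lift L (Y.pathFunctional e₀ (q + latticeVec m) - Y.pathFunctional e₀ q) (Zg t))
        (contL2 L η hη.continuous) +
      inner ℝ (V t) (contL2 L (fun x => fderiv ℝ η x (latticeVec m)) hηd) = 0 := by
  set A := lift L (Y.pathFunctional e₀ (q + latticeVec m) - Y.pathFunctional e₀ q) with hA
  have hZgi : Integrable (fun t => Zg t) (timeMeasure T) := integrable_time (Lp.memLp Zg)
  have hVi : Integrable V (timeMeasure T) := integrable_time hV
  have hi1 : Integrable (fun t => inner ℝ (A (Zg t)) (contL2 L η hη.continuous)) (timeMeasure T) :=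
    (A.integrable_comp hZgi).inner_const _
  have hi2 : Integrable (fun t => inner ℝ (V t)
      (contL2 L (fun x => fderiv ℝ η x (latticeVec m)) hηd)) (timeMeasure T) := hVi.inner_const _
  -- It suffices to integrate over an arbitrary measurable set `S` of times. The averages of `v k`
  -- over `S` lie in `P k`, they are functions on the mesh without time, and their unfoldings
  -- converge weakly, so `shift_limit` applies to them.
  refine Integrable.ae_eq_zero_of_forall_setIntegral_eq_zero (hi1.add hi2) fun S hSm _ => ?_
  have hvi : ∀ k, Integrable (v k) ((timeMeasure T).restrict S) := fun k =>
    (integrable_time (hv k)).restrict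
  have hcs : ∀ k, CompleteSpace (Y.mesh (δ k) (N k)).H1 := fun k => completeSpace_mesh_H1 (hδ k) _
  have eU : ∀ k, unfold (hδ k) (hN k) (MetricGraph.H1.toL2 (∫ t in S, v k t ∂(timeMeasure T))) =
      ∫ t in S, U k t ∂(timeMeasure T) := fun k => by
    rw [← ContinuousLinearMap.integral_comp_comm _ (hvi k), ← ContinuousLinearMap.integral_comp_comm
      _ (ContinuousLinearMap.integrable_comp _ (hvi k))]
    exact integral_congr_ae (ae_restrict_of_ae ((hU k).mono fun t ht => ht.symm))
  have eG : ∀ k, unfold (hδ k) (hN k) (MetricGraph.H1.deriv (∫ t in S, v k t ∂(timeMeasure T))) =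
      ∫ t in S, G k t ∂(timeMeasure T) := fun k => by
    rw [← ContinuousLinearMap.integral_comp_comm _ (hvi k), ← ContinuousLinearMap.integral_comp_comm
      _ (ContinuousLinearMap.integrable_comp _ (hvi k))]
    exact integral_congr_ae (ae_restrict_of_ae ((hG k).mono fun t ht => ht.symm))
  have eZ : ∫ t in S, Z t ∂(timeMeasure T) = Y.slow (∫ t in S, V t ∂(timeMeasure T)) := by
    rw [← slowL_apply, ← ContinuousLinearMap.integral_comp_comm _ hVi.restrict]
    exact integral_congr_ae (ae_restrict_of_ae hVZ)
  have hbd : ∀ {W : Lp (L2Rect L Y.periodic.L2) 2 (timeMeasure T)}, ‖W‖ ≤ C →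
      ‖∫ t in S, W t ∂(timeMeasure T)‖ ≤ C * (timeMeasure T).real S ^ (1 / 2 : ℝ) := fun {W} hW =>
    (norm_setIntegral_time_le W hSm).trans (mul_le_mul_of_nonneg_right hW (by positivity))
  have hw1 := hZ.setIntegral hSm
  have hw2 := hZg.setIntegral hSm
  rw [eZ] at hw1
  simp only [← eU] at hw1
  simp only [← eG] at hw2
  choose a ha using fun k => (∫ t in S, v k t ∂(timeMeasure T)).2
  have h := shift_limit hconn e₀ hδ hN hδ0 (u := fun k => MetricGraph.H1.toL2
    (∫ t in S, v k t ∂(timeMeasure T))) (g := fun k => MetricGraph.H1.deriv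
    (∫ t in S, v k t ∂(timeMeasure T))) ha
    (fun k => by rw [eU k]; exact hbd (hCU k)) (fun k => by rw [eG k]; exact hbd (hCG k))
    hw1 hw2 hq hq' hη hc hηd (hS.mono fun k hk => hk _ (hP k S hSm) _ (ha k))
  rw [integral_add hi1.restrict hi2.restrict]
  convert h using 2
  · rw [← hA, ← ContinuousLinearMap.integral_comp_comm _ hZgi.restrict]
    simp only [real_inner_comm (contL2 L η hη.continuous)]
    rw [integral_inner (A.integrable_comp hZgi).restrict]
  · simp only [real_inner_comm (contL2 L (fun x => fderiv ℝ η x (latticeVec m)) hηd)]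
    rw [integral_inner hVi.restrict]

end UnitMesh

/-! ### The Sobolev space on the rectangle as an orthogonal complement -/

section H1Rect

variable {L : Fin 2 → ℝ}

/-- The ambient space of `H¹(Ω)`. -/
abbrev GradPair (L : Fin 2 → ℝ) := WithLp 2 (L2Rect L ℝ × PiLp 2 (fun _ : Fin 2 => L2Rect L ℝ))

lemma continuous_partialDeriv {φ : Pt → ℝ} (hφ : ContDiff ℝ ∞ φ) (i : Fin 2) :
    Continuous (partialDeriv i φ) :=
  (hφ.continuous_fderiv (by simp)).clm_apply continuous_const

/-- The pair `(∂ᵢφ, φ eᵢ)`. -/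
noncomputable def testPair (L : Fin 2 → ℝ) (i : Fin 2) (φ : Pt → ℝ) (hφ : ContDiff ℝ ∞ φ) :
    GradPair L :=
  WithLp.toLp 2 (contL2 L (partialDeriv i φ) (continuous_partialDeriv hφ i),
    WithLp.toLp 2 (Pi.single i (contL2 L φ hφ.continuous)))

lemma inner_testPair (f : GradPair L) (i : Fin 2) {φ : Pt → ℝ} (hφ : ContDiff ℝ ∞ φ) :
    inner ℝ f (testPair L i φ hφ) =
      inner ℝ f.fst (contL2 L (partialDeriv i φ) (continuous_partialDeriv hφ i)) +
        inner ℝ (f.snd i) (contL2 L φ hφ.continuous) := by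
  rw [WithLp.prod_inner_apply, PiLp.inner_apply, Finset.sum_eq_single i]
  · simp [testPair]
  · intro j _ hj
    simp [testPair, hj]
  · simp

/-- Membership in `H¹(Ω)` is orthogonality to the test pairs, which gives closedness and an
orthogonal projection at once. -/
lemma mem_H1Rect_iff (f : GradPair L) :
    f ∈ H1Rect L ↔ ∀ φ (hφ : IsTestFunction L φ) i, inner ℝ f (testPair L i φ hφ.1) = 0 := by
  refine forall_congr' fun φ => forall_congr' fun hφ => forall_congr' fun i => ?_
  rw [inner_testPair, inner_contL2, inner_contL2, add_eq_zero_iff_eq_neg]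

lemma isClosed_H1Rect : IsClosed (H1Rect L : Set (GradPair L)) := by
  have h : (H1Rect L : Set (GradPair L)) = ⋂ φ, ⋂ hφ : IsTestFunction L φ, ⋂ i,
      {f | inner ℝ f (testPair L i φ hφ.1) = 0} := by
    ext f
    rw [SetLike.mem_coe, mem_H1Rect_iff]
    simp only [mem_iInter, mem_ofPred_eq]
  rw [h]
  exact isClosed_iInter fun φ => isClosed_iInter fun hφ => isClosed_iInter fun i =>
    isClosed_eq (by fun_prop) continuous_const

instance : CompleteSpace (H1Rect L) := isClosed_H1Rect.completeSpace_coe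

instance {X : Type*} [NormedAddCommGroup X] [TopologicalSpace.SeparableSpace X] :
    SecondCountableTopology (L2Rect L X) := Lp.SecondCountableTopology

/-- Identities with test pairs hold at almost every time for all test functions. -/
lemma ae_forall_testPair {T : ℝ} {ι : Type*} {f : ℝ → GradPair L} {S : ι → Prop} (i : ι → Fin 2)
    (φ : ι → Pt → ℝ) (hφ : ∀ p, S p → ContDiff ℝ ∞ (φ p))
    (h : ∀ p (hp : S p), ∀ᵐ t ∂(timeMeasure T), inner ℝ (f t) (testPair L (i p) (φ p) (hφ p hp)) = 0) :
    ∀ᵐ t ∂(timeMeasure T), ∀ p (hp : S p),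
      inner ℝ (f t) (testPair L (i p) (φ p) (hφ p hp)) = 0 := by
  have : SecondCountableTopology (GradPair L) := WithLp.secondCountableTopology 2 _ _
  have := ae_forall_inner_eq_zero (μ := timeMeasure T) (f := f)
    {c | ∃ p, ∃ hp : S p, testPair L (i p) (φ p) (hφ p hp) = c}
    (by rintro _ ⟨p, hp, rfl⟩; exact h p hp)
  filter_upwards [this] with t ht p hp
  exact ht _ ⟨p, hp, rfl⟩

end H1Rect

/-! ### The structure of the limits -/

namespace UnitMesh

variable {E : Type*} {Y : UnitMesh E}

lemma latticeVec_single (i : Fin 2) :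
    latticeVec (Pi.single i 1) = EuclideanSpace.single i (1 : ℝ) := by
  ext j
  rw [latticeVec_apply]
  by_cases h : j = i
  · subst h; simp
  · simp [h]

lemma exists_latticeVec {q q' : Pt} (h : ∀ i, (q i : UnitAddCircle) = (q' i : UnitAddCircle)) :
    ∃ m : Fin 2 → ℤ, q' = q + latticeVec m := by
  have h1 : ∀ i, ∃ m : ℤ, q' i = q i + m := fun i => by
    obtain ⟨m, hm⟩ := AddSubgroup.mem_zmultiples_iff.1 (QuotientAddGroup.eq.1 (h i))
    refine ⟨m, ?_⟩
    simp only [zsmul_eq_mul, mul_one] at hm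
    linarith
  choose m hm using h1
  refine ⟨m, ?_⟩
  ext i
  rw [PiLp.add_apply, latticeVec_apply, hm]

/-- Opposite points of the unit mesh are vertices. -/
lemma TouchesOpposite.exists_vertex (h : Y.TouchesOpposite) (i : Fin 2) :
    ∃ q ∈ Y.vertices, q + latticeVec (Pi.single i 1) ∈ Y.vertices := by
  obtain ⟨y, hy, hy'⟩ := h i
  obtain ⟨e, s, hs, rfl⟩ := mem_iUnion.1 hy
  obtain ⟨e', s', hs', hss⟩ := mem_iUnion.1 hy'
  have hcoe : ∀ j, (Y.γ e s j : UnitAddCircle) = (Y.γ e' s' j : UnitAddCircle) := fun j => by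
    rw [hss, ← latticeVec_single, PiLp.add_apply, latticeVec_apply, AddCircle.coe_add]
    have : (((Pi.single i 1 : Fin 2 → ℤ) j : ℝ) : UnitAddCircle) = 0 := by
      rw [AddCircle.coe_eq_zero_iff]
      exact ⟨(Pi.single i 1 : Fin 2 → ℤ) j, by simp⟩
    rw [this, add_zero]
  -- The two points differ by a unit vector. If one of them were inside an open edge, `separated`
  -- would make them coincide, so both are endpoints.
  have hne : Y.γ e s ≠ Y.γ e' s' := fun heq => by
    rw [hss] at heq
    have := congrArg (fun p : Pt => p i) heq
    simp at this
  have hv : ∀ {e : E} {s : ℝ}, s ∈ Icc 0 (Y.len e) → s ∉ Ioo 0 (Y.len e) →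
      Y.γ e s ∈ Y.vertices := fun {e s} hs hn => by
    rcases hs.1.eq_or_lt with h0 | h0
    · exact ⟨e, .inl (by rw [h0])⟩
    · rcases hs.2.eq_or_lt with h1 | h1
      · exact ⟨e, .inr (by rw [h1])⟩
      · exact absurd ⟨h0, h1⟩ hn
  refine ⟨Y.γ e s, hv hs fun hn => hne ?_, ?_⟩
  · obtain ⟨rfl, rfl⟩ := Y.separated e s hn e' s' hs' hcoe
    rfl
  · rw [latticeVec_single, ← hss]
    refine hv hs' fun hn => hne ?_
    obtain ⟨rfl, rfl⟩ := Y.separated e' s' hn e s hs fun j => (hcoe j).symm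
    rfl

/-- The support has positive distance `ε` from the boundary, so no boundary terms occur once `δ ‖m‖
< ε`. -/
lemma eventually_shift_of_isTestFunction {L : Fin 2 → ℝ} {δ : ℕ → ℝ} (hδ : ∀ k, 0 < δ k)
    (hδ0 : Tendsto δ atTop (𝓝 0)) (m : Pt) {φ : Pt → ℝ} (hφ : IsTestFunction L φ) :
    ∀ᶠ k in atTop, (∀ x ∈ rect L, x - δ k • m ∉ rect L → φ (x - δ k • m) = 0) ∧
      ∀ x ∈ rect L, x + δ k • m ∉ rect L → φ x = 0 := by
  obtain ⟨ε, hε, hsub⟩ := hφ.2.1.exists_thickening_subset_open (isOpen_rect L) hφ.2.2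
  have h1 : ∀ᶠ k in atTop, δ k * ‖m‖ < ε := by
    have : Tendsto (fun k => δ k * ‖m‖) atTop (𝓝 0) := by simpa using hδ0.mul_const ‖m‖
    exact this.eventually_lt_const hε
  filter_upwards [h1] with k hk
  refine ⟨fun x _ hx => image_eq_zero_of_notMem_tsupport fun h => hx (hφ.2.2 h), fun x _ hx => ?_⟩
  refine image_eq_zero_of_notMem_tsupport fun h => hx (hsub (Metric.mem_thickening_iff.2 ⟨x, h, ?_⟩))
  rw [dist_eq_norm, add_sub_cancel_left, norm_smul, Real.norm_eq_abs, abs_of_pos (hδ k)]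
  exact hk

variable [Fintype E] {L : Fin 2 → ℝ} {T : ℝ}

lemma lift_unfold_eq {X : Type*} [NormedAddCommGroup X] [NormedSpace ℝ X] {δ : ℝ} {N : Fin 2 → ℕ}
    (hδ : 0 < δ) (hN : ∀ i, (N i : ℝ) * δ = L i) (A B : Y.periodic.L2 →L[ℝ] X)
    {u g : (Y.mesh δ N).L2} (h : ∀ n, A (cellPart hδ n u) = δ • B (cellPart hδ n g)) :
    lift L A (unfold hδ hN u) = δ • lift L B (unfold hδ hN g) := by
  rw [lift_apply, lift_apply, unfold_apply, unfold_apply, compLp_step hδ hN, compLp_step hδ hN,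
    ← step_smul]
  congr 1
  funext n
  exact h n

/-- Weak limits satisfy the linear relations of the sequence. -/
lemma relation_limit {X Z : Type*} [NormedAddCommGroup X] [InnerProductSpace ℝ X] [CompleteSpace X]
    [NormedAddCommGroup Z] [InnerProductSpace ℝ Z] [CompleteSpace Z] (A B : X →L[ℝ] Z) {δ : ℕ → ℝ}
    (hδ0 : Tendsto δ atTop (𝓝 0)) {U G : ℕ → Lp X 2 (timeMeasure T)} {C : ℝ} (hG : ∀ k, ‖G k‖ ≤ C)
    (h : ∀ k, ∀ᵐ t ∂(timeMeasure T), A (U k t) = δ k • B (G k t)) {u : Lp X 2 (timeMeasure T)}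
    (hu : WeakTendsto U u) : ∀ᵐ t ∂(timeMeasure T), A (u t) = 0 := by
  have h1 := hu.clm (A.compLpL 2 (timeMeasure T))
  have h2 : ∀ k, A.compLpL 2 (timeMeasure T) (U k) = δ k • B.compLpL 2 (timeMeasure T) (G k) :=
    fun k => Lp.ext (by
      filter_upwards [A.coeFn_compLpL (U k), B.coeFn_compLpL (G k), Lp.coeFn_smul (δ k)
        (B.compLpL 2 (timeMeasure T) (G k)), h k] with t h1 h2 h3 h4
      rw [h1, h3, Pi.smul_apply, h2, h4])
  simp only [h2] at h1
  have h3 := WeakTendsto.smul_of_bounded hδ0 (x := fun k => B.compLpL 2 (timeMeasure T) (G k))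
    (C := ‖B.compLpL 2 (timeMeasure T)‖ * C) fun k =>
      ((B.compLpL 2 (timeMeasure T)).le_opNorm _).trans
        (mul_le_mul_of_nonneg_left (hG k) (norm_nonneg _))
  have h4 := h1.unique (WeakTendsto.of_tendsto h3)
  filter_upwards [A.coeFn_compLpL u, Lp.coeFn_zero Z 2 (timeMeasure T)] with t h5 h6
  rw [← h5, h4, h6, Pi.zero_apply]

variable (Y) in
/-- The part of a function on the unit mesh with vanishing mean. -/
noncomputable def fluct : Y.periodic.L2 →L[ℝ] Y.periodic.L2 :=
  ContinuousLinearMap.id ℝ _ - Y.mean.smulRight Y.one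

lemma fluct_apply (h : Y.periodic.L2) : Y.fluct h = h - Y.mean h • Y.one := rfl

lemma eq_slow_of_lift_fluct {z : L2Rect L Y.periodic.L2} (h : lift L Y.fluct z = 0) :
    z = Y.slow (lift L Y.mean z) := by
  refine Lp.ext ?_
  filter_upwards [coeFn_lift Y.fluct z, coeFn_lift Y.mean z, coeFn_lift
    (ContinuousLinearMap.toSpanSingleton ℝ Y.one) (lift L Y.mean z),
    Lp.coeFn_zero Y.periodic.L2 2 (rectMeasure L)] with x h1 h2 h3 h4
  rw [← slowL_apply, slowL, h3, h2, ContinuousLinearMap.toSpanSingleton_apply]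
  rw [h, h4, Pi.zero_apply, fluct_apply] at h1
  exact sub_eq_zero.1 h1.symm

lemma lift_fluct_slow (e₀ : E) (u : L2Rect L ℝ) : lift L Y.fluct (Y.slow u) = 0 := by
  refine Lp.ext ?_
  filter_upwards [coeFn_lift Y.fluct (Y.slow u), coeFn_lift
    (ContinuousLinearMap.toSpanSingleton ℝ Y.one) u,
    Lp.coeFn_zero Y.periodic.L2 2 (rectMeasure L)] with x h1 h3 h4
  rw [h1, h4, ← slowL_apply, slowL, h3, ContinuousLinearMap.toSpanSingleton_apply, fluct_apply,
    map_smul, mean_one e₀]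
  simp

end UnitMesh

/-! ### The limit of the derivatives -/

/-- The `i`-th weak partial derivative as an operator. -/
noncomputable def H1Rect.gradL {L : Fin 2 → ℝ} (i : Fin 2) : H1Rect L →L[ℝ] L2Rect L ℝ :=
  (PiLp.proj 2 (𝕜 := ℝ) (fun _ : Fin 2 => L2Rect L ℝ) i).comp
    ((WithLp.sndL 2 ℝ (L2Rect L ℝ) (PiLp 2 (fun _ : Fin 2 => L2Rect L ℝ))).comp (H1Rect L).subtypeL)

namespace UnitMesh

variable {E : Type*} [Fintype E] {Y : UnitMesh E} {L : Fin 2 → ℝ} {T : ℝ}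

variable (Y L T) in
/-- The unfolded functions `U k`, `G k` of `v k` and its derivative are bounded and converge weakly
to `Z` and `Zg`. -/
structure IsUnfoldedLimit {δ : ℕ → ℝ} {N : ℕ → Fin 2 → ℕ} (hδ : ∀ k, 0 < δ k)
    (hN : ∀ k i, (N k i : ℝ) * δ k = L i) (v : ∀ k, ℝ → (Y.mesh (δ k) (N k)).H1)
    (U G : ℕ → Lp (L2Rect L Y.periodic.L2) 2 (timeMeasure T))
    (Z Zg : Lp (L2Rect L Y.periodic.L2) 2 (timeMeasure T)) (C : ℝ) : Prop where
  tendsto_zero : Tendsto δ atTop (𝓝 0)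
  memLp : ∀ k, MemLp (v k) 2 (timeMeasure T)
  unfold_eq : ∀ k, ∀ᵐ t ∂(timeMeasure T),
    U k t = unfold (hδ k) (hN k) (MetricGraph.H1.toL2 (v k t))
  unfold_deriv_eq : ∀ k, ∀ᵐ t ∂(timeMeasure T),
    G k t = unfold (hδ k) (hN k) (MetricGraph.H1.deriv (v k t))
  norm_le : ∀ k, ‖U k‖ ≤ C
  norm_deriv_le : ∀ k, ‖G k‖ ≤ C
  tendsto : WeakTendsto U Z
  tendsto_deriv : WeakTendsto G Zg

lemma fluct_one (e₀ : E) : Y.fluct Y.one = 0 := by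
  rw [fluct_apply, mean_one e₀, one_smul, sub_self]

lemma finite_vertices : (Y.vertices).Finite := by
  have : Y.vertices = range (fun e => Y.γ e 0) ∪ range (fun e => Y.γ e (Y.len e)) := by
    ext q
    constructor
    · rintro ⟨e, rfl | rfl⟩
      · exact .inl ⟨e, rfl⟩
      · exact .inr ⟨e, rfl⟩
    · rintro (⟨e, rfl⟩ | ⟨e, rfl⟩)
      · exact src_mem_vertices e
      · exact tgt_mem_vertices e
  rw [this]
  exact (finite_range _).union (finite_range _)

variable (Y) in
/-- This functional vanishes on derivatives of functions on the unit mesh. -/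
noncomputable def edgeDefect (e₀ e : E) : Y.periodic.L2 →L[ℝ] ℝ :=
  Y.pathFunctional e₀ (Y.γ e (Y.len e)) - Y.pathFunctional e₀ (Y.γ e 0) - Y.edgeIntegral e

lemma edgeDefect_apply (e₀ e : E) (h : Y.periodic.L2) : Y.edgeDefect e₀ e h =
    Y.pathFunctional e₀ (Y.γ e (Y.len e)) h - Y.pathFunctional e₀ (Y.γ e 0) h -
      Y.edgeIntegral e h := rfl

lemma edgeDefect_eq_zero (hconn : Y.graph.Connected) (e₀ e : E) {u g : Y.periodic.L2} {a : Pt → ℝ}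
    (h : Y.IsCellFunction u g a) : Y.edgeDefect e₀ e g = 0 := by
  have h1 : a (Y.γ e (Y.len e)) = a (Y.γ e 0) + Y.edgeIntegral e g := (h e).2
  rw [edgeDefect_apply, ← pathFunctional_eq hconn e₀ (src_mem_vertices e) h,
    ← pathFunctional_eq hconn e₀ (tgt_mem_vertices e) h, h1]
  ring

lemma edgeDefect_tangent (hconn : Y.graph.Connected) (e₀ e : E) (i : Fin 2) :
    Y.edgeDefect e₀ e (Y.tangent i) = 0 := by
  rw [edgeDefect_apply, pathFunctional_tangent hconn e₀ (src_mem_vertices e),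
    pathFunctional_tangent hconn e₀ (tgt_mem_vertices e), edgeIntegral_tangent]
  ring

variable (Y L) in
/-- The slow derivative as an operator. -/
noncomputable def slowDerivL : H1Rect L →L[ℝ] L2Rect L Y.periodic.L2 :=
  ∑ i, (lift L (ContinuousLinearMap.toSpanSingleton ℝ (Y.tangent i))).comp (H1Rect.gradL i)

lemma slowDerivL_apply (u : H1Rect L) : Y.slowDerivL L u = Y.slowDeriv u := by
  rw [slowDerivL, sum_apply]
  rfl

lemma coeFn_slowDeriv (u : H1Rect L) : ∀ᵐ x ∂(rectMeasure L),
    Y.slowDeriv u x = ∑ i, H1Rect.grad u i x • Y.tangent i := by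
  have h1 : ∀ i, ∀ᵐ x ∂(rectMeasure L), Y.tensor (H1Rect.grad u i) (Y.tangent i) x =
      H1Rect.grad u i x • Y.tangent i := fun i =>
    (ContinuousLinearMap.toSpanSingleton ℝ (Y.tangent i)).coeFn_compLp (H1Rect.grad u i)
  rw [slowDeriv, Fin.sum_univ_two]
  filter_upwards [Lp.coeFn_add (Y.tensor (H1Rect.grad u 0) (Y.tangent 0))
    (Y.tensor (H1Rect.grad u 1) (Y.tangent 1)), h1 0, h1 1] with x h h0 h1
  rw [h, Pi.add_apply, h0, h1, Fin.sum_univ_two]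

lemma memLp_slowDeriv {v0 : ℝ → H1Rect L} (hv0 : MemLp v0 2 (timeMeasure T)) :
    MemLp (fun t => Y.slowDeriv (v0 t)) 2 (timeMeasure T) :=
  ((Y.slowDerivL L).comp_memLp' hv0).ae_eq (Eventually.of_forall fun t => slowDerivL_apply (v0 t))

lemma memLp_lift {X Z : Type*} [NormedAddCommGroup X] [NormedSpace ℝ X] [NormedAddCommGroup Z]
    [NormedSpace ℝ Z] (A : X →L[ℝ] Z) {f : ℝ → L2Rect L X} (hf : MemLp f 2 (timeMeasure T)) :
    MemLp (fun t => lift L A (f t)) 2 (timeMeasure T) :=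
  (lift L A).comp_memLp' hf

/-- A function whose values satisfy the cycle conditions up to a slow gradient is the sum of a slow
and a fast derivative. -/
lemma fastDeriv_eq (hconn : Y.graph.Connected) (e₀ : E) {A : Y.periodic.L2 →L[ℝ] Y.periodic.H1}
    (hA : ∀ h ∈ Y.periodicDerivs e₀, MetricGraph.H1.deriv (A h) = h) {g : L2Rect L Y.periodic.L2}
    {u : H1Rect L} (h1 : ∀ e, lift L (Y.edgeDefect e₀ e) g = 0)
    (h2 : ∀ q ∈ Y.vertices, ∀ q' ∈ Y.vertices, (∀ i, (q i : UnitAddCircle) = (q' i : UnitAddCircle)) →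
      lift L (Y.pathFunctional e₀ q' - Y.pathFunctional e₀ q) g =
        ∑ i, (q' i - q i) • H1Rect.grad u i) :
    Y.fastDeriv (lift L A (g - Y.slowDeriv u)) = g - Y.slowDeriv u := by
  have hv : (Y.vertices).Countable := finite_vertices.countable
  have h1' : ∀ᵐ x ∂(rectMeasure L), ∀ e, Y.edgeDefect e₀ e (g x) = 0 := by
    refine ae_all_iff.2 fun e => ?_
    filter_upwards [coeFn_lift (Y.edgeDefect e₀ e) g, Lp.coeFn_zero ℝ 2 (rectMeasure L)]
      with x hx hx0
    rw [← hx, h1 e, hx0, Pi.zero_apply]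
  have h2' : ∀ᵐ x ∂(rectMeasure L), ∀ q ∈ Y.vertices, ∀ q' ∈ Y.vertices,
      (∀ i, (q i : UnitAddCircle) = (q' i : UnitAddCircle)) →
      Y.pathFunctional e₀ q' (g x) - Y.pathFunctional e₀ q (g x) =
        ∑ i, (q' i - q i) * H1Rect.grad u i x := by
    refine (ae_ball_iff hv).2 fun q hq => (ae_ball_iff hv).2 fun q' hq' => ?_
    by_cases hqq : ∀ i, (q i : UnitAddCircle) = (q' i : UnitAddCircle)
    · have h3 := h2 q hq q' hq' hqq
      rw [Fin.sum_univ_two] at h3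
      filter_upwards [coeFn_lift (Y.pathFunctional e₀ q' - Y.pathFunctional e₀ q) g,
        Lp.coeFn_add ((q' 0 - q 0) • H1Rect.grad u 0) ((q' 1 - q 1) • H1Rect.grad u 1),
        Lp.coeFn_smul (q' 0 - q 0) (H1Rect.grad u 0),
        Lp.coeFn_smul (q' 1 - q 1) (H1Rect.grad u 1)] with x h4 h5 h6 h7 _
      rw [sub_apply] at h4
      rw [← h4, h3, h5, Pi.add_apply, h6, h7, Fin.sum_univ_two]
      rfl
    · exact Eventually.of_forall fun x h => absurd h hqq
  refine Lp.ext ?_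
  filter_upwards [h1', h2', coeFn_slowDeriv (Y := Y) u, Lp.coeFn_sub g (Y.slowDeriv u),
    coeFn_lift A (g - Y.slowDeriv u), (MetricGraph.H1.deriv (G := Y.periodic)).coeFn_compLp
      (lift L A (g - Y.slowDeriv u))] with x h3 h4 h5 h6 h7 h8
  rw [fastDeriv, h8, h7]
  refine hA _ ?_
  rw [h6, Pi.sub_apply, h5]
  refine ⟨fun e => ?_, fun q hq q' hq' hqq => ?_⟩
  · rw [← sub_eq_zero, ← sub_sub, ← edgeDefect_apply, map_sub, h3 e, map_sum]
    simp [edgeDefect_tangent hconn]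
  -- Between identified vertices the tangent field integrates to `q' - q`, so subtracting the slow
  -- gradient removes exactly the increment of the path integral of `g`.
  · have h9 := h4 q hq q' hq' hqq
    simp only [map_sub, map_add, map_smul, pathFunctional_tangent hconn e₀ hq,
      pathFunctional_tangent hconn e₀ hq', Fin.sum_univ_two, smul_eq_mul] at h9 ⊢
    linarith

namespace IsUnfoldedLimit

variable {δ : ℕ → ℝ} {N : ℕ → Fin 2 → ℕ} {hδ : ∀ k, 0 < δ k}
  {hN : ∀ k i, (N k i : ℝ) * δ k = L i} {v : ∀ k, ℝ → (Y.mesh (δ k) (N k)).H1}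
  {U G : ℕ → Lp (L2Rect L Y.periodic.L2) 2 (timeMeasure T)}
  {Z Zg : Lp (L2Rect L Y.periodic.L2) 2 (timeMeasure T)} {C : ℝ}

/-- Apply `fluct` to a cell function: the constant disappears and `δ` times a bounded image of the
unfolded derivative remains. Hence the fluctuation of the weak limit is zero. -/
lemma eq_slow (h : IsUnfoldedLimit Y L T hδ hN v U G Z Zg C) (hconn : Y.graph.Connected) (e₀ : E) :
    ∀ᵐ t ∂(timeMeasure T), Z t = Y.slow (lift L Y.mean (Z t)) := by
  have h1 := relation_limit (lift L Y.fluct) (lift L (Y.fluct.comp (Y.meshPrimitive e₀)))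
    h.tendsto_zero h.norm_deriv_le (U := U) (fun k => ?_) h.tendsto
  · exact h1.mono fun t ht => eq_slow_of_lift_fluct ht
  · filter_upwards [h.unfold_eq k, h.unfold_deriv_eq k] with t h1 h2
    rw [h1, h2]
    refine lift_unfold_eq (hδ k) (hN k) _ _ fun n => ?_
    obtain ⟨a, ha⟩ := (v k t).2
    have h3 := (isCellFunction_cellPart (hδ k) ha n).eq_add_meshPrimitive hconn e₀
    change Y.fluct (cellPart (hδ k) n (v k t).1.fst) = _
    rw [h3, map_add, map_smul, fluct_one e₀, smul_zero, zero_add, map_smul, map_smul]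
    rfl

/-- The edge defect vanishes on the derivative of each cell function, after division by the factor
`δ`; an exact linear relation passes to the weak limit. -/
lemma edgeDefect_eq_zero (h : IsUnfoldedLimit Y L T hδ hN v U G Z Zg C)
    (hconn : Y.graph.Connected) (e₀ e : E) :
    ∀ᵐ t ∂(timeMeasure T), lift L (Y.edgeDefect e₀ e) (Zg t) = 0 := by
  refine relation_limit (lift L (Y.edgeDefect e₀ e)) (0 : L2Rect L Y.periodic.L2 →L[ℝ] L2Rect L ℝ)
    h.tendsto_zero h.norm_deriv_le (U := G) (fun k => ?_) h.tendsto_deriv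
  filter_upwards [h.unfold_deriv_eq k] with t h2
  have h3 := lift_unfold_eq (hδ k) (hN k) (Y.edgeDefect e₀ e) 0
    (u := MetricGraph.H1.deriv (v k t)) (g := MetricGraph.H1.deriv (v k t)) fun n => ?_
  · rw [h2, h3, zero_apply, smul_zero]
    have : lift L (0 : Y.periodic.L2 →L[ℝ] ℝ) = 0 := by
      ext1 f
      refine Lp.ext ?_
      filter_upwards [coeFn_lift (0 : Y.periodic.L2 →L[ℝ] ℝ) f, Lp.coeFn_zero ℝ 2 (rectMeasure L)]
        with x h4 h5
      rw [h4, zero_apply, zero_apply, h5, Pi.zero_apply]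
    rw [this, zero_apply, smul_zero]
  · obtain ⟨a, ha⟩ := (v k t).2
    have h3 := UnitMesh.edgeDefect_eq_zero hconn e₀ e (isCellFunction_cellPart (hδ k) ha n)
    rw [map_smul, smul_eq_zero] at h3
    rw [zero_apply, smul_zero]
    exact h3.resolve_left (hδ k).ne'

lemma shift_identity (h : IsUnfoldedLimit Y L T hδ hN v U G Z Zg C) (hconn : Y.graph.Connected)
    (e₀ : E) {q : Pt} {m : Fin 2 → ℤ} (hq : q ∈ Y.vertices) (hq' : q + latticeVec m ∈ Y.vertices)
    {φ : Pt → ℝ} (hφ : IsTestFunction L φ)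
    (hφd : Continuous fun x => fderiv ℝ φ x (latticeVec m)) :
    ∀ᵐ t ∂(timeMeasure T),
      inner ℝ (lift L (Y.pathFunctional e₀ (q + latticeVec m) - Y.pathFunctional e₀ q) (Zg t))
        (contL2 L φ hφ.1.continuous) +
      inner ℝ (lift L Y.mean (Z t)) (contL2 L (fun x => fderiv ℝ φ x (latticeVec m)) hφd) = 0 := by
  refine shift_limit_ae hconn e₀ hδ hN h.tendsto_zero h.memLp (P := fun _ => univ)
    (fun _ _ _ => mem_univ _) h.unfold_eq h.unfold_deriv_eq h.norm_le h.norm_deriv_le h.tendsto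
    h.tendsto_deriv ((lift L Y.mean).comp_memLp' (Lp.memLp Z)) (h.eq_slow hconn e₀) hq hq' hφ.1
    hφ.2.1 hφd ?_
  filter_upwards [eventually_shift_of_isTestFunction hδ h.tendsto_zero (latticeVec m) hφ]
    with k hk f _ a _
  exact ⟨Eventually.of_forall fun x hx hx' => .inr (hk.1 x hx hx'), fun x hx hx' => .inr (hk.2 x hx hx')⟩

/-- The weak limit is a slow function in `H¹(Ω)`. -/
lemma exists_slow (h : IsUnfoldedLimit Y L T hδ hN v U G Z Zg C) (hconn : Y.graph.Connected)
    (hopp : Y.TouchesOpposite) (e₀ : E) :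
    ∃ v0 : ℝ → H1Rect L, MemLp v0 2 (timeMeasure T) ∧
      (∀ᵐ t ∂(timeMeasure T), H1Rect.toL2 (v0 t) = lift L Y.mean (Z t)) ∧
      ∀ q m, q ∈ Y.vertices → q + latticeVec m ∈ Y.vertices → ∀ᵐ t ∂(timeMeasure T),
        lift L (Y.pathFunctional e₀ (q + latticeVec m) - Y.pathFunctional e₀ q) (Zg t) =
          ∑ i, (m i : ℝ) • H1Rect.grad (v0 t) i := by
  choose q hq hq' using hopp.exists_vertex
  -- `D i` applied to `Zg t` is the candidate for the `i`-th partial derivative: the path integral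
  -- between two opposite vertices.
  set D : Fin 2 → L2Rect L Y.periodic.L2 →L[ℝ] L2Rect L ℝ := fun i =>
    lift L (Y.pathFunctional e₀ (q i + latticeVec (Pi.single i 1)) - Y.pathFunctional e₀ (q i)) with hD
  set f : ℝ → GradPair L := fun t => WithLp.toLp 2 (lift L Y.mean (Z t),
    WithLp.toLp 2 fun i => D i (Zg t)) with hf
  have hfm : MemLp f 2 (timeMeasure T) := by
    let A : L2Rect L Y.periodic.L2 →L[ℝ] GradPair L :=
      ((WithLp.prodContinuousLinearEquiv 2 ℝ (L2Rect L ℝ)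
        (PiLp 2 (fun _ : Fin 2 => L2Rect L ℝ))).symm : _ →L[ℝ] _).comp
        ((lift L Y.mean).prod
          (0 : L2Rect L Y.periodic.L2 →L[ℝ] PiLp 2 (fun _ : Fin 2 => L2Rect L ℝ)))
    let B : L2Rect L Y.periodic.L2 →L[ℝ] GradPair L :=
      ((WithLp.prodContinuousLinearEquiv 2 ℝ (L2Rect L ℝ)
        (PiLp 2 (fun _ : Fin 2 => L2Rect L ℝ))).symm : _ →L[ℝ] _).comp
        (ContinuousLinearMap.prod (0 : L2Rect L Y.periodic.L2 →L[ℝ] L2Rect L ℝ) (((PiLp.continuousLinearEquiv 2 ℝ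
          (fun _ : Fin 2 => L2Rect L ℝ)).symm : _ →L[ℝ] PiLp 2 (fun _ : Fin 2 => L2Rect L ℝ)).comp
          (ContinuousLinearMap.pi D)))
    have h1 : f = fun t => A (Z t) + B (Zg t) := by
      funext t
      change f t = WithLp.toLp 2 (lift L Y.mean (Z t), 0) +
        WithLp.toLp 2 (0, WithLp.toLp 2 fun i => D i (Zg t))
      rw [← WithLp.toLp_add, Prod.mk_add_mk, add_zero, zero_add]
    rw [h1]
    exact (A.comp_memLp' (Lp.memLp Z)).add (B.comp_memLp' (Lp.memLp Zg))
  have hmem : ∀ᵐ t ∂(timeMeasure T), f t ∈ H1Rect L := by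
    have h1 := ae_forall_testPair (T := T) (f := f) (ι := (Pt → ℝ) × Fin 2)
      (S := fun p => IsTestFunction L p.1) (fun p => p.2) (fun p => p.1) (fun p hp => hp.1)
      fun p hp => ?_
    · filter_upwards [h1] with t ht
      exact (mem_H1Rect_iff _).2 fun φ hφ i => ht (φ, i) hφ
    · obtain ⟨φ, i⟩ := p
      have hd : Continuous fun x => fderiv ℝ φ x (latticeVec (Pi.single i 1)) :=
        (hp.1.continuous_fderiv (by simp)).clm_apply continuous_const
      filter_upwards [h.shift_identity hconn e₀ (hq i) (hq' i) hp hd] with t ht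
      rw [inner_testPair]
      simp only [latticeVec_single] at ht
      rw [add_comm, hf]
      simp only [hD, latticeVec_single]
      exact ht
  -- At almost every time `f t` already lies in `H¹(Ω)`; the projection changes nothing there and
  -- supplies a function that is measurable with values in `H¹(Ω)`.
  refine ⟨fun t => (H1Rect L).orthogonalProjectionOnto (f t),
    (H1Rect L).orthogonalProjectionOnto.comp_memLp' hfm, ?_, ?_⟩
  · filter_upwards [hmem] with t ht
    rw [Submodule.orthogonalProjectionOnto_mem_subspace_eq_self (K := H1Rect L) ⟨f t, ht⟩]
    rfl
  intro p m hp hp'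
  set R := lift L (Y.pathFunctional e₀ (p + latticeVec m) - Y.pathFunctional e₀ p) with hR
  -- For an arbitrary lattice vector the same identity gives the derivative in direction `m`,
  -- compared here with `∑ mᵢ ∂ᵢ v0` on test functions.
  have h2 := ae_forall_inner_eq_zero (μ := timeMeasure T)
    (f := fun t => R (Zg t) - ∑ i, (m i : ℝ) • H1Rect.grad ((H1Rect L).orthogonalProjectionOnto (f t)) i)
    {c | ∃ φ, ∃ hφ : IsTestFunction L φ, contL2 L φ hφ.1.continuous = c} ?_
  · filter_upwards [h2] with t ht
    exact sub_eq_zero.1 (L2Rect_eq_zero fun φ hφ => ht _ ⟨φ, hφ, rfl⟩)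
  · rintro _ ⟨φ, hφ, rfl⟩
    have hd : Continuous fun x => fderiv ℝ φ x (latticeVec m) :=
      (hφ.1.continuous_fderiv (by simp)).clm_apply continuous_const
    filter_upwards [hmem, h.shift_identity hconn e₀ hp hp' hφ hd] with t ht h3
    rw [Submodule.orthogonalProjectionOnto_mem_subspace_eq_self (K := H1Rect L) ⟨f t, ht⟩]
    have h4 := (mem_H1Rect_iff _).1 ht φ hφ
    simp only [inner_testPair] at h4
    have h5 : contL2 L (fun x => fderiv ℝ φ x (latticeVec m)) hd =
        ∑ i, (m i : ℝ) • contL2 L (partialDeriv i φ) (continuous_partialDeriv hφ.1 i) := by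
      rw [Fin.sum_univ_two]
      refine Lp.ext ?_
      filter_upwards [coeFn_contL2 (L := L) hd,
        coeFn_contL2 (L := L) (continuous_partialDeriv hφ.1 0),
        coeFn_contL2 (L := L) (continuous_partialDeriv hφ.1 1),
        Lp.coeFn_add ((m 0 : ℝ) • contL2 L (partialDeriv 0 φ) (continuous_partialDeriv hφ.1 0))
          ((m 1 : ℝ) • contL2 L (partialDeriv 1 φ) (continuous_partialDeriv hφ.1 1)),
        Lp.coeFn_smul (m 0 : ℝ) (contL2 L (partialDeriv 0 φ) (continuous_partialDeriv hφ.1 0)),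
        Lp.coeFn_smul (m 1 : ℝ) (contL2 L (partialDeriv 1 φ) (continuous_partialDeriv hφ.1 1))]
        with x h5 h6 h7 h8 h9 h10
      rw [h5, h8, Pi.add_apply, h9, h10, Pi.smul_apply, Pi.smul_apply, h6, h7]
      have : latticeVec m = (m 0 : ℝ) • EuclideanSpace.single 0 (1 : ℝ) +
          (m 1 : ℝ) • EuclideanSpace.single 1 (1 : ℝ) := by
        ext j
        fin_cases j <;> simp [latticeVec_apply]
      rw [this, map_add, map_smul, map_smul]
      rfl
    rw [inner_sub_left]
    rw [h5] at h3
    simp only [Fin.sum_univ_two, inner_add_left, inner_add_right, inner_smul_left, inner_smul_right,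
      RCLike.conj_to_real] at h3 ⊢
    have h6 := h4 0
    have h7 := h4 1
    have h8 : ∀ i, H1Rect.grad (⟨f t, ht⟩ : H1Rect L) i = (f t).snd i := fun i => rfl
    have h9 : (f t).fst = lift L Y.mean (Z t) := rfl
    rw [h8, h8]
    rw [h9] at h6 h7
    linear_combination h3 - (m 0 : ℝ) * h6 - (m 1 : ℝ) * h7

/-- The limit of the derivatives is the sum of a slow and a fast derivative. -/
lemma exists_fast (h : IsUnfoldedLimit Y L T hδ hN v U G Z Zg C) (hconn : Y.graph.Connected)
    (e₀ : E) {v0 : ℝ → H1Rect L} (hv0 : MemLp v0 2 (timeMeasure T))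
    (hgrad : ∀ q m, q ∈ Y.vertices → q + latticeVec m ∈ Y.vertices → ∀ᵐ t ∂(timeMeasure T),
      lift L (Y.pathFunctional e₀ (q + latticeVec m) - Y.pathFunctional e₀ q) (Zg t) =
        ∑ i, (m i : ℝ) • H1Rect.grad (v0 t) i) :
    ∃ v1 : ℝ → L2Rect L Y.periodic.H1, MemLp v1 2 (timeMeasure T) ∧
      ∀ᵐ t ∂(timeMeasure T), Y.slowDeriv (v0 t) + Y.fastDeriv (v1 t) = Zg t := by
  obtain ⟨A, hA⟩ := exists_right_inverse (Y := Y) e₀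
  have hv : (Y.vertices).Countable := finite_vertices.countable
  have h1 : ∀ᵐ t ∂(timeMeasure T), ∀ e, lift L (Y.edgeDefect e₀ e) (Zg t) = 0 :=
    ae_all_iff.2 fun e => h.edgeDefect_eq_zero hconn e₀ e
  have h2 : ∀ᵐ t ∂(timeMeasure T), ∀ q ∈ Y.vertices, ∀ q' ∈ Y.vertices,
      (∀ i, (q i : UnitAddCircle) = (q' i : UnitAddCircle)) →
      lift L (Y.pathFunctional e₀ q' - Y.pathFunctional e₀ q) (Zg t) =
        ∑ i, (q' i - q i) • H1Rect.grad (v0 t) i := by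
    refine (ae_ball_iff hv).2 fun q hq => (ae_ball_iff hv).2 fun q' hq' => ?_
    by_cases hqq : ∀ i, (q i : UnitAddCircle) = (q' i : UnitAddCircle)
    · obtain ⟨m, rfl⟩ := exists_latticeVec hqq
      filter_upwards [hgrad q m hq hq'] with t ht _
      refine ht.trans (Finset.sum_congr rfl fun i _ => ?_)
      rw [PiLp.add_apply, add_sub_cancel_left, latticeVec_apply]
    · exact Eventually.of_forall fun x h => absurd h hqq
  -- The corrector is the right inverse applied to the fast part of the limit; its values outside a
  -- null set are genuine primitives by `fastDeriv_eq`.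
  refine ⟨fun t => lift L A (Zg t - Y.slowDeriv (v0 t)), ?_, ?_⟩
  · exact memLp_lift A ((Lp.memLp Zg).sub (memLp_slowDeriv hv0))
  · filter_upwards [h1, h2] with t h3 h4
    rw [fastDeriv_eq hconn e₀ hA h3 h4, add_sub_cancel]

end IsUnfoldedLimit

end UnitMesh

/-! ### Weak time derivatives -/

lemma memLp_time_of_continuous {T : ℝ} {φ : ℝ → ℝ} (hφ : Continuous φ) : MemLp φ 2 (timeMeasure T) :=
  UnitMesh.memLp_time_of_continuousOn hφ.continuousOn

section InitialValue

variable {X : Type*} [NormedAddCommGroup X] {T : ℝ}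

lemma IsInitialValue.unique (hT : 0 < T) {u : ℝ → X} {a b : X} (h : IsInitialValue T u a)
    (h' : IsInitialValue T u b) : a = b := by
  obtain ⟨V, hV, hVu, rfl⟩ := h
  obtain ⟨W, hW, hWu, rfl⟩ := h'
  have h1 : V =ᵐ[volume.restrict (Icc 0 T)] W := by
    rw [← restrict_Ioo_eq_restrict_Icc]
    filter_upwards [hVu, hWu] with t h1 h2
    rw [← h1, h2]
  exact Measure.eqOn_Icc_of_ae_eq _ hT.ne h1 hV hW ⟨le_rfl, hT.le⟩

lemma IsInitialValue.congr {u u' : ℝ → X} {a : X} (h : IsInitialValue T u a)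
    (hu : ∀ᵐ t ∂(timeMeasure T), u t = u' t) : IsInitialValue T u' a := by
  obtain ⟨V, hV, hVu, rfl⟩ := h
  refine ⟨V, hV, ?_, rfl⟩
  filter_upwards [hu, hVu] with t h1 h2
  rw [← h1, h2]

variable [NormedSpace ℝ X]

lemma IsInitialValue.clm {K : Type*} [NormedAddCommGroup K] [NormedSpace ℝ K] {u : ℝ → X} {a : X}
    (h : IsInitialValue T u a) (A : X →L[ℝ] K) : IsInitialValue T (fun t => A (u t)) (A a) := by
  obtain ⟨V, hV, hVu, rfl⟩ := h
  exact ⟨fun t => A (V t), A.continuous.comp_continuousOn hV, hVu.mono fun t ht => congrArg A ht, rfl⟩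

lemma integrable_smul_time {φ : ℝ → ℝ} (hφ : Continuous φ) {f : ℝ → X}
    (hf : MemLp f 2 (timeMeasure T)) : Integrable (fun t => φ t • f t) (timeMeasure T) :=
  memLp_one_iff_integrable.1 (hf.smul (memLp_time_of_continuous (T := T) hφ))

lemma HasWeakTimeDeriv.congr {u w u' w' : ℝ → X} (h : HasWeakTimeDeriv T u w)
    (hu : ∀ᵐ t ∂(timeMeasure T), u t = u' t) (hw : ∀ᵐ t ∂(timeMeasure T), w t = w' t) :
    HasWeakTimeDeriv T u' w' := fun φ h1 h2 h3 => by
  have e1 : ∫ t, deriv φ t • u' t ∂(timeMeasure T) = ∫ t, deriv φ t • u t ∂(timeMeasure T) :=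
    integral_congr_ae (hu.mono fun t ht => by simp only [ht])
  have e2 : ∫ t, φ t • w' t ∂(timeMeasure T) = ∫ t, φ t • w t ∂(timeMeasure T) :=
    integral_congr_ae (hw.mono fun t ht => by simp only [ht])
  rw [e1, e2, h φ h1 h2 h3]

lemma intervalIntegrable_time {Z : Type*} [NormedAddCommGroup Z] {w : ℝ → Z} (hT : 0 ≤ T)
    (hw : MemLp w 2 (timeMeasure T)) : IntervalIntegrable w volume 0 T := by
  rw [intervalIntegrable_iff_integrableOn_Ioo_of_le hT]
  exact integrable_time hw

lemma intervalIntegral_time_eq {Z : Type*} [NormedAddCommGroup Z] [NormedSpace ℝ Z] (hT : 0 ≤ T)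
    (w : ℝ → Z) : ∫ t in 0..T, w t = ∫ t, w t ∂(timeMeasure T) := by
  rw [intervalIntegral.integral_of_le hT, integral_Ioc_eq_integral_Ioo]; rfl

lemma continuousOn_timePrimitive (hT : 0 ≤ T) {w : ℝ → X} (hw : MemLp w 2 (timeMeasure T)) :
    ContinuousOn (fun t => ∫ s in 0..t, w s) (Icc 0 T) := by
  have := intervalIntegral.continuousOn_primitive_interval' (intervalIntegrable_time hT hw)
    (a := 0) left_mem_uIcc
  rwa [uIcc_of_le hT] at this

lemma isInitialValue_of_eq_add_primitive (hT : 0 ≤ T) {u w : ℝ → X}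
    (hw : MemLp w 2 (timeMeasure T)) {c : X}
    (h : ∀ᵐ t ∂(timeMeasure T), u t = c + ∫ s in 0..t, w s) : IsInitialValue T u c :=
  ⟨fun t => c + ∫ s in 0..t, w s, continuousOn_const.add (continuousOn_timePrimitive hT hw), h,
    by simp⟩

end InitialValue

section WeakTimeDeriv

variable {X : Type*} [NormedAddCommGroup X] [InnerProductSpace ℝ X] [CompleteSpace X] {T : ℝ}

/-- The operator `f ↦ ∫ φ f`. -/
noncomputable def timeIntegral (X : Type*) [NormedAddCommGroup X] [InnerProductSpace ℝ X]
    [CompleteSpace X] (T : ℝ) (φ : ℝ → ℝ) (hφ : Continuous φ) : Lp X 2 (timeMeasure T) →L[ℝ] X :=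
  (ContinuousLinearMap.lsmul ℝ ℝ : ℝ →L[ℝ] X →L[ℝ] X).lpPairing (timeMeasure T) 2 2
    (memLp_time_of_continuous hφ).toLp

lemma timeIntegral_apply {φ : ℝ → ℝ} (hφ : Continuous φ) (f : Lp X 2 (timeMeasure T)) :
    timeIntegral X T φ hφ f = ∫ t, φ t • f t ∂(timeMeasure T) := by
  rw [timeIntegral, ContinuousLinearMap.lpPairing_eq_integral]
  refine integral_congr_ae ?_
  filter_upwards [(memLp_time_of_continuous (T := T) hφ).coeFn_toLp] with t ht
  rw [ht]; rfl

lemma HasWeakTimeDeriv.clm {K : Type*} [NormedAddCommGroup K] [InnerProductSpace ℝ K]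
    [CompleteSpace K] {u w : ℝ → X} (h : HasWeakTimeDeriv T u w) (hu : MemLp u 2 (timeMeasure T))
    (hw : MemLp w 2 (timeMeasure T)) (A : X →L[ℝ] K) :
    HasWeakTimeDeriv T (fun t => A (u t)) (fun t => A (w t)) := fun φ h1 h2 h3 => by
  have e1 := A.integral_comp_comm (integrable_smul_time (h1.continuous_deriv (by simp)) hu)
  have e2 := A.integral_comp_comm (integrable_smul_time h1.continuous hw)
  simp only [map_smul] at e1 e2
  rw [e1, e2, h φ h1 h2 h3, map_neg]

lemma HasWeakTimeDeriv.of_weakTendsto {U W : ℕ → Lp X 2 (timeMeasure T)}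
    {Z Zw : Lp X 2 (timeMeasure T)} (h : ∀ k, HasWeakTimeDeriv T (U k) (W k))
    (hU : WeakTendsto U Z) (hW : WeakTendsto W Zw) : HasWeakTimeDeriv T Z Zw := fun φ h1 h2 h3 => by
  have e1 := hU.clm (timeIntegral X T _ (h1.continuous_deriv (by simp)))
  have e2 := hW.clm (-timeIntegral X T _ h1.continuous)
  simp only [neg_apply, timeIntegral_apply] at e1 e2
  refine e1.unique fun y => (e2 y).congr fun k => ?_
  simp only [h k φ h1 h2 h3]

/-- Integration by parts with the primitive of a vector valued function. -/
lemma integral_deriv_smul_primitive (hT : 0 ≤ T) {w : ℝ → X} (hw : MemLp w 2 (timeMeasure T))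
    {φ : ℝ → ℝ} (hφ : ContDiff ℝ 1 φ) :
    ∫ t, deriv φ t • (∫ s in 0..t, w s) ∂(timeMeasure T) =
      φ T • (∫ s, w s ∂(timeMeasure T)) - ∫ t, φ t • w t ∂(timeMeasure T) := by
  have hWm : MemLp (fun t => ∫ s in 0..t, w s) 2 (timeMeasure T) :=
    UnitMesh.memLp_time_of_continuousOn (continuousOn_timePrimitive hT hw)
  -- Testing with a vector reduces to scalar functions, for which the primitive of an integrable
  -- function is absolutely continuous and may be integrated by parts.
  refine ext_inner_left ℝ fun y => ?_
  rw [inner_sub_right, ← integral_inner (integrable_smul_time (hφ.continuous_deriv le_rfl) hWm),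
    ← integral_inner (integrable_smul_time hφ.continuous hw), inner_smul_right,
    ← integral_inner (integrable_time hw)]
  have hi := intervalIntegrable_time hT (hw.const_inner (𝕜 := ℝ) y)
  set g : ℝ → ℝ := fun t => ∫ s in 0..t, inner ℝ y (w s) with hg
  have hgac := hi.absolutelyContinuousOnInterval_intervalIntegral (c := 0) left_mem_uIcc
  have hφac := (hφ.contDiffOn (s := uIcc 0 T)).absolutelyContinuousOnInterval
  have hp := hφac.integral_mul_deriv_eq_deriv_mul hgac
  have e1 : ∀ t ∈ Ioo 0 T, inner ℝ y (∫ s in 0..t, w s) = g t := fun t ht => by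
    have hit : IntervalIntegrable w volume 0 t := (intervalIntegrable_time hT hw).mono_set (by
      rw [uIcc_of_le hT, uIcc_of_le ht.1.le]; exact Icc_subset_Icc_right ht.2.le)
    rw [hg]
    simp only
    rw [intervalIntegral.integral_of_le ht.1.le, intervalIntegral.integral_of_le ht.1.le,
      integral_inner hit.1]
  have e2 : ∀ᵐ t ∂(timeMeasure T), deriv g t = inner ℝ y (w t) := by
    refine (ae_restrict_iff' measurableSet_Ioo).2 ?_
    filter_upwards [hi.ae_hasDerivAt_integral] with t ht htm
    exact (ht (by rw [uIcc_of_le hT]; exact Ioo_subset_Icc_self htm) 0 left_mem_uIcc).deriv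
  have e3 : ∫ t, inner ℝ y (deriv φ t • ∫ s in 0..t, w s) ∂(timeMeasure T) =
      ∫ t in 0..T, deriv φ t * g t := by
    rw [intervalIntegral_time_eq hT]
    refine integral_congr_ae ?_
    filter_upwards [ae_restrict_mem (μ := volume) measurableSet_Ioo] with t ht
    rw [inner_smul_right, e1 t ht]
  have e4 : ∫ t, inner ℝ y (φ t • w t) ∂(timeMeasure T) = ∫ t in 0..T, φ t * deriv g t := by
    rw [intervalIntegral_time_eq hT]
    refine integral_congr_ae ?_
    filter_upwards [e2] with t ht
    rw [inner_smul_right, ht]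
  have e5 : ∫ t, inner ℝ y (w t) ∂(timeMeasure T) = g T := (intervalIntegral_time_eq hT _).symm
  have e6 : g 0 = 0 := intervalIntegral.integral_same
  rw [e3, e4, e5, hp]
  change _ = φ T * g T - (φ T * g T - φ 0 * g 0 - _)
  rw [e6]; ring

/-- A function with vanishing weak derivative is constant. -/
lemma ae_eq_const_of_weak_deriv_zero (hT : 0 < T) {f : ℝ → X} (hf : MemLp f 2 (timeMeasure T))
    (h : HasWeakTimeDeriv T f 0) : ∃ c, ∀ᵐ t ∂(timeMeasure T), f t = c := by
  -- A bump of integral one whose support, of radius `T / 4` about the midpoint, stays inside `(0,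
  -- T)`; it fixes the constant.
  let χb : ContDiffBump (T / 2) := ⟨T / 8, T / 4, by positivity, by linarith⟩
  set χ : ℝ → ℝ := χb.normed volume with hχ
  have hχs : ContDiff ℝ ∞ χ := χb.contDiff_normed
  have hχc : HasCompactSupport χ := χb.hasCompactSupport_normed
  have hχ1 : ∫ t, χ t = 1 := χb.integral_normed
  have hχt : tsupport χ ⊆ Ioo 0 T := by
    rw [hχ, χb.tsupport_normed_eq, Real.closedBall_eq_Icc]
    intro t ht
    have h1 : χb.rOut = T / 4 := rfl
    rw [h1] at ht
    exact ⟨by linarith [ht.1], by linarith [ht.2]⟩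
  refine ⟨∫ t, χ t • f t ∂(timeMeasure T), ?_⟩
  set c := ∫ t, χ t • f t ∂(timeMeasure T) with hc
  have key : ∀ φ : ℝ → ℝ, ContDiff ℝ ∞ φ → HasCompactSupport φ → tsupport φ ⊆ Ioo 0 T →
      ∫ t, φ t • f t ∂(timeMeasure T) = (∫ t, φ t) • c := fun φ hφ hφc hφt => by
    set m := ∫ t, φ t with hm
    -- Removing the mean of `φ` makes the primitive of `η` compactly supported, hence an admissible
    -- test function with derivative `η`.
    set η : ℝ → ℝ := fun t => φ t - m * χ t with hη
    have hηs : ContDiff ℝ ∞ η := hφ.sub (contDiff_const.mul hχs)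
    have hηi : ∫ t, η t = 0 := by
      rw [hη, integral_sub (hφ.continuous.integrable_of_hasCompactSupport hφc)
        ((hχs.continuous.integrable_of_hasCompactSupport hχc).const_mul m), integral_const_mul, hχ1]
      simp [hm]
    have hK : IsCompact (tsupport φ ∪ tsupport χ) := hφc.isCompact.union hχc.isCompact
    have hKne : (tsupport φ ∪ tsupport χ).Nonempty := by
      refine Nonempty.inr ?_
      rw [nonempty_iff_ne_empty]
      intro h0
      rw [tsupport_eq_empty_iff] at h0
      rw [h0] at hχ1
      simp at hχ1
    have hKsub : tsupport φ ∪ tsupport χ ⊆ Ioo 0 T := union_subset hφt hχt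
    -- The primitive vanishes before `p`, where `η` has not begun, and after `q`, where the full
    -- integral of `η` is zero.
    set p := sInf (tsupport φ ∪ tsupport χ) with hp
    set q := sSup (tsupport φ ∪ tsupport χ) with hq
    have hp0 : p ∈ Ioo 0 T := hKsub (hK.sInf_mem hKne)
    have hq0 : q ∈ Ioo 0 T := hKsub (hK.sSup_mem hKne)
    have hpq : tsupport φ ∪ tsupport χ ⊆ Icc p q := hK.isBounded.subset_Icc_sInf_sSup
    have hη0 : ∀ t, t ∉ Icc p q → η t = 0 := fun t ht => by
      have h1 : t ∉ tsupport φ := fun h => ht (hpq (.inl h))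
      have h2 : t ∉ tsupport χ := fun h => ht (hpq (.inr h))
      simp [hη, image_eq_zero_of_notMem_tsupport h1, image_eq_zero_of_notMem_tsupport h2]
    set ψ : ℝ → ℝ := fun t => ∫ s in 0..t, η s with hψ
    have hψd : ∀ t, HasDerivAt ψ (η t) t := fun t =>
      hηs.continuous.integral_hasStrictDerivAt 0 t |>.hasDerivAt
    have hψ' : deriv ψ = η := funext fun t => (hψd t).deriv
    have hψs : ContDiff ℝ ∞ ψ :=
      contDiff_infty_iff_deriv.2 ⟨fun t => (hψd t).differentiableAt, hψ' ▸ hηs⟩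
    have hψ0 : ∀ t, t ∉ Icc p q → ψ t = 0 := fun t ht => by
      rcases lt_or_ge t p with h1 | h1
      · refine intervalIntegral.integral_zero_ae (Eventually.of_forall fun s hs => hη0 s fun h2 => ?_)
        rcases le_total 0 t with h3 | h3
        · rw [uIoc_of_le h3] at hs; linarith [hs.2, h2.1]
        · rw [uIoc_of_ge h3] at hs; linarith [hs.2, h2.1, hp0.1]
      · have h2 : q < t := lt_of_not_ge fun h3 => ht ⟨h1, h3⟩
        rw [hψ]
        simp only
        rw [intervalIntegral.integral_eq_integral_of_support_subset, hηi]
        intro s hs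
        have h3 : s ∈ Icc p q := by_contra fun h4 => hs (hη0 s h4)
        exact ⟨hp0.1.trans_le h3.1, h3.2.trans h2.le⟩
    have hψt : tsupport ψ ⊆ Icc p q :=
      closure_minimal (fun t ht => by_contra fun h1 => ht (hψ0 t h1)) isClosed_Icc
    have h3 := h ψ hψs (HasCompactSupport.of_support_subset_isCompact isCompact_Icc
      (subset_closure.trans hψt)) (hψt.trans fun t ht => ⟨hp0.1.trans_le ht.1, ht.2.trans_lt hq0.2⟩)
    rw [hψ'] at h3
    simp only [Pi.zero_apply, smul_zero, integral_zero, neg_zero, hη, sub_smul, mul_smul] at h3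
    have h4 := integral_sub (integrable_smul_time hφ.continuous hf)
      ((integrable_smul_time hχs.continuous hf).smul m)
    simp only [Pi.smul_apply] at h4
    rw [h4, integral_smul] at h3
    exact sub_eq_zero.1 h3
  have h4 : ∀ᵐ t, t ∈ Ioo 0 T → f t - c = 0 := by
    refine isOpen_Ioo.ae_eq_zero_of_integral_contDiff_smul_eq_zero ?_ fun φ hφ hφc hφt => ?_
    · exact IntegrableOn.locallyIntegrableOn ((integrable_time hf).sub (integrable_const c))
    · have e1 : ∫ t, φ t • (f t - c) = ∫ t, φ t • (f t - c) ∂(timeMeasure T) := by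
        rw [timeMeasure, setIntegral_eq_integral_of_forall_compl_eq_zero]
        intro t ht
        rw [image_eq_zero_of_notMem_tsupport fun h => ht (hφt h), zero_smul]
      have e2 : ∫ t, φ t = ∫ t, φ t ∂(timeMeasure T) := by
        rw [timeMeasure, setIntegral_eq_integral_of_forall_compl_eq_zero]
        intro t ht
        rw [image_eq_zero_of_notMem_tsupport fun h => ht (hφt h)]
      rw [e1]
      simp only [smul_sub]
      rw [integral_sub (integrable_smul_time hφ.continuous hf)
        (integrable_smul_time hφ.continuous (memLp_const c)), key φ hφ hφc hφt, integral_smul_const,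
        e2, sub_self]
  exact ((ae_restrict_iff' measurableSet_Ioo).2 h4).mono fun t ht => sub_eq_zero.1 ht

/-- A function with a weak derivative is a primitive of it. -/
lemma HasWeakTimeDeriv.exists_eq_add_primitive (hT : 0 < T) {u w : ℝ → X}
    (h : HasWeakTimeDeriv T u w) (hu : MemLp u 2 (timeMeasure T)) (hw : MemLp w 2 (timeMeasure T)) :
    ∃ c, ∀ᵐ t ∂(timeMeasure T), u t = c + ∫ s in 0..t, w s := by
  have hWm : MemLp (fun t => ∫ s in 0..t, w s) 2 (timeMeasure T) :=
    UnitMesh.memLp_time_of_continuousOn (continuousOn_timePrimitive hT.le hw)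
  obtain ⟨c, hc⟩ := ae_eq_const_of_weak_deriv_zero hT (hu.sub hWm) fun φ h1 h2 h3 => by
    have e1 := integral_deriv_smul_primitive hT.le hw (h1.of_le (by simp))
    have e2 : φ T = 0 := image_eq_zero_of_notMem_tsupport fun h => (h3 h).2.false
    simp only [Pi.sub_apply, smul_sub, Pi.zero_apply, smul_zero, integral_zero, neg_zero]
    rw [integral_sub (integrable_smul_time (h1.continuous_deriv (by simp)) hu)
      (integrable_smul_time (h1.continuous_deriv (by simp)) hWm), h φ h1 h2 h3, e1, e2, zero_smul]
    simp
  exact ⟨c, hc.mono fun t ht => by rw [← ht, Pi.sub_apply, sub_add_cancel]⟩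

/-- The initial value in terms of time averages. -/
lemma smul_initialValue_eq (hT : 0 < T) {u w : Lp X 2 (timeMeasure T)} (h : HasWeakTimeDeriv T u w)
    {a : X} (ha : IsInitialValue T u a) :
    T • a = timeIntegral X T (fun _ => 1) continuous_const u +
      timeIntegral X T (fun t => t - T) (by fun_prop) w := by
  obtain ⟨c, hc⟩ := h.exists_eq_add_primitive hT (Lp.memLp u) (Lp.memLp w)
  obtain rfl := ha.unique hT (isInitialValue_of_eq_add_primitive hT.le (Lp.memLp w) hc)
  have hWm : MemLp (fun t => ∫ s in 0..t, w s) 2 (timeMeasure T) :=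
    UnitMesh.memLp_time_of_continuousOn (continuousOn_timePrimitive hT.le (Lp.memLp w))
  -- The weight `t - T` has derivative one and vanishes at `T`, so the boundary term at the final
  -- time drops out.
  have e1 := integral_deriv_smul_primitive hT.le (Lp.memLp w) (φ := fun t => t - T) (by fun_prop)
  have e2 : deriv (fun t : ℝ => t - T) = fun _ => 1 := by
    funext t
    exact ((hasDerivAt_id t).sub_const T).deriv
  simp only [e2, one_smul, sub_self, zero_smul, zero_sub] at e1
  simp only [timeIntegral_apply, one_smul]
  rw [integral_congr_ae hc, integral_add (integrable_const _) (integrable_time hWm), e1,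
    integral_const, add_assoc, neg_add_cancel, add_zero]
  congr 1
  simp [timeMeasure, Measure.real, hT.le]

/-- Initial values converge weakly. -/
lemma WeakTendsto.initialValue (hT : 0 < T) {U W : ℕ → Lp X 2 (timeMeasure T)}
    {Z Zw : Lp X 2 (timeMeasure T)} (h : ∀ k, HasWeakTimeDeriv T (U k) (W k))
    (hU : WeakTendsto U Z) (hW : WeakTendsto W Zw) {C : ℝ} (hCU : ∀ k, ‖U k‖ ≤ C)
    (hCW : ∀ k, ‖W k‖ ≤ C) {a : ℕ → X} (ha : ∀ k, IsInitialValue T (U k) (a k)) :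
    ∃ c, IsInitialValue T Z c ∧ WeakTendsto a c ∧ ∃ C', ∀ k, ‖a k‖ ≤ C' := by
  have hZ := HasWeakTimeDeriv.of_weakTendsto h hU hW
  obtain ⟨c, hc⟩ := hZ.exists_eq_add_primitive hT (Lp.memLp Z) (Lp.memLp Zw)
  have hcZ := isInitialValue_of_eq_add_primitive hT.le (Lp.memLp Zw) hc
  set I := timeIntegral X T (fun _ => 1) continuous_const with hI
  set J := timeIntegral X T (fun t => t - T) (by fun_prop) with hJ
  -- The initial value is a bounded linear function of the pair `(u, w)`, so both weak convergence
  -- and the bound carry over.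
  have e : ∀ {u w : Lp X 2 (timeMeasure T)} {b : X}, HasWeakTimeDeriv T u w →
      IsInitialValue T u b → b = (T⁻¹ • I) u + (T⁻¹ • J) w := fun {u w b} h1 h2 => by
    rw [smul_apply, smul_apply, ← smul_add, hI, hJ, ← smul_initialValue_eq hT h1 h2, smul_smul,
      inv_mul_cancel₀ hT.ne', one_smul]
  refine ⟨c, hcZ, ?_, ‖T⁻¹ • I‖ * C + ‖T⁻¹ • J‖ * C, fun k => ?_⟩
  · have h1 := (hU.clm (T⁻¹ • I)).add (hW.clm (T⁻¹ • J))
    rw [← e hZ hcZ] at h1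
    intro y
    refine (h1 y).congr fun k => ?_
    simp only [← e (h k) (ha k)]
  · rw [e (h k) (ha k)]
    refine (norm_add_le _ _).trans (add_le_add ?_ ?_)
    · exact ((T⁻¹ • I).le_opNorm _).trans (mul_le_mul_of_nonneg_left (hCU k) (norm_nonneg _))
    · exact ((T⁻¹ • J).le_opNorm _).trans (mul_le_mul_of_nonneg_left (hCW k) (norm_nonneg _))

end WeakTimeDeriv

namespace UnitMesh

variable {E : Type*} [Fintype E] {Y : UnitMesh E} {L : Fin 2 → ℝ} {T : ℝ}

/-- The weak time derivative of a slow function is slow. -/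
lemma eq_slow_of_hasWeakTimeDeriv (e₀ : E) {Z Zw : Lp (L2Rect L Y.periodic.L2) 2 (timeMeasure T)}
    (h : HasWeakTimeDeriv T Z Zw) (hZ : ∀ᵐ t ∂(timeMeasure T), Z t = Y.slow (lift L Y.mean (Z t))) :
    ∀ᵐ t ∂(timeMeasure T), Zw t = Y.slow (lift L Y.mean (Zw t)) := by
  have h1 := h.clm (Lp.memLp Z) (Lp.memLp Zw) (lift L Y.fluct)
  have hm := (lift L Y.fluct).comp_memLp' (Lp.memLp Zw)
  have h2 : ∀ᵐ t, t ∈ Ioo 0 T → lift L Y.fluct (Zw t) = 0 := by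
    refine isOpen_Ioo.ae_eq_zero_of_integral_contDiff_smul_eq_zero ?_ fun φ hφ hφc hφt => ?_
    · exact IntegrableOn.locallyIntegrableOn (integrable_time hm)
    · have e1 := h1 φ hφ hφc hφt
      -- The fluctuation of `Z` is zero, and that of `Zw` is its weak derivative.
      have e2 : ∫ t, deriv φ t • lift L Y.fluct (Z t) ∂(timeMeasure T) = 0 := by
        refine integral_eq_zero_of_ae (hZ.mono fun t ht => ?_)
        simp only [Pi.zero_apply]
        rw [ht, lift_fluct_slow e₀, smul_zero]
      rw [e2, eq_comm, neg_eq_zero] at e1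
      rw [← e1]
      refine (setIntegral_eq_integral_of_forall_compl_eq_zero fun t ht => ?_).symm
      rw [image_eq_zero_of_notMem_tsupport fun h => ht (hφt h), zero_smul]
  exact ((ae_restrict_iff' measurableSet_Ioo).2 h2).mono fun t ht => eq_slow_of_lift_fluct ht

end UnitMesh

/-! ### Partial derivatives -/

lemma hasFDerivAt_coord {f : ℝ → ℝ} (j : Fin 2) {x : Pt} (hf : DifferentiableAt ℝ f (x j)) :
    HasFDerivAt (fun x : Pt => f (x j)) (deriv f (x j) • (EuclideanSpace.proj j : Pt →L[ℝ] ℝ)) x :=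
  hf.hasDerivAt.comp_hasFDerivAt x (EuclideanSpace.proj j : Pt →L[ℝ] ℝ).hasFDerivAt

lemma partialDeriv_coord_self {f : ℝ → ℝ} (i : Fin 2) {x : Pt} (hf : DifferentiableAt ℝ f (x i)) :
    partialDeriv i (fun x : Pt => f (x i)) x = deriv f (x i) := by
  rw [partialDeriv, (hasFDerivAt_coord i hf).fderiv]; simp

lemma partialDeriv_coord_ne {f : ℝ → ℝ} {i j : Fin 2} (hij : i ≠ j) {x : Pt}
    (hf : DifferentiableAt ℝ f (x j)) : partialDeriv i (fun x : Pt => f (x j)) x = 0 := by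
  rw [partialDeriv, (hasFDerivAt_coord j hf).fderiv]; simp [hij.symm]

lemma partialDeriv_mul {f g : Pt → ℝ} (i : Fin 2) {x : Pt} (hf : DifferentiableAt ℝ f x)
    (hg : DifferentiableAt ℝ g x) : partialDeriv i (fun x => f x * g x) x =
      partialDeriv i f x * g x + f x * partialDeriv i g x := by
  rw [partialDeriv, fderiv_fun_mul hf hg]
  simp only [partialDeriv, add_apply, smul_apply, smul_eq_mul]
  ring

lemma contDiff_coord {f : ℝ → ℝ} (hf : ContDiff ℝ ∞ f) (j : Fin 2) :
    ContDiff ℝ ∞ fun x : Pt => f (x j) :=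
  hf.comp (EuclideanSpace.proj j : Pt →L[ℝ] ℝ).contDiff

lemma partialDeriv_coord_mul_coord {f g : ℝ → ℝ} {i j : Fin 2} (hij : i ≠ j) (hf : Differentiable ℝ f)
    (hg : Differentiable ℝ g) (x : Pt) :
    partialDeriv i (fun x : Pt => f (x i) * g (x j)) x = deriv f (x i) * g (x j) := by
  rw [partialDeriv_mul i (hasFDerivAt_coord i (hf _)).differentiableAt
    (hasFDerivAt_coord j (hg _)).differentiableAt, partialDeriv_coord_self i (hf _),
    partialDeriv_coord_ne hij (hg _)]
  ring

lemma exists_ne_fin_two (i : Fin 2) : ∃ j : Fin 2, i ≠ j := by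
  fin_cases i
  · exact ⟨1, by simp⟩
  · exact ⟨0, by simp⟩

lemma eq_or_eq_fin_two {i j : Fin 2} (hij : i ≠ j) (k : Fin 2) : k = i ∨ k = j := by
  fin_cases i <;> fin_cases j <;> fin_cases k <;> simp_all

lemma sum_fin_two_of_ne {M : Type*} [AddCommMonoid M] {i j : Fin 2} (hij : i ≠ j) (f : Fin 2 → M) :
    ∑ k, f k = f i + f j := by
  fin_cases i <;> fin_cases j <;> simp_all [add_comm]

/-! ### Cutoff functions -/

/-- A smooth cutoff function of `(0, ℓ)`. -/
noncomputable def cutoff (ℓ : ℝ) (n : ℕ) (r : ℝ) : ℝ :=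
  Real.smoothTransition (n * r - 1) * Real.smoothTransition (n * (ℓ - r) - 1)

lemma contDiff_cutoff (ℓ : ℝ) (n : ℕ) : ContDiff ℝ ∞ (cutoff ℓ n) :=
  (Real.smoothTransition.contDiff.comp (by fun_prop)).mul
    (Real.smoothTransition.contDiff.comp (by fun_prop))

lemma cutoff_nonneg (ℓ : ℝ) (n : ℕ) (r : ℝ) : 0 ≤ cutoff ℓ n r :=
  mul_nonneg (Real.smoothTransition.nonneg _) (Real.smoothTransition.nonneg _)

lemma cutoff_le_one (ℓ : ℝ) (n : ℕ) (r : ℝ) : cutoff ℓ n r ≤ 1 :=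
  mul_le_one₀ (Real.smoothTransition.le_one _) (Real.smoothTransition.nonneg _)
    (Real.smoothTransition.le_one _)

lemma cutoff_eq_zero {ℓ : ℝ} {n : ℕ} (hn : 0 < n) {r : ℝ}
    (h : r ∉ Icc ((n : ℝ)⁻¹) (ℓ - (n : ℝ)⁻¹)) : cutoff ℓ n r = 0 := by
  have hn' : (0 : ℝ) < n := by exact_mod_cast hn
  rw [cutoff]
  by_cases h1 : r < (n : ℝ)⁻¹
  · rw [Real.smoothTransition.zero_of_nonpos, zero_mul]
    have := mul_lt_mul_of_pos_left h1 hn'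
    rw [mul_inv_cancel₀ hn'.ne'] at this
    linarith
  · have h2 : ℓ - r < (n : ℝ)⁻¹ := by
      by_contra h3
      exact h ⟨not_lt.1 h1, by linarith⟩
    rw [Real.smoothTransition.zero_of_nonpos (x := n * (ℓ - r) - 1), mul_zero]
    have := mul_lt_mul_of_pos_left h2 hn'
    rw [mul_inv_cancel₀ hn'.ne'] at this
    linarith

lemma eventually_cutoff_eq {ℓ r : ℝ} (hr : r ∈ Ioo 0 ℓ) :
    ∀ᶠ n in atTop, cutoff ℓ n r = 1 ∧ deriv (cutoff ℓ n) r = 0 := by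
  have h1 : Tendsto (fun n : ℕ => (n : ℝ) * r) atTop atTop :=
    tendsto_natCast_atTop_atTop.atTop_mul_const hr.1
  have h2 : Tendsto (fun n : ℕ => (n : ℝ) * (ℓ - r)) atTop atTop :=
    tendsto_natCast_atTop_atTop.atTop_mul_const (by linarith [hr.2])
  filter_upwards [h1.eventually_gt_atTop 2, h2.eventually_gt_atTop 2] with n h1 h2
  have h3 : cutoff ℓ n =ᶠ[𝓝 r] fun _ => 1 := by
    have e1 : ∀ᶠ s in 𝓝 r, 2 < (n : ℝ) * s :=
      (continuous_const.mul continuous_id).continuousAt.eventually_const_lt h1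
    have e2 : ∀ᶠ s in 𝓝 r, 2 < (n : ℝ) * (ℓ - s) :=
      (continuous_const.mul (continuous_const.sub continuous_id)).continuousAt.eventually_const_lt h2
    filter_upwards [e1, e2] with s hs1 hs2
    rw [cutoff, Real.smoothTransition.one_of_one_le (by linarith),
      Real.smoothTransition.one_of_one_le (by linarith), one_mul]
  exact ⟨h3.self_of_nhds, by rw [h3.deriv_eq, deriv_const]⟩

lemma exists_deriv_smoothTransition_bound : ∃ M : ℝ, 0 ≤ M ∧ ∀ x,
    |deriv Real.smoothTransition x| ≤ M ∧ (1 < x → deriv Real.smoothTransition x = 0) := by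
  have hc : Continuous (deriv Real.smoothTransition) :=
    (Real.smoothTransition.contDiff (n := 1)).continuous_deriv le_rfl
  obtain ⟨M, hM⟩ := (isCompact_Icc (a := (0 : ℝ)) (b := 1)).exists_bound_of_continuousOn hc.continuousOn
  have h1 : ∀ x, 1 < x → deriv Real.smoothTransition x = 0 := fun x hx => by
    have : Real.smoothTransition =ᶠ[𝓝 x] fun _ => 1 := by
      filter_upwards [lt_mem_nhds hx] with y hy
      exact Real.smoothTransition.one_of_one_le hy.le
    rw [this.deriv_eq, deriv_const]
  have h0 : ∀ x, x < 0 → deriv Real.smoothTransition x = 0 := fun x hx => by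
    have : Real.smoothTransition =ᶠ[𝓝 x] fun _ => 0 := by
      filter_upwards [gt_mem_nhds hx] with y hy
      exact Real.smoothTransition.zero_of_nonpos hy.le
    rw [this.deriv_eq, deriv_const]
  have hM0 : 0 ≤ M := (norm_nonneg _).trans (hM 0 (by simp))
  refine ⟨M, hM0, fun x => ⟨?_, h1 x⟩⟩
  rcases lt_or_ge x 0 with hx | hx
  · rw [h0 x hx, abs_zero]; exact hM0
  rcases lt_or_ge 1 x with hx' | hx'
  · rw [h1 x hx', abs_zero]; exact hM0
  · exact hM x ⟨hx, hx'⟩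

/-- The cutoff has slope of order `n`, but only at distance at most `2 / n` from an endpoint, where
`|y|` is at most `2 K / n`. Each of the two endpoint factors contributes `2 M K`. -/
lemma exists_deriv_cutoff_bound : ∃ M : ℝ, 0 ≤ M ∧ ∀ (ℓ K : ℝ) (n : ℕ) (r y : ℝ), r ∈ Ioo 0 ℓ →
    |y| ≤ K * r → |y| ≤ K * (ℓ - r) → |deriv (cutoff ℓ n) r * y| ≤ M * K := by
  obtain ⟨M, hM0, hM⟩ := exists_deriv_smoothTransition_bound
  refine ⟨4 * M, by positivity, fun ℓ K n r y hr h1 h2 => ?_⟩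
  have hK : 0 ≤ K := by
    by_contra h
    have := mul_neg_of_neg_of_pos (not_le.1 h) hr.1
    linarith [abs_nonneg y]
  have hσ : ∀ x, HasDerivAt Real.smoothTransition (deriv Real.smoothTransition x) x := fun x =>
    ((Real.smoothTransition.contDiff (n := 1)).differentiable (by simp) x).hasDerivAt
  have e1 : HasDerivAt (fun r => Real.smoothTransition ((n : ℝ) * r - 1))
      (deriv Real.smoothTransition (n * r - 1) * n) r := by
    refine (hσ _).comp r ?_
    simpa using ((hasDerivAt_id r).const_mul (n : ℝ)).sub_const 1
  have e2 : HasDerivAt (fun r => Real.smoothTransition ((n : ℝ) * (ℓ - r) - 1))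
      (deriv Real.smoothTransition (n * (ℓ - r) - 1) * (-n)) r := by
    refine (hσ _).comp r ?_
    simpa using (((hasDerivAt_id r).const_sub ℓ).const_mul (n : ℝ)).sub_const 1
  have e3 := (e1.mul e2).deriv
  have key : ∀ s, 0 < s → |y| ≤ K * s → |deriv Real.smoothTransition (n * s - 1) * n * y| ≤ 2 * M * K :=
    fun s hs hy => by
    rcases lt_or_ge 1 ((n : ℝ) * s - 1) with h | h
    · rw [(hM _).2 h]; simp; positivity
    · rw [abs_mul, abs_mul, Nat.abs_cast]
      calc _ ≤ M * n * (K * s) := by gcongr; exact (hM _).1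
        _ = M * K * (n * s) := by ring
        _ ≤ M * K * 2 := by gcongr; linarith
        _ = _ := by ring
  have k1 := key r hr.1 h1
  have k2 := key (ℓ - r) (by linarith [hr.2]) h2
  have hs : ∀ x, |Real.smoothTransition x| ≤ 1 := fun x => by
    rw [abs_of_nonneg (Real.smoothTransition.nonneg _)]; exact Real.smoothTransition.le_one _
  change |deriv (fun r => Real.smoothTransition ((n : ℝ) * r - 1) *
    Real.smoothTransition ((n : ℝ) * (ℓ - r) - 1)) r * y| ≤ _
  change deriv (fun r => Real.smoothTransition ((n : ℝ) * r - 1) *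
    Real.smoothTransition ((n : ℝ) * (ℓ - r) - 1)) r = _ at e3
  rw [e3]
  calc _ = |(deriv Real.smoothTransition (n * r - 1) * n * y) *
        Real.smoothTransition (n * (ℓ - r) - 1) - Real.smoothTransition (n * r - 1) *
        (deriv Real.smoothTransition (n * (ℓ - r) - 1) * n * y)| := by congr 1; ring
    _ ≤ 2 * M * K * 1 + 1 * (2 * M * K) := by
        refine (abs_sub _ _).trans ?_
        rw [abs_mul (deriv Real.smoothTransition (n * r - 1) * n * y),
          abs_mul (Real.smoothTransition (n * r - 1))]
        exact add_le_add (mul_le_mul k1 (hs _) (abs_nonneg _) (by positivity))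
          (mul_le_mul (hs _) k2 (abs_nonneg _) zero_le_one)
    _ = _ := by ring

/-! ### Green's formula for functions that vanish on two opposite sides -/

section Green

variable {L : Fin 2 → ℝ}

lemma tendsto_inner_contL2 (u : L2Rect L ℝ) {η : ℕ → Pt → ℝ} {η₀ : Pt → ℝ} (hη : ∀ n, Continuous (η n))
    (hη₀ : Continuous η₀) {C : ℝ} (hC : ∀ n, ∀ x ∈ rect L, |η n x| ≤ C)
    (h : ∀ x ∈ rect L, Tendsto (fun n => η n x) atTop (𝓝 (η₀ x))) :
    Tendsto (fun n => inner ℝ u (contL2 L (η n) (hη n))) atTop (𝓝 (inner ℝ u (contL2 L η₀ hη₀))) := by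
  simp only [inner_contL2]
  have hu : Integrable (fun x => u x) (rectMeasure L) := (Lp.memLp u).integrable (by norm_num)
  refine tendsto_integral_of_dominated_convergence (fun x => |u x| * C) (fun n => ?_)
    (hu.abs.mul_const C) (fun n => ?_) ?_
  · exact hu.aestronglyMeasurable.mul (hη n).aestronglyMeasurable
  · filter_upwards [ae_mem_rect L] with x hx
    rw [Real.norm_eq_abs, abs_mul]
    exact mul_le_mul_of_nonneg_left (hC n x hx) (abs_nonneg _)
  · filter_upwards [ae_mem_rect L] with x hx
    exact (h x hx).const_mul _

/-- Multiply by cutoffs to obtain test functions. The critical term is the derivative of the cutoff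
times `ψ`; it stays bounded since `ψ` vanishes linearly at the sides `xᵢ = 0, Lᵢ`, and it tends to
zero pointwise. Nothing is needed at the other two sides, because only `∂ᵢ` is taken. -/
lemma inner_testPair_eq_zero_of_vanishing {f : GradPair L} (hf : f ∈ H1Rect L) {i j : Fin 2}
    (hij : i ≠ j) {ψ : Pt → ℝ} (hψ : ContDiff ℝ ∞ ψ) {K : ℝ}
    (hK : ∀ x ∈ rect L, |ψ x| ≤ K * x i ∧ |ψ x| ≤ K * (L i - x i)) :
    inner ℝ f (testPair L i ψ hψ) = 0 := by
  set κ : ℕ → Pt → ℝ := fun n x => cutoff (L i) n (x i) * cutoff (L j) n (x j) with hκ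
  set η : ℕ → Pt → ℝ := fun n x => κ n x * ψ x with hη
  have hκs : ∀ n, ContDiff ℝ ∞ (κ n) := fun n =>
    (contDiff_coord (contDiff_cutoff _ _) i).mul (contDiff_coord (contDiff_cutoff _ _) j)
  have hηs : ∀ n, ContDiff ℝ ∞ (η n) := fun n => (hκs n).mul hψ
  have hκd : ∀ n x, partialDeriv i (κ n) x = deriv (cutoff (L i) n) (x i) * cutoff (L j) n (x j) :=
    fun n x => partialDeriv_coord_mul_coord hij ((contDiff_cutoff _ _).differentiable (by simp))
      ((contDiff_cutoff _ _).differentiable (by simp)) x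
  have hηd : ∀ n x, partialDeriv i (η n) x = deriv (cutoff (L i) n) (x i) * ψ x *
      cutoff (L j) n (x j) + κ n x * partialDeriv i ψ x := fun n x => by
    rw [hη]
    simp only
    rw [partialDeriv_mul i ((hκs n).differentiable (by simp) x) (hψ.differentiable (by simp) x), hκd]
    ring
  have htest : ∀ n, 0 < n → IsTestFunction L (η n) := fun n hn => by
    have hn' : (0 : ℝ) < (n : ℝ)⁻¹ := by positivity
    set S : Set Pt := {x | ∀ k, x k ∈ Icc ((n : ℝ)⁻¹) (L k - (n : ℝ)⁻¹)} with hS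
    have hScl : IsClosed S := by
      simp only [hS, Set.ofPred_forall]
      exact isClosed_iInter fun k => isClosed_Icc.preimage (by fun_prop : Continuous fun x : Pt => x k)
    have hSr : S ⊆ rect L := fun x hx k => ⟨hn'.trans_le (hx k).1, by linarith [(hx k).2]⟩
    have hsupp : Function.support (η n) ⊆ S := fun x hx k => by
      by_contra h
      refine hx ?_
      rcases eq_or_eq_fin_two hij k with rfl | rfl
      · simp [hη, hκ, cutoff_eq_zero hn h]
      · simp [hη, hκ, cutoff_eq_zero hn h]
    have hSc : IsCompact S := (UnitMesh.closedRect_compact L).of_isClosed_subset hScl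
      (hSr.trans (UnitMesh.rect_subset_closedRect L))
    exact ⟨hηs n, HasCompactSupport.of_support_subset_isCompact hSc hsupp,
      (closure_minimal hsupp hScl).trans hSr⟩
  obtain ⟨M, hM0, hM⟩ := exists_deriv_cutoff_bound
  obtain ⟨B, hB⟩ := (UnitMesh.closedRect_compact L).exists_bound_of_continuousOn
    (continuous_partialDeriv hψ i).continuousOn
  obtain ⟨B', hB'⟩ := (UnitMesh.closedRect_compact L).exists_bound_of_continuousOn
    hψ.continuous.continuousOn
  have hκ1 : ∀ n x, |κ n x| ≤ 1 := fun n x => by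
    rw [abs_of_nonneg (mul_nonneg (cutoff_nonneg _ _ _) (cutoff_nonneg _ _ _))]
    exact mul_le_one₀ (cutoff_le_one _ _ _) (cutoff_nonneg _ _ _) (cutoff_le_one _ _ _)
  have l1 := tendsto_inner_contL2 f.fst (η := fun n => partialDeriv i (η n))
    (η₀ := partialDeriv i ψ) (fun n => continuous_partialDeriv (hηs n) i)
    (continuous_partialDeriv hψ i) (C := M * K + B) (fun n x hx => by
      rw [hηd]
      refine (abs_add_le _ _).trans (add_le_add ?_ ?_)
      · rw [abs_mul]
        refine (mul_le_of_le_one_right (abs_nonneg _) ?_).trans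
          (hM (L i) K n (x i) (ψ x) (hx i) (hK x hx).1 (hK x hx).2)
        rw [abs_of_nonneg (cutoff_nonneg _ _ _)]
        exact cutoff_le_one _ _ _
      · rw [abs_mul]
        exact (mul_le_of_le_one_left (abs_nonneg _) (hκ1 n x)).trans
          (hB x (UnitMesh.rect_subset_closedRect L hx)))
    (fun x hx => by
      refine tendsto_const_nhds.congr' ?_
      filter_upwards [eventually_cutoff_eq (hx i), eventually_cutoff_eq (hx j)] with n h1 h2
      rw [hηd]
      simp [hκ, h1.1, h1.2, h2.1])
  have l2 := tendsto_inner_contL2 (f.snd i) (η := η) (η₀ := ψ) (fun n => (hηs n).continuous)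
    hψ.continuous (C := B') (fun n x hx => by
      simp only [hη]
      rw [abs_mul]
      exact (mul_le_of_le_one_left (abs_nonneg _) (hκ1 n x)).trans
          (hB' x (UnitMesh.rect_subset_closedRect L hx)))
    (fun x hx => by
      refine tendsto_const_nhds.congr' ?_
      filter_upwards [eventually_cutoff_eq (hx i), eventually_cutoff_eq (hx j)] with n h1 h2
      simp [hη, hκ, h1.1, h2.1])
  have l3 := l1.add l2
  rw [← inner_testPair f i hψ] at l3
  refine tendsto_nhds_unique l3 (tendsto_const_nhds.congr' ?_)
  filter_upwards [eventually_gt_atTop 0] with n hn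
  rw [← inner_testPair f i (hηs n)]
  exact ((mem_H1Rect_iff f).1 hf (η n) (htest n hn) i).symm

end Green

/-! ### Density of smooth functions in `H¹(Ω)` -/

section Density

variable {L : Fin 2 → ℝ}

/-- The pair `(φ, ∇φ)`. -/
noncomputable def smoothPair (L : Fin 2 → ℝ) (φ : Pt → ℝ) (hφ : ContDiff ℝ ∞ φ) : GradPair L :=
  WithLp.toLp 2 (contL2 L φ hφ.continuous,
    WithLp.toLp 2 fun i => contL2 L (partialDeriv i φ) (continuous_partialDeriv hφ i))

lemma inner_smoothPair (f : GradPair L) {φ : Pt → ℝ} (hφ : ContDiff ℝ ∞ φ) :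
    inner ℝ f (smoothPair L φ hφ) = inner ℝ f.fst (contL2 L φ hφ.continuous) +
      ∑ i, inner ℝ (f.snd i) (contL2 L (partialDeriv i φ) (continuous_partialDeriv hφ i)) := by
  rw [WithLp.prod_inner_apply, PiLp.inner_apply]
  rfl

/-- The test function has compact support in the rectangle, so both integrals extend to the plane
and integration by parts has no boundary term. -/
lemma smoothPair_mem {φ : Pt → ℝ} (hφ : ContDiff ℝ ∞ φ) : smoothPair L φ hφ ∈ H1Rect L := by
  intro η hη i
  have hc := hη.continuous_partialDeriv i
  have e1 : ∫ x, (smoothPair L φ hφ).fst x * partialDeriv i η x ∂(rectMeasure L) =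
      ∫ x, φ x * partialDeriv i η x := by
    have : ∫ x, (smoothPair L φ hφ).fst x * partialDeriv i η x ∂(rectMeasure L) =
        ∫ x, φ x * partialDeriv i η x ∂(rectMeasure L) := by
      refine integral_congr_ae ?_
      filter_upwards [coeFn_contL2 (L := L) hφ.continuous] with x hx
      exact congrArg (· * partialDeriv i η x) hx
    rw [this, rectMeasure, setIntegral_eq_integral_of_forall_compl_eq_zero]
    intro x hx
    have h0 : x ∉ tsupport η := fun h => hx (hη.2.2 h)
    have h1 : fderiv ℝ η x = 0 := by
      by_contra h
      exact h0 (support_fderiv_subset ℝ h)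
    rw [partialDeriv, h1, zero_apply, mul_zero]
  have e2 : ∫ x, (smoothPair L φ hφ).snd i x * η x ∂(rectMeasure L) =
      ∫ x, partialDeriv i φ x * η x := by
    have : ∫ x, (smoothPair L φ hφ).snd i x * η x ∂(rectMeasure L) =
        ∫ x, partialDeriv i φ x * η x ∂(rectMeasure L) := by
      refine integral_congr_ae ?_
      filter_upwards [coeFn_contL2 (L := L) (continuous_partialDeriv hφ i)] with x hx
      exact congrArg (· * η x) hx
    rw [this, rectMeasure, setIntegral_eq_integral_of_forall_compl_eq_zero]
    intro x hx
    rw [image_eq_zero_of_notMem_tsupport fun h => hx (hη.2.2 h), mul_zero]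
  rw [e1, e2]
  refine integral_mul_fderiv_eq_neg_fderiv_mul_of_integrable ?_ ?_ ?_ ?_ ?_
  · exact ((continuous_partialDeriv hφ i).mul hη.1.continuous).integrable_of_hasCompactSupport
      hη.2.1.mul_left
  · exact (hφ.continuous.mul hc.1).integrable_of_hasCompactSupport hc.2.mul_left
  · exact (hφ.continuous.mul hη.1.continuous).integrable_of_hasCompactSupport hη.2.1.mul_left
  · exact fun x _ => hφ.differentiable (by simp) x
  · exact fun x _ => hη.1.differentiable (by simp) x

/-- The eigenfunctions of the Neumann problem on an interval. -/
noncomputable def cosFun (ℓ : ℝ) (k : ℤ) (r : ℝ) : ℝ := Real.cos (k * (Real.pi / ℓ) * r)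

lemma contDiff_cosFun (ℓ : ℝ) (k : ℤ) : ContDiff ℝ ∞ (cosFun ℓ k) := by
  unfold cosFun; fun_prop

/-- The derivative of `cosFun`. -/
noncomputable def sinFun (ℓ : ℝ) (k : ℤ) (r : ℝ) : ℝ :=
  -(k * (Real.pi / ℓ)) * Real.sin (k * (Real.pi / ℓ) * r)

lemma contDiff_sinFun (ℓ : ℝ) (k : ℤ) : ContDiff ℝ ∞ (sinFun ℓ k) := by
  unfold sinFun; fun_prop

lemma deriv_cosFun (ℓ : ℝ) (k : ℤ) : deriv (cosFun ℓ k) = sinFun ℓ k := by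
  funext r
  have h : HasDerivAt (fun r : ℝ => k * (Real.pi / ℓ) * r) (k * (Real.pi / ℓ)) r := by
    simpa using (hasDerivAt_id r).const_mul (k * (Real.pi / ℓ))
  rw [show cosFun ℓ k = fun r => Real.cos (k * (Real.pi / ℓ) * r) from rfl, h.cos.deriv, sinFun]
  ring

lemma deriv_sinFun (ℓ : ℝ) (k : ℤ) (r : ℝ) :
    deriv (sinFun ℓ k) r = -(k * (Real.pi / ℓ)) ^ 2 * cosFun ℓ k r := by
  have h : HasDerivAt (fun r : ℝ => k * (Real.pi / ℓ) * r) (k * (Real.pi / ℓ)) r := by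
    simpa using (hasDerivAt_id r).const_mul (k * (Real.pi / ℓ))
  rw [show sinFun ℓ k = fun r => -(k * (Real.pi / ℓ)) * Real.sin (k * (Real.pi / ℓ) * r) from rfl,
    (h.sin.const_mul _).deriv, cosFun]
  ring

lemma abs_sinFun_le {ℓ : ℝ} (hℓ : 0 < ℓ) (k : ℤ) {r : ℝ} (hr : r ∈ Ioo 0 ℓ) :
    |sinFun ℓ k r| ≤ (k * (Real.pi / ℓ)) ^ 2 * r ∧ |sinFun ℓ k r| ≤ (k * (Real.pi / ℓ)) ^ 2 * (ℓ - r) := by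
  have key : ∀ s, 0 < s → |Real.sin (k * (Real.pi / ℓ) * r)| ≤ |(k : ℝ) * (Real.pi / ℓ)| * s →
      |sinFun ℓ k r| ≤ (k * (Real.pi / ℓ)) ^ 2 * s := fun s hs h => by
    rw [sinFun, abs_mul, abs_neg, ← sq_abs, sq, mul_assoc |(k : ℝ) * (Real.pi / ℓ)|]
    exact mul_le_mul_of_nonneg_left h (abs_nonneg _)
  refine ⟨key r hr.1 ?_, key (ℓ - r) (by linarith [hr.2]) ?_⟩
  · refine Real.abs_sin_le_abs.trans ?_
    rw [abs_mul, abs_of_pos hr.1]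
  · have e : k * (Real.pi / ℓ) * r = k * Real.pi - k * (Real.pi / ℓ) * (ℓ - r) := by
      field_simp; ring
    have h1 : |Real.sin (k * (Real.pi / ℓ) * r)| = |Real.sin (k * (Real.pi / ℓ) * (ℓ - r))| := by
      rw [e, Real.sin_sub, Real.sin_int_mul_pi, zero_mul, zero_sub, abs_neg, abs_mul,
        Real.abs_cos_int_mul_pi, one_mul]
    rw [h1]
    refine Real.abs_sin_le_abs.trans ?_
    rw [abs_mul, abs_of_pos (sub_pos.2 hr.2)]

/-- Multiplication by the first cosine keeps the span of the eigenfunctions invariant, the property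
behind the Stone–Weierstrass argument for completeness. -/
lemma cosFun_mul (ℓ : ℝ) (k : ℤ) (r : ℝ) :
    cosFun ℓ 1 r * cosFun ℓ k r = 2⁻¹ * cosFun ℓ (k + 1) r + 2⁻¹ * cosFun ℓ (k - 1) r := by
  simp only [cosFun]
  push_cast
  rw [show ((k : ℝ) + 1) * (Real.pi / ℓ) * r = k * (Real.pi / ℓ) * r + 1 * (Real.pi / ℓ) * r by ring,
    show ((k : ℝ) - 1) * (Real.pi / ℓ) * r = k * (Real.pi / ℓ) * r - 1 * (Real.pi / ℓ) * r by ring,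
    Real.cos_add, Real.cos_sub]
  ring

/-- The eigenfunctions of the Neumann problem on the rectangle. -/
noncomputable def cosProd (L : Fin 2 → ℝ) (κ : Fin 2 → ℤ) (x : Pt) : ℝ :=
  cosFun (L 0) (κ 0) (x 0) * cosFun (L 1) (κ 1) (x 1)

lemma cosProd_eq {i j : Fin 2} (hij : i ≠ j) (κ : Fin 2 → ℤ) (x : Pt) :
    cosProd L κ x = cosFun (L i) (κ i) (x i) * cosFun (L j) (κ j) (x j) := by
  fin_cases i <;> fin_cases j
  · exact absurd rfl hij
  · rfl
  · exact mul_comm _ _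
  · exact absurd rfl hij

lemma contDiff_cosProd (κ : Fin 2 → ℤ) : ContDiff ℝ ∞ (cosProd L κ) :=
  (contDiff_coord (contDiff_cosFun _ _) 0).mul (contDiff_coord (contDiff_cosFun _ _) 1)

lemma contL2_congr {η η' : Pt → ℝ} (hη : Continuous η) (h : η = η') :
    contL2 L η hη = contL2 L η' (h ▸ hη) := by subst h; rfl

lemma contL2_smul (c : ℝ) {η : Pt → ℝ} (hη : Continuous η) (h : Continuous fun x => c * η x) :
    contL2 L (fun x => c * η x) h = c • contL2 L η hη := by
  refine Lp.ext ?_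
  filter_upwards [coeFn_contL2 (L := L) h, coeFn_contL2 (L := L) hη,
    Lp.coeFn_smul c (contL2 L η hη)] with x h1 h2 h3
  rw [h1, h3, Pi.smul_apply, h2, smul_eq_mul]

lemma contL2_add {η η' : Pt → ℝ} (hη : Continuous η) (hη' : Continuous η')
    (h : Continuous fun x => η x + η' x) :
    contL2 L (fun x => η x + η' x) h = contL2 L η hη + contL2 L η' hη' := by
  refine Lp.ext ?_
  filter_upwards [coeFn_contL2 (L := L) h, coeFn_contL2 (L := L) hη, coeFn_contL2 (L := L) hη',
    Lp.coeFn_add (contL2 L η hη) (contL2 L η' hη')] with x h1 h2 h3 h4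
  rw [h1, h4, Pi.add_apply, h2, h3]

/-- Green's formula with eigenfunctions. -/
lemma inner_grad_cosProd (hL : ∀ i, 0 < L i) {f : GradPair L} (hf : f ∈ H1Rect L) (i : Fin 2)
    (κ : Fin 2 → ℤ) :
    inner ℝ (f.snd i) (contL2 L (partialDeriv i (cosProd L κ))
      (continuous_partialDeriv (contDiff_cosProd κ) i)) =
    (κ i * (Real.pi / L i)) ^ 2 * inner ℝ f.fst (contL2 L (cosProd L κ)
      (contDiff_cosProd κ).continuous) := by
  obtain ⟨j, hij⟩ := exists_ne_fin_two i
  have e0 : cosProd L κ = fun x => cosFun (L i) (κ i) (x i) * cosFun (L j) (κ j) (x j) :=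
    funext fun x => cosProd_eq hij κ x
  have e1 : partialDeriv i (cosProd L κ) =
      fun x => sinFun (L i) (κ i) (x i) * cosFun (L j) (κ j) (x j) := by
    funext x
    rw [e0, partialDeriv_coord_mul_coord hij ((contDiff_cosFun _ _).differentiable (by simp))
      ((contDiff_cosFun _ _).differentiable (by simp)), deriv_cosFun]
  have hψ : ContDiff ℝ ∞ fun x : Pt => sinFun (L i) (κ i) (x i) * cosFun (L j) (κ j) (x j) :=
    (contDiff_coord (contDiff_sinFun _ _) i).mul (contDiff_coord (contDiff_cosFun _ _) j)
  have e2 : partialDeriv i (fun x => sinFun (L i) (κ i) (x i) * cosFun (L j) (κ j) (x j)) =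
      fun x => -(κ i * (Real.pi / L i)) ^ 2 * cosProd L κ x := by
    funext x
    rw [partialDeriv_coord_mul_coord hij ((contDiff_sinFun _ _).differentiable (by simp))
      ((contDiff_cosFun _ _).differentiable (by simp)), deriv_sinFun, cosProd_eq hij, mul_assoc]
  -- The `i`-th derivative of a Neumann eigenfunction vanishes linearly on the two sides `xᵢ = 0,
  -- Lᵢ`, so Green's formula has no boundary term.
  have h := inner_testPair_eq_zero_of_vanishing hf hij hψ (K := (κ i * (Real.pi / L i)) ^ 2)
    fun x hx => by
      have h1 := abs_sinFun_le (hL i) (κ i) (hx i)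
      rw [abs_mul]
      have h2 : |cosFun (L j) (κ j) (x j)| ≤ 1 := Real.abs_cos_le_one _
      exact ⟨(mul_le_of_le_one_right (abs_nonneg _) h2).trans h1.1,
        (mul_le_of_le_one_right (abs_nonneg _) h2).trans h1.2⟩
  rw [inner_testPair, contL2_congr _ e2, contL2_smul _ (contDiff_cosProd κ).continuous,
    inner_smul_right] at h
  rw [contL2_congr _ e1]
  linarith

/-- A square integrable function that is orthogonal to all eigenfunctions vanishes. -/
lemma eq_zero_of_inner_cosProd (hL : ∀ i, 0 < L i) {u : L2Rect L ℝ}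
    (h : ∀ κ, inner ℝ u (contL2 L (cosProd L κ) (contDiff_cosProd κ).continuous) = 0) : u = 0 := by
  have hu : Integrable (fun x => u x) (rectMeasure L) := (Lp.memLp u).integrable (by norm_num)
  -- `Q w` says that `u w` is orthogonal to all eigenfunctions, `R H` that multiplication by `H`
  -- preserves this. The functions with `R` are closed under sums and products and contain the first
  -- cosines, hence the algebra `A` below.
  let Q : (Pt → ℝ) → Prop := fun w => ∀ κ, ∫ x, u x * (w x * cosProd L κ x) ∂(rectMeasure L) = 0
  let R : (Pt → ℝ) → Prop := fun H => Continuous H ∧ ∀ w, Continuous w → Q w → Q fun x => H x * w x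
  have hint : ∀ {w : Pt → ℝ}, Continuous w → Integrable (fun x => u x * w x) (rectMeasure L) :=
    fun {w} hw => (Lp.memLp u).integrable_mul (UnitMesh.memLp_of_continuousOn hw.continuousOn)
  have hint' : ∀ {w : Pt → ℝ} (κ : Fin 2 → ℤ), Continuous w →
      Integrable (fun x => u x * (w x * cosProd L κ x)) (rectMeasure L) :=
    fun κ hw => hint (hw.mul (contDiff_cosProd κ).continuous)
  have hc : ∀ i : Fin 2, R fun x => cosFun (L i) 1 (x i) := fun i => by
    refine ⟨(contDiff_coord (contDiff_cosFun _ _) i).continuous, fun w hw hQ κ => ?_⟩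
    obtain ⟨j, hij⟩ := exists_ne_fin_two i
    have e : ∀ x, u x * (cosFun (L i) 1 (x i) * w x * cosProd L κ x) =
        2⁻¹ * (u x * (w x * cosProd L (Function.update κ i (κ i + 1)) x)) +
        2⁻¹ * (u x * (w x * cosProd L (Function.update κ i (κ i - 1)) x)) := fun x => by
      simp only [cosProd_eq hij, Function.update_self, Function.update_of_ne hij.symm]
      linear_combination (u x * w x * cosFun (L j) (κ j) (x j)) * cosFun_mul (L i) (κ i) (x i)
    simp only [e]
    rw [integral_add ((hint' _ hw).const_mul _) ((hint' _ hw).const_mul _), integral_const_mul,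
      integral_const_mul, hQ, hQ]
    simp
  let c : Fin 2 → C(closedRect L, ℝ) := fun i =>
    ⟨fun x => cosFun (L i) 1 (x.1 i), (hc i).1.comp continuous_subtype_val⟩
  let A : Subalgebra ℝ C(closedRect L, ℝ) := Algebra.adjoin ℝ (range c)
  have hA : ∀ g ∈ A, ∃ H, R H ∧ ∀ x : closedRect L, g x = H x := fun g hg => by
    induction hg using Algebra.adjoin_induction with
    | mem g hg => obtain ⟨i, rfl⟩ := hg; exact ⟨_, hc i, fun x => rfl⟩
    | algebraMap r =>
      refine ⟨fun _ => r, ⟨continuous_const, fun w hw hQ κ => ?_⟩, fun x => rfl⟩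
      have e : ∀ x, u x * (r * w x * cosProd L κ x) = r * (u x * (w x * cosProd L κ x)) := fun x => by
        ring
      simp only [e, integral_const_mul, hQ κ, mul_zero]
    | add g g' _ _ h h' =>
      obtain ⟨H, hH, hg⟩ := h
      obtain ⟨H', hH', hg'⟩ := h'
      refine ⟨fun x => H x + H' x, ⟨hH.1.add hH'.1, fun w hw hQ κ => ?_⟩, fun x => ?_⟩
      · have e : ∀ x, u x * ((H x + H' x) * w x * cosProd L κ x) =
            u x * (H x * w x * cosProd L κ x) + u x * (H' x * w x * cosProd L κ x) := fun x => by ring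
        simp only [e]
        rw [integral_add (hint' (w := fun x => H x * w x) κ (hH.1.mul hw))
          (hint' (w := fun x => H' x * w x) κ (hH'.1.mul hw)), hH.2 w hw hQ κ,
          hH'.2 w hw hQ κ, add_zero]
      · rw [ContinuousMap.add_apply, hg, hg']
    | mul g g' _ _ h h' =>
      obtain ⟨H, hH, hg⟩ := h
      obtain ⟨H', hH', hg'⟩ := h'
      refine ⟨fun x => H x * H' x, ⟨hH.1.mul hH'.1, fun w hw hQ κ => ?_⟩, fun x => ?_⟩
      · have := hH.2 (fun x => H' x * w x) (hH'.1.mul hw) (hH'.2 w hw hQ) κ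
        simpa only [mul_assoc] using this
      · rw [ContinuousMap.mul_apply, hg, hg']
  have hAsep : A.SeparatesPoints := by
    intro x y hxy
    obtain ⟨i, hi⟩ : ∃ i, x.1 i ≠ y.1 i := by
      by_contra hcon
      exact hxy (Subtype.ext (by ext i; exact not_not.1 (not_exists.1 hcon i)))
    refine ⟨c i, ⟨c i, Algebra.subset_adjoin ⟨i, rfl⟩, rfl⟩, fun heq => hi ?_⟩
    -- The argument of the first cosine runs through `[0, π]`, where cosine is injective; so the
    -- generators separate points.
    have hmem : ∀ z : closedRect L, ((1 : ℤ) : ℝ) * (Real.pi / L i) * z.1 i ∈ Icc 0 Real.pi := fun z => by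
      have h1 := z.2 i
      have h2 := (hL i)
      rw [Int.cast_one, one_mul]
      refine ⟨mul_nonneg (by positivity) h1.1, ?_⟩
      rw [div_mul_eq_mul_div, div_le_iff₀ h2]
      exact mul_le_mul_of_nonneg_left h1.2 Real.pi_pos.le
    have h3 := Real.injOn_cos (hmem x) (hmem y) heq
    have h4 : ((1 : ℤ) : ℝ) * (Real.pi / L i) ≠ 0 := by
      rw [Int.cast_one, one_mul]; exact (div_pos Real.pi_pos (hL i)).ne'
    exact mul_left_cancel₀ h4 h3
  have : CompactSpace (closedRect L) := isCompact_iff_compactSpace.1 (UnitMesh.closedRect_compact L)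
  have hQ1 : Q fun _ => 1 := fun κ => by
    simp only [one_mul]
    rw [← inner_contL2 (contDiff_cosProd κ).continuous]
    exact h κ
  refine L2Rect_eq_zero fun φ hφ => ?_
  rw [inner_contL2]
  set I := ∫ x, |u x| ∂(rectMeasure L) with hI
  have hI0 : 0 ≤ I := integral_nonneg fun x => abs_nonneg _
  refine abs_eq_zero.1 (le_antisymm (le_of_forall_pos_le_add fun ε hε => ?_) (abs_nonneg _))
  obtain ⟨⟨g, hg⟩, hgφ⟩ := ContinuousMap.exists_mem_subalgebra_near_continuous_of_separatesPoints A
    hAsep (fun x => φ x.1) (hφ.1.continuous.comp continuous_subtype_val) (ε / (I + 1)) (by positivity)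
  obtain ⟨H, hH, hgH⟩ := hA g hg
  have h0 : ∫ x, u x * H x ∂(rectMeasure L) = 0 := by
    have := hH.2 _ continuous_const hQ1 0
    simpa [cosProd, cosFun] using this
  have h1 : ∫ x, u x * φ x ∂(rectMeasure L) = ∫ x, u x * (φ x - H x) ∂(rectMeasure L) := by
    simp only [mul_sub]
    rw [integral_sub (hint hφ.1.continuous) (hint hH.1), h0, sub_zero]
  rw [h1, zero_add]
  calc |∫ x, u x * (φ x - H x) ∂(rectMeasure L)| ≤ ∫ x, |u x| * (ε / (I + 1)) ∂(rectMeasure L) := by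
        rw [← Real.norm_eq_abs]
        refine norm_integral_le_of_norm_le (hu.abs.mul_const _) ?_
        filter_upwards [ae_mem_rect L] with x hx
        rw [Real.norm_eq_abs, abs_mul]
        refine mul_le_mul_of_nonneg_left ?_ (abs_nonneg _)
        have := hgφ ⟨x, UnitMesh.rect_subset_closedRect L hx⟩
        rw [abs_sub_comm]
        exact (hgH ⟨x, UnitMesh.rect_subset_closedRect L hx⟩ ▸ this).le
    _ = I * (ε / (I + 1)) := by rw [integral_mul_const]
    _ ≤ ε := by
        rw [mul_div_assoc', div_le_iff₀ (by positivity)]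
        nlinarith

variable (L) in
/-- The space of the pairs `(φ, ∇φ)` of smooth functions. -/
def smoothPairs : Submodule ℝ (GradPair L) where
  carrier := {f | ∃ φ, ∃ hφ : ContDiff ℝ ∞ φ, f = smoothPair L φ hφ}
  zero_mem' := ⟨fun _ => 0, contDiff_const, by
    have h1 : contL2 L (fun _ : Pt => (0 : ℝ)) continuous_const = 0 :=
      Lp.ext (by
        filter_upwards [coeFn_contL2 (L := L) (continuous_const (y := (0 : ℝ))),
          Lp.coeFn_zero ℝ 2 (rectMeasure L)] with x h1 h2
        rw [h1, h2, Pi.zero_apply])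
    have h2 : ∀ i, partialDeriv i (fun _ : Pt => (0 : ℝ)) = fun _ => 0 := fun i => by
      funext x; simp [partialDeriv]
    rw [smoothPair, h1]
    have h3 : (fun i => contL2 L (partialDeriv i fun _ : Pt => (0 : ℝ))
        (continuous_partialDeriv contDiff_const i)) = 0 := by
      funext i
      rw [contL2_congr _ (h2 i), h1]
      rfl
    rw [h3]
    rfl⟩
  add_mem' := by
    rintro _ _ ⟨φ, hφ, rfl⟩ ⟨ψ, hψ, rfl⟩
    refine ⟨fun x => φ x + ψ x, hφ.add hψ, ?_⟩
    have h2 : ∀ i, partialDeriv i (fun x => φ x + ψ x) =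
        fun x => partialDeriv i φ x + partialDeriv i ψ x := fun i => by
      funext x
      rw [partialDeriv, fderiv_fun_add (hφ.differentiable (by simp) x)
        (hψ.differentiable (by simp) x)]
      rfl
    have h3 : (fun i => contL2 L (partialDeriv i fun x => φ x + ψ x)
        (continuous_partialDeriv (hφ.add hψ) i)) = fun i => contL2 L (partialDeriv i φ)
        (continuous_partialDeriv hφ i) + contL2 L (partialDeriv i ψ) (continuous_partialDeriv hψ i) := by
      funext i
      rw [contL2_congr _ (h2 i), contL2_add]
    symm
    rw [smoothPair, h3, contL2_add hφ.continuous hψ.continuous]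
    rfl
  smul_mem' := by
    rintro c _ ⟨φ, hφ, rfl⟩
    refine ⟨fun x => c * φ x, contDiff_const.mul hφ, ?_⟩
    have h2 : ∀ i, partialDeriv i (fun x => c * φ x) = fun x => c * partialDeriv i φ x := fun i => by
      funext x
      rw [partialDeriv, fderiv_const_mul (hφ.differentiable (by simp) x)]
      rfl
    have h3 : (fun i => contL2 L (partialDeriv i fun x => c * φ x)
        (continuous_partialDeriv (contDiff_const.mul hφ) i)) = fun i => c • contL2 L (partialDeriv i φ)
        (continuous_partialDeriv hφ i) := by
      funext i
      rw [contL2_congr _ (h2 i), contL2_smul]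
    symm
    rw [smoothPair, h3, contL2_smul c hφ.continuous]
    rfl

/-- Smooth functions are dense in `H¹(Ω)`. -/
lemma mem_closure_smoothPairs (hL : ∀ i, 0 < L i) {f : GradPair L} (hf : f ∈ H1Rect L) :
    f ∈ (smoothPairs L).topologicalClosure := by
  set M := (smoothPairs L).topologicalClosure with hM
  have hMc : IsClosed (M : Set (GradPair L)) := Submodule.isClosed_topologicalClosure _
  have : CompleteSpace M := hMc.completeSpace_coe
  have hMle : M ≤ H1Rect L := Submodule.topologicalClosure_minimal _ (by
    rintro _ ⟨φ, hφ, rfl⟩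
    exact smoothPair_mem hφ) isClosed_H1Rect
  -- The part of `f` orthogonal to the smooth pairs. By Green's formula, orthogonality to an
  -- eigenfunction reads `(1 + λ) ⟨g, cos⟩ = 0` with `λ ≥ 0`, so the function vanishes, and then its
  -- weak gradient does too.
  set g : GradPair L := f - M.orthogonalProjectionOnto f with hg
  have hgH : g ∈ H1Rect L := (H1Rect L).sub_mem hf (hMle (M.orthogonalProjectionOnto f).2)
  have hgo : ∀ φ (hφ : ContDiff ℝ ∞ φ), inner ℝ g (smoothPair L φ hφ) = 0 := fun φ hφ =>
    Submodule.inner_left_of_mem_orthogonal (K := M)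
      (Submodule.le_topologicalClosure _ ⟨φ, hφ, rfl⟩) (Submodule.sub_starProjection_mem_orthogonal f)
  have hg1 : g.fst = 0 := eq_zero_of_inner_cosProd hL fun κ => by
    have h := hgo _ (contDiff_cosProd (L := L) κ)
    rw [inner_smoothPair, Finset.sum_congr rfl fun i _ => inner_grad_cosProd hL hgH i κ,
      ← Finset.sum_mul, ← one_add_mul] at h
    refine (mul_eq_zero.1 h).resolve_left ?_
    positivity
  have hg2 : ∀ i, g.snd i = 0 := fun i => L2Rect_eq_zero fun φ hφ => by
    have h := (mem_H1Rect_iff g).1 hgH φ hφ i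
    rwa [inner_testPair, hg1, inner_zero_left, zero_add] at h
  have hg0 : g = 0 := by
    have h : g.snd = 0 := PiLp.ext fun i => hg2 i
    exact WithLp.ofLp_injective 2 (Prod.ext hg1 h)
  rw [sub_eq_zero.1 hg0]
  exact (M.orthogonalProjectionOnto f).2

lemma exists_tendsto_smoothPair (hL : ∀ i, 0 < L i) {f : GradPair L} (hf : f ∈ H1Rect L) :
    ∃ (φ : ℕ → Pt → ℝ) (hφ : ∀ k, ContDiff ℝ ∞ (φ k)),
      Tendsto (fun k => smoothPair L (φ k) (hφ k)) atTop (𝓝 f) := by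
  have h := mem_closure_smoothPairs hL hf
  obtain ⟨x, hx, hlim⟩ := mem_closure_iff_seq_limit.1
    (show f ∈ closure (smoothPairs L : Set (GradPair L)) from h)
  choose φ hφ he using hx
  exact ⟨φ, hφ, by simpa only [← he] using hlim⟩

end Density

/-! ### Traces on the sides of the rectangle -/

section Trace

/-- The point with `i`-th coordinate `r` whose other coordinate is `s`. -/
noncomputable def sidePoint (i : Fin 2) (r s : ℝ) : Pt := WithLp.toLp 2 (Function.update (fun _ => s) i r)

lemma sidePoint_self (i : Fin 2) (r s : ℝ) : sidePoint i r s i = r := by simp [sidePoint]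

lemma sidePoint_ne {i j : Fin 2} (hij : i ≠ j) (r s : ℝ) : sidePoint i r s j = s := by
  simp [sidePoint, hij.symm]

lemma eq_sidePoint {i j : Fin 2} (hij : i ≠ j) (x : Pt) : x = sidePoint i (x i) (x j) := by
  ext k
  rcases eq_or_eq_fin_two hij k with rfl | rfl
  · rw [sidePoint_self]
  · rw [sidePoint_ne hij]

lemma sidePoint_eq_add (i : Fin 2) (r s : ℝ) :
    sidePoint i r s = sidePoint i 0 s + r • EuclideanSpace.single i (1 : ℝ) := by
  obtain ⟨j, hij⟩ := exists_ne_fin_two i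
  ext k
  rcases eq_or_eq_fin_two hij k with rfl | rfl
  · simp [sidePoint_self]
  · simp [sidePoint_ne hij, hij.symm]

lemma continuous_sidePoint (i : Fin 2) : Continuous fun p : ℝ × ℝ => sidePoint i p.2 p.1 := by
  unfold sidePoint
  refine (PiLp.continuous_toLp 2 _).comp ?_
  exact (continuous_pi fun _ => continuous_fst).update i continuous_snd

lemma exists_coord_equiv {i j : Fin 2} (hij : i ≠ j) : ∃ e : Pt ≃ᵐ ℝ × ℝ,
    MeasurePreserving e volume volume ∧ ∀ x, e x = (x j, x i) := by
  let e₀ : Pt ≃ᵐ ℝ × ℝ :=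
    (MeasurableEquiv.toLp 2 (Fin 2 → ℝ)).symm.trans MeasurableEquiv.finTwoArrow
  have h₀ : MeasurePreserving e₀ volume volume :=
    (volume_preserving_finTwoArrow ℝ).comp (EuclideanSpace.volume_preserving_symm_measurableEquiv_toLp (Fin 2))
  fin_cases i <;> fin_cases j
  · exact absurd rfl hij
  · exact ⟨e₀.trans MeasurableEquiv.prodComm, Measure.measurePreserving_swap.comp h₀, fun x => rfl⟩
  · exact ⟨e₀, h₀, fun x => rfl⟩
  · exact absurd rfl hij

variable {L : Fin 2 → ℝ}

lemma integral_rect {i j : Fin 2} (hij : i ≠ j) {F : Pt → ℝ} (hF : Continuous F) :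
    ∫ x, F x ∂(rectMeasure L) =
      ∫ s in Ioo 0 (L j), ∫ r in Ioo 0 (L i), F (sidePoint i r s) := by
  obtain ⟨e, he, hex⟩ := exists_coord_equiv hij
  have hpre : rect L = e ⁻¹' (Ioo 0 (L j) ×ˢ Ioo 0 (L i)) := by
    ext x
    simp only [rect, Set.mem_ofPred_eq, mem_preimage, hex, mem_prod]
    refine ⟨fun h => ⟨h j, h i⟩, fun h k => ?_⟩
    rcases eq_or_eq_fin_two hij k with rfl | rfl
    · exact h.2
    · exact h.1
  have hcomp : ∀ x, F x = (fun p : ℝ × ℝ => F (sidePoint i p.2 p.1)) (e x) := fun x => by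
    simp only [hex]
    rw [← eq_sidePoint hij]
  have hc : Continuous fun p : ℝ × ℝ => F (sidePoint i p.2 p.1) := hF.comp (continuous_sidePoint i)
  rw [rectMeasure, hpre]
  rw [integral_congr_ae (Eventually.of_forall hcomp), he.setIntegral_preimage_emb e.measurableEmbedding
    (fun p : ℝ × ℝ => F (sidePoint i p.2 p.1)), Measure.volume_eq_prod, setIntegral_prod]
  refine (hc.continuousOn.integrableOn_compact (isCompact_Icc.prod isCompact_Icc)).mono_set
    (prod_mono Ioo_subset_Icc_self Ioo_subset_Icc_self)

lemma integral_partialDeriv_rect (hL : ∀ i, 0 < L i) {i j : Fin 2} (hij : i ≠ j) {F : Pt → ℝ}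
    (hF : ContDiff ℝ ∞ F) : ∫ x, partialDeriv i F x ∂(rectMeasure L) =
      ∫ s in Ioo 0 (L j), (F (sidePoint i (L i) s) - F (sidePoint i 0 s)) := by
  rw [integral_rect hij (continuous_partialDeriv hF i)]
  refine integral_congr_ae (Eventually.of_forall fun s => ?_)
  have hd : ∀ r, HasDerivAt (fun r => F (sidePoint i r s)) (partialDeriv i F (sidePoint i r s)) r :=
    fun r => by
    have h1 : HasDerivAt (fun r => sidePoint i r s) (EuclideanSpace.single i (1 : ℝ)) r := by
      have : (fun r => sidePoint i r s) =
          fun r => sidePoint i 0 s + r • EuclideanSpace.single i (1 : ℝ) :=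
        funext fun r => sidePoint_eq_add i r s
      rw [this]
      simpa using ((hasDerivAt_id r).smul_const (EuclideanSpace.single i (1 : ℝ))).const_add
        (sidePoint i 0 s)
    exact ((hF.differentiable (by simp) _).hasFDerivAt).comp_hasDerivAt r h1
  have hc : Continuous fun r => partialDeriv i F (sidePoint i r s) :=
    (continuous_partialDeriv hF i).comp ((continuous_sidePoint i).comp (by fun_prop :
      Continuous fun r : ℝ => (s, r)))
  simp only
  rw [← integral_Ioc_eq_integral_Ioo, ← intervalIntegral.integral_of_le (hL i).le]
  exact intervalIntegral.integral_eq_sub_of_hasDerivAt (fun r _ => hd r) (hc.intervalIntegrable _ _)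

lemma norm_contL2_mul_le {m φ : Pt → ℝ} (hφ : Continuous φ) (hmφ : Continuous fun x => m x * φ x)
    {K : ℝ} (hK : ∀ x, |m x| ≤ K) : ‖contL2 L (fun x => m x * φ x) hmφ‖ ≤ K * ‖contL2 L φ hφ‖ := by
  refine Lp.norm_le_mul_norm_of_ae_le_mul ?_
  filter_upwards [coeFn_contL2 (L := L) hφ, coeFn_contL2 (L := L) hmφ] with x h1 h2
  rw [h1, h2, norm_mul]
  exact mul_le_mul_of_nonneg_right (hK x) (norm_nonneg _)

lemma inner_smoothPair_testPair (i : Fin 2) {φ η : Pt → ℝ} (hφ : ContDiff ℝ ∞ φ) (hη : ContDiff ℝ ∞ η) :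
    inner ℝ (smoothPair L φ hφ) (testPair L i η hη) =
      ∫ x, partialDeriv i (fun x => φ x * η x) x ∂(rectMeasure L) := by
  have h1 : inner ℝ (contL2 L φ hφ.continuous)
      (contL2 L (partialDeriv i η) (continuous_partialDeriv hη i)) =
      ∫ x, φ x * partialDeriv i η x ∂(rectMeasure L) := by
    rw [inner_contL2]
    refine integral_congr_ae ?_
    filter_upwards [coeFn_contL2 (L := L) hφ.continuous] with x hx
    rw [hx]
  have h2 : inner ℝ (contL2 L (partialDeriv i φ) (continuous_partialDeriv hφ i))
      (contL2 L η hη.continuous) = ∫ x, partialDeriv i φ x * η x ∂(rectMeasure L) := by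
    rw [inner_contL2]
    refine integral_congr_ae ?_
    filter_upwards [coeFn_contL2 (L := L) (continuous_partialDeriv hφ i)] with x hx
    rw [hx]
  have hint : ∀ {F : Pt → ℝ}, Continuous F → Integrable F (rectMeasure L) := fun hF =>
    (UnitMesh.memLp_of_continuousOn (L := L) hF.continuousOn).integrable (by norm_num)
  rw [inner_testPair]
  change inner ℝ (contL2 L φ hφ.continuous) _ +
    inner ℝ (contL2 L (partialDeriv i φ) (continuous_partialDeriv hφ i)) _ = _
  rw [h1, h2, ← integral_add
    (hint (F := fun x => φ x * partialDeriv i η x) (hφ.continuous.mul (continuous_partialDeriv hη i)))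
    (hint (F := fun x => partialDeriv i φ x * η x)
      ((continuous_partialDeriv hφ i).mul hη.continuous))]
  refine integral_congr_ae (Eventually.of_forall fun x => ?_)
  simp only
  rw [partialDeriv_mul i (hφ.differentiable (by simp) x) (hη.differentiable (by simp) x), add_comm]

/-- Smooth functions with compact support that meet the boundary only in the part of the side
`xᵢ = b` with `α < xⱼ < β`. -/
structure IsBoundaryTest (L : Fin 2 → ℝ) (i j : Fin 2) (b α β : ℝ) (η : Pt → ℝ) : Prop where
  contDiff : ContDiff ℝ ∞ η
  hasCompactSupport : HasCompactSupport η
  ne_of_mem_tsupport : ∀ x ∈ tsupport η, x i ≠ L i - b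
  mem_of_mem_tsupport : ∀ x ∈ tsupport η, x j ∈ Ioo α β

/-- An estimate of the trace on a part of a side where Green's formula holds without boundary
integral. -/
lemma exists_trace_bound (hL : ∀ i, 0 < L i) {i j : Fin 2} (hij : i ≠ j) {b : ℝ}
    (hb : b = 0 ∨ b = L i) : ∃ M : ℝ, 0 ≤ M ∧ ∀ (α β : ℝ) (f : GradPair L),
      (∀ η (hη : IsBoundaryTest L i j b α β η), inner ℝ f (testPair L i η hη.contDiff) = 0) →
      ∀ φ (hφ : ContDiff ℝ ∞ φ) (τ : ℝ → ℝ), ContDiff ℝ ∞ τ → (∀ s, τ s ∈ Icc 0 1) →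
        HasCompactSupport τ → tsupport τ ⊆ Ioo α β →
        ∫ s in Ioo 0 (L j), τ s * φ (sidePoint i b s) ^ 2 ≤
          M * ‖smoothPair L φ hφ‖ * ‖smoothPair L φ hφ - f‖ := by
  have hLi := hL i
  -- `θ` equals one on the side `xᵢ = b`, and its support, of radius `Lᵢ / 2`, misses the opposite
  -- side `xᵢ = Lᵢ - b`.
  let θb : ContDiffBump b := ⟨L i / 4, L i / 2, by positivity, by linarith⟩
  set θ : ℝ → ℝ := fun r => θb r with hθ
  have hθs : ContDiff ℝ ∞ θ := θb.contDiff
  have hθt : ∀ r, r ∈ tsupport θ → |r - b| ≤ L i / 2 := fun r hr => by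
    rw [hθ, θb.tsupport_eq] at hr
    exact hr
  have hθc : HasCompactSupport θ := θb.hasCompactSupport
  have hθb : θ b = 1 := θb.one_of_mem_closedBall (by simp [θb]; positivity)
  have hbb : |L i - b - b| = L i := by
    rcases hb with rfl | rfl
    · simp [hLi.le]
    · rw [sub_self, zero_sub, abs_neg, abs_of_pos hLi]
  have hθn : L i - b ∉ tsupport θ := fun h => by
    have := hθt _ h
    rw [hbb] at this
    linarith
  have hθb' : θ (L i - b) = 0 := image_eq_zero_of_notMem_tsupport hθn
  have hθ1 : ∀ r, |θ r| ≤ 1 := fun r => by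
    rw [abs_of_nonneg θb.nonneg]; exact θb.le_one
  obtain ⟨M, hM⟩ := hθc.deriv.exists_bound_of_continuous (hθs.continuous_deriv (by simp))
  have hM0 : 0 ≤ M := (norm_nonneg _).trans (hM 0)
  -- `M` bounds `θ'`; one unit comes from the term with `∂ᵢφ` and one from the second component of
  -- the test pair.
  refine ⟨M + 2, by positivity, fun α β f hf φ hφ τ hτ hτ01 hτc hτt => ?_⟩
  set ρ : Pt → ℝ := fun x => θ (x i) * τ (x j) with hρ
  set η : Pt → ℝ := fun x => ρ x * φ x with hη
  have hρs : ContDiff ℝ ∞ ρ := (contDiff_coord hθs i).mul (contDiff_coord hτ j)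
  have hηs : ContDiff ℝ ∞ η := hρs.mul hφ
  have hτ1 : ∀ s, |τ s| ≤ 1 := fun s => by rw [abs_of_nonneg (hτ01 s).1]; exact (hτ01 s).2
  have hηt : tsupport η ⊆ {x | x i ∈ tsupport θ ∧ x j ∈ tsupport τ} := by
    refine closure_minimal (fun x hx => ⟨subset_closure fun h => hx ?_, subset_closure fun h => hx ?_⟩) ?_
    · simp [hη, hρ, h]
    · simp [hη, hρ, h]
    · rw [Set.ofPred_and]
      exact ((isClosed_tsupport θ).preimage (by fun_prop : Continuous fun x : Pt => x i)).inter
        ((isClosed_tsupport τ).preimage (by fun_prop : Continuous fun x : Pt => x j))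
  have htest : IsBoundaryTest L i j b α β η := by
    refine ⟨hηs, ?_, fun x hx h => hθn (h ▸ (hηt hx).1), fun x hx => hτt (hηt hx).2⟩
    have hK : IsCompact ((fun p : ℝ × ℝ => sidePoint i p.2 p.1) '' (tsupport τ ×ˢ tsupport θ)) :=
      (hτc.isCompact.prod hθc.isCompact).image (continuous_sidePoint i)
    refine HasCompactSupport.of_support_subset_isCompact hK fun x hx => ?_
    have := hηt (subset_closure hx)
    exact ⟨(x j, x i), ⟨this.2, this.1⟩, (eq_sidePoint hij x).symm⟩
  have hηd : partialDeriv i η = fun x => deriv θ (x i) * τ (x j) * φ x + ρ x * partialDeriv i φ x := by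
    funext x
    rw [hη]
    simp only
    rw [partialDeriv_mul i (hρs.differentiable (by simp) x) (hφ.differentiable (by simp) x), hρ,
      partialDeriv_coord_mul_coord hij (hθs.differentiable (by simp)) (hτ.differentiable (by simp))]
  have hφd := continuous_partialDeriv hφ i
  have hθd : Continuous (deriv θ) := hθs.continuous_deriv (by simp)
  have hc1 : Continuous fun x : Pt => deriv θ (x i) * τ (x j) * φ x :=
    ((hθd.comp (by fun_prop : Continuous fun x : Pt => x i)).mul
      (hτ.continuous.comp (by fun_prop : Continuous fun x : Pt => x j))).mul hφ.continuous
  have hc2 : Continuous fun x : Pt => ρ x * partialDeriv i φ x := hρs.continuous.mul hφd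
  have hρ1 : ∀ x, |ρ x| ≤ 1 := fun x => by
    rw [hρ, abs_mul]; exact mul_le_one₀ (hθ1 _) (abs_nonneg _) (hτ1 _)
  set P := smoothPair L φ hφ with hP
  have hP1 : ‖contL2 L φ hφ.continuous‖ ≤ ‖P‖ := WithLp.norm_fst_le _ P
  have hP2 : ‖contL2 L (partialDeriv i φ) hφd‖ ≤ ‖P‖ :=
    (PiLp.norm_apply_le P.snd i).trans (WithLp.norm_snd_le _ P)
  have n1 : ‖contL2 L (partialDeriv i η) (continuous_partialDeriv hηs i)‖ ≤ (M + 1) * ‖P‖ := by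
    rw [contL2_congr _ hηd, contL2_add hc1 hc2, add_mul, one_mul]
    refine (norm_add_le _ _).trans (add_le_add ?_ ?_)
    · refine (norm_contL2_mul_le hφ.continuous hc1 (K := M) fun x => ?_).trans
        (mul_le_mul_of_nonneg_left hP1 hM0)
      rw [abs_mul]
      exact (mul_le_of_le_one_right (abs_nonneg _) (hτ1 _)).trans (hM _)
    · refine (norm_contL2_mul_le hφd hc2 hρ1).trans ?_
      rw [one_mul]; exact hP2
  have n2 : ‖contL2 L η hηs.continuous‖ ≤ ‖P‖ :=
    (norm_contL2_mul_le hφ.continuous hηs.continuous hρ1).trans (by rw [one_mul]; exact hP1)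
  have n3 : |inner ℝ (P - f) (testPair L i η hηs)| ≤ (M + 2) * ‖P‖ * ‖P - f‖ := by
    rw [inner_testPair]
    have a1 := abs_real_inner_le_norm (P - f).fst
      (contL2 L (partialDeriv i η) (continuous_partialDeriv hηs i))
    have a2 := abs_real_inner_le_norm ((P - f).snd i) (contL2 L η hηs.continuous)
    have a3 : ‖(P - f).fst‖ ≤ ‖P - f‖ := WithLp.norm_fst_le _ (P - f)
    have a4 : ‖(P - f).snd i‖ ≤ ‖P - f‖ :=
      (PiLp.norm_apply_le (P - f).snd i).trans (WithLp.norm_snd_le _ (P - f))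
    calc _ ≤ _ := abs_add_le _ _
      _ ≤ ‖P - f‖ * ((M + 1) * ‖P‖) + ‖P - f‖ * ‖P‖ := add_le_add
          (a1.trans (mul_le_mul a3 n1 (norm_nonneg _) (norm_nonneg _)))
          (a2.trans (mul_le_mul a4 n2 (norm_nonneg _) (norm_nonneg _)))
      _ = _ := by ring
  -- The test pair annihilates `f`, so pairing it with `P - f` leaves the boundary integral of `φ
  -- η`, which up to sign is the weighted square of the trace of `φ`.
  have e1 : inner ℝ (P - f) (testPair L i η hηs) = ∫ s in Ioo 0 (L j),
      (φ (sidePoint i (L i) s) * η (sidePoint i (L i) s) - φ (sidePoint i 0 s) * η (sidePoint i 0 s)) := by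
    rw [inner_sub_left, hf η htest, sub_zero, hP, inner_smoothPair_testPair,
      integral_partialDeriv_rect hL hij (hφ.mul hηs)]
  have e2 : |∫ s in Ioo 0 (L j), τ s * φ (sidePoint i b s) ^ 2| =
      |inner ℝ (P - f) (testPair L i η hηs)| := by
    have h1 : ∀ r s, η (sidePoint i r s) = θ r * τ s * φ (sidePoint i r s) := fun r s => by
      simp only [hη, hρ, sidePoint_self, sidePoint_ne hij]
    rw [e1]
    simp only [h1]
    rcases hb with rfl | rfl
    · rw [sub_zero] at hθb'
      simp only [hθb, hθb', zero_mul, mul_zero, zero_sub, integral_neg, abs_neg]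
      congr 2
      funext s; ring
    · rw [sub_self] at hθb'
      simp only [hθb, hθb', zero_mul, mul_zero, sub_zero]
      congr 2
      funext s; ring
  exact (le_abs_self _).trans (e2 ▸ n3)

/-- The trace vanishes on a part of a side where Green's formula holds without boundary integral. -/
lemma tendsto_trace_zero (hL : ∀ i, 0 < L i) {i j : Fin 2} (hij : i ≠ j) {b α β : ℝ}
    (hb : b = 0 ∨ b = L i) (hα : 0 ≤ α) (hβ : β ≤ L j) {f : GradPair L}
    (hf : ∀ η (hη : IsBoundaryTest L i j b α β η), inner ℝ f (testPair L i η hη.contDiff) = 0)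
    {φ : ℕ → Pt → ℝ} (hφ : ∀ k, ContDiff ℝ ∞ (φ k))
    (hlim : Tendsto (fun k => smoothPair L (φ k) (hφ k)) atTop (𝓝 f)) :
    Tendsto (fun k => ∫ s in Ioo α β, φ k (sidePoint i b s) ^ 2) atTop (𝓝 0) := by
  obtain ⟨M, hM0, hM⟩ := exists_trace_bound hL hij hb
  have key : ∀ k, ∫ s in Ioo α β, φ k (sidePoint i b s) ^ 2 ≤
      M * ‖smoothPair L (φ k) (hφ k)‖ * ‖smoothPair L (φ k) (hφ k) - f‖ := fun k => by
    set g : ℝ → ℝ := fun s => φ k (sidePoint i b s) ^ 2 with hg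
    have hgc : Continuous g := ((hφ k).continuous.comp ((continuous_sidePoint i).comp
      (by fun_prop : Continuous fun s : ℝ => (s, b)))).pow 2
    have hgi : IntegrableOn g (Ioo α β) :=
      (hgc.continuousOn.integrableOn_compact isCompact_Icc).mono_set Ioo_subset_Icc_self
    -- Cutoffs that converge to one on `(α, β)`; the trace bound does not depend on them.
    set τ : ℕ → ℝ → ℝ := fun n s => cutoff (β - α) n (s - α) with hτ
    have hτs : ∀ n, ContDiff ℝ ∞ (τ n) := fun n => (contDiff_cutoff _ _).comp (by fun_prop)
    have hτ0 : ∀ n, ∀ s, 0 ≤ τ n s := fun n s => cutoff_nonneg _ _ _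
    have hτ1 : ∀ n, ∀ s, τ n s ≤ 1 := fun n s => cutoff_le_one _ _ _
    have hlim : Tendsto (fun n => ∫ s in Ioo α β, τ n s * g s) atTop (𝓝 (∫ s in Ioo α β, g s)) := by
      refine tendsto_integral_of_dominated_convergence g
        (fun n => ((hτs n).continuous.mul hgc).aestronglyMeasurable) hgi (fun n => ?_) ?_
      · refine Eventually.of_forall fun s => ?_
        rw [Real.norm_eq_abs, abs_of_nonneg (mul_nonneg (hτ0 n s) (sq_nonneg _))]
        exact mul_le_of_le_one_left (sq_nonneg _) (hτ1 n s)
      · filter_upwards [ae_restrict_mem (μ := volume) measurableSet_Ioo] with s hs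
        refine tendsto_const_nhds.congr' ?_
        filter_upwards [eventually_cutoff_eq (ℓ := β - α) (r := s - α)
          ⟨by linarith [hs.1], by linarith [hs.2]⟩] with n hn
        rw [hτ]
        simp only
        rw [hn.1, one_mul]
    refine le_of_tendsto hlim ?_
    filter_upwards [eventually_gt_atTop 0] with n hn
    have hn' : (0 : ℝ) < (n : ℝ)⁻¹ := by positivity
    have hsupp : Function.support (τ n) ⊆ Icc (α + (n : ℝ)⁻¹) (β - (n : ℝ)⁻¹) := fun s hs => by
      by_contra h
      refine hs (cutoff_eq_zero hn fun h' => h ⟨by linarith [h'.1], by linarith [h'.2]⟩)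
    have ht : tsupport (τ n) ⊆ Ioo α β := (closure_minimal hsupp isClosed_Icc).trans fun s hs =>
      ⟨by linarith [hs.1], by linarith [hs.2]⟩
    refine le_trans (setIntegral_mono_set ?_ (Eventually.of_forall fun s =>
      mul_nonneg (hτ0 n s) (sq_nonneg _)) (Ioo_subset_Ioo hα hβ).eventuallyLE) (hM α β f hf (φ k) (hφ k)
        (τ n) (hτs n) (fun s => ⟨hτ0 n s, hτ1 n s⟩)
        (HasCompactSupport.of_support_subset_isCompact isCompact_Icc hsupp) ht)
    exact (((hτs n).continuous.mul hgc).continuousOn.integrableOn_compact isCompact_Icc).mono_set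
      Ioo_subset_Icc_self
  refine squeeze_zero (fun k => integral_nonneg fun s => sq_nonneg _) key ?_
  have h1 := (hlim.norm.const_mul M).mul (tendsto_iff_norm_sub_tendsto_zero.1 hlim)
  simpa using h1

end Trace

/-! ### Functions that vanish on a part of the boundary -/

section BoundaryPart

variable {L : Fin 2 → ℝ}

lemma isometry_sidePoint (i : Fin 2) (b : ℝ) : Isometry (sidePoint i b) := by
  obtain ⟨j, hij⟩ := exists_ne_fin_two i
  refine Isometry.of_dist_eq fun s t => ?_
  rw [EuclideanSpace.dist_eq, sum_fin_two_of_ne hij]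
  simp only [sidePoint_self, sidePoint_ne hij, dist_self]
  rw [zero_pow two_ne_zero, zero_add, Real.sqrt_sq dist_nonneg]

/-- The parametrization of a side is an isometry, so it carries one-dimensional Hausdorff measure to
Lebesgue measure. -/
lemma setLIntegral_image_sidePoint (i : Fin 2) (b : ℝ) (A : Set ℝ) (F : Pt → ℝ≥0∞) :
    ∫⁻ x in sidePoint i b '' A, F x ∂(Measure.hausdorffMeasure 1) = ∫⁻ s in A, F (sidePoint i b s) := by
  have hι := isometry_sidePoint i b
  have he : MeasurableEmbedding (sidePoint i b) := hι.isClosedEmbedding.measurableEmbedding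
  have h1 : (Measure.hausdorffMeasure 1 : Measure Pt).restrict (sidePoint i b '' A) =
      (volume.restrict A).map (sidePoint i b) := by
    rw [← hausdorffMeasure_real, ← inter_eq_left.2 (image_subset_range (sidePoint i b) A),
      ← Measure.restrict_restrict_of_subset (inter_subset_right),
      ← hι.map_hausdorffMeasure (.inl zero_le_one), he.restrict_map,
      inter_eq_left.2 (image_subset_range (sidePoint i b) A), preimage_image_eq _ hι.injective]
  rw [h1, he.lintegral_map]

lemma mem_openSegment_of_mem_Ioo {i j : Fin 2} (hij : i ≠ j) {p q : Pt} (hi : p i = q i) {x : Pt}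
    (hx : x i = p i) (hpq : p j < q j) (hxj : x j ∈ Ioo (p j) (q j)) : x ∈ openSegment ℝ p q := by
  rw [openSegment_eq_image]
  have h0 : 0 < q j - p j := sub_pos.2 hpq
  refine ⟨(x j - p j) / (q j - p j), ⟨div_pos (sub_pos.2 hxj.1) h0, ?_⟩, ?_⟩
  · rw [div_lt_one h0]
    linarith [hxj.2]
  · ext k
    rcases eq_or_eq_fin_two hij k with rfl | rfl
    · simp only [PiLp.add_apply, PiLp.smul_apply, smul_eq_mul]
      rw [← hi, hx]; ring
    · simp only [PiLp.add_apply, PiLp.smul_apply, smul_eq_mul]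
      field_simp
      ring

lemma frontier_rect_subset (L : Fin 2 → ℝ) : frontier (rect L) ⊆ closedRect L \ rect L := by
  rw [(isOpen_rect L).frontier_eq]
  exact sdiff_subset_sdiff_left (closure_minimal (UnitMesh.rect_subset_closedRect L)
    (UnitMesh.closedRect_compact L).isClosed)

/-- A line segment on the boundary of a rectangle lies on one of the sides. -/
lemma exists_side {p q : Pt} (hpq : p ≠ q) (hsub : openSegment ℝ p q ⊆ frontier (rect L)) :
    ∃ i j : Fin 2, i ≠ j ∧ ∃ b α β : ℝ, (b = 0 ∨ b = L i) ∧ 0 ≤ α ∧ β ≤ L j ∧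
      (∀ x : Pt, x i = b → x j ∈ Ioo α β → x ∈ openSegment ℝ p q) ∧
      segment ℝ p q ⊆ sidePoint i b '' Icc α β := by
  have hsub' := hsub.trans (frontier_rect_subset L)
  have hseg : segment ℝ p q ⊆ closedRect L := by
    rw [← closure_openSegment]
    exact closure_minimal (hsub'.trans sdiff_subset) (UnitMesh.closedRect_compact L).isClosed
  have hp : p ∈ closedRect L := hseg (left_mem_segment ℝ p q)
  have hq : q ∈ closedRect L := hseg (right_mem_segment ℝ p q)
  -- The midpoint lies on some side, say in the coordinate `i`. As both endpoints are in the closed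
  -- rectangle, equality in this average forces both onto the same side.
  have hz : (1 / 2 : ℝ) • p + (1 / 2 : ℝ) • q ∈ openSegment ℝ p q :=
    ⟨1 / 2, 1 / 2, by norm_num, by norm_num, by norm_num, rfl⟩
  have hz' := (hsub' hz).2
  simp only [rect, Set.mem_ofPred_eq, not_forall] at hz'
  obtain ⟨i, hi⟩ := hz'
  simp only [PiLp.add_apply, PiLp.smul_apply, smul_eq_mul, mem_Ioo, not_and_or, not_lt] at hi
  have hb : (p i = 0 ∨ p i = L i) ∧ p i = q i := by
    have h1 := hp i
    have h2 := hq i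
    rcases hi with hi | hi
    · have h3 : p i = 0 := by linarith [h1.1, h2.1]
      have h4 : q i = 0 := by linarith [h1.1, h2.1]
      exact ⟨.inl h3, h3.trans h4.symm⟩
    · have h3 : p i = L i := by linarith [h1.2, h2.2]
      have h4 : q i = L i := by linarith [h1.2, h2.2]
      exact ⟨.inr h3, h3.trans h4.symm⟩
  obtain ⟨j, hij⟩ := exists_ne_fin_two i
  have hj : p j ≠ q j := fun h => hpq (by
    ext k
    rcases eq_or_eq_fin_two hij k with rfl | rfl
    · exact hb.2
    · exact h)
  refine ⟨i, j, hij, p i, min (p j) (q j), max (p j) (q j), hb.1, le_min (hp j).1 (hq j).1,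
    max_le (hp j).2 (hq j).2, fun x hx hxj => ?_, fun x hx => ⟨x j, ?_, ?_⟩⟩
  · rcases lt_or_gt_of_ne hj with h | h
    · rw [min_eq_left h.le, max_eq_right h.le] at hxj
      exact mem_openSegment_of_mem_Ioo hij hb.2 hx h hxj
    · rw [min_eq_right h.le, max_eq_left h.le] at hxj
      rw [openSegment_symm]
      exact mem_openSegment_of_mem_Ioo hij hb.2.symm (hx.trans hb.2) h hxj
  · obtain ⟨c, d, hc, hd, hcd, rfl⟩ := hx
    simp only [PiLp.add_apply, PiLp.smul_apply, smul_eq_mul]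
    constructor
    · calc min (p j) (q j) = c * min (p j) (q j) + d * min (p j) (q j) := by
            rw [← add_mul, hcd, one_mul]
        _ ≤ _ := add_le_add (mul_le_mul_of_nonneg_left (min_le_left _ _) hc)
            (mul_le_mul_of_nonneg_left (min_le_right _ _) hd)
    · calc c * p j + d * q j ≤ c * max (p j) (q j) + d * max (p j) (q j) :=
            add_le_add (mul_le_mul_of_nonneg_left (le_max_left _ _) hc)
              (mul_le_mul_of_nonneg_left (le_max_right _ _) hd)
        _ = _ := by rw [← add_mul, hcd, one_mul]
  · obtain ⟨c, d, hc, hd, hcd, rfl⟩ := hx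
    conv_rhs => rw [eq_sidePoint hij (c • p + d • q)]
    congr 1
    simp only [PiLp.add_apply, PiLp.smul_apply, smul_eq_mul]
    rw [← hb.2, ← add_mul, hcd, one_mul]

lemma tendsto_eLpNorm_sub_of_contL2 {φ : ℕ → Pt → ℝ} (hφ : ∀ k, Continuous (φ k)) {f : L2Rect L ℝ}
    (h : Tendsto (fun k => contL2 L (φ k) (hφ k)) atTop (𝓝 f)) :
    Tendsto (fun k => eLpNorm (fun x => φ k x - f x) 2 (rectMeasure L)) atTop (𝓝 0) := by
  refine ((Lp.tendsto_Lp_iff_tendsto_eLpNorm' _ _).1 h).congr fun k => eLpNorm_congr_ae ?_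
  filter_upwards [coeFn_contL2 (L := L) (hφ k)] with x hx
  rw [Pi.sub_apply, hx]

/-- Functions in `H¹(Ω)` which satisfy Green's formula without boundary integral near a part of the
boundary have the trace zero there. -/
lemma hasTrace_zero (hL : ∀ i, 0 < L i) {ΓD : Set Pt} (hΓD : IsBoundaryPart L ΓD) {u : H1Rect L}
    (hu : ∀ i j : Fin 2, i ≠ j → ∀ b α β : ℝ, (b = 0 ∨ b = L i) →
      (∀ x : Pt, x i = b → x j ∈ Ioo α β → x ∈ ΓD) →
      ∀ η (hη : IsBoundaryTest L i j b α β η), inner ℝ u.1 (testPair L i η hη.contDiff) = 0) :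
    HasTrace ΓD u 0 := by
  obtain ⟨hfr, n, p, q, hpq, hsub, hsub'⟩ := hΓD
  obtain ⟨φ, hφ, hlim⟩ := exists_tendsto_smoothPair hL u.2
  refine ⟨φ, hφ, ?_, fun i => ?_, ?_⟩
  · exact tendsto_eLpNorm_sub_of_contL2 (fun k => (hφ k).continuous)
      (((WithLp.fstL 2 ℝ (L2Rect L ℝ) (PiLp 2 (fun _ : Fin 2 => L2Rect L ℝ))).continuous.tendsto _).comp
        hlim)
  · exact tendsto_eLpNorm_sub_of_contL2 (fun k => continuous_partialDeriv (hφ k) i)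
      ((((PiLp.proj 2 (𝕜 := ℝ) (fun _ : Fin 2 => L2Rect L ℝ) i).comp
        (WithLp.sndL 2 ℝ (L2Rect L ℝ) (PiLp 2 (fun _ : Fin 2 => L2Rect L ℝ)))).continuous.tendsto
          _).comp hlim)
  -- One approximating sequence serves all segments; the endpoints of the intervals are null sets.
  have hseg : ∀ c, Tendsto (fun k => ∫⁻ x in segment ℝ (p c) (q c), ‖φ k x‖ₑ ^ (2 : ℝ)
      ∂(Measure.hausdorffMeasure 1)) atTop (𝓝 0) := fun c => by
    have hc : openSegment ℝ (p c) (q c) ⊆ ΓD := (subset_iUnion _ c).trans hsub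
    obtain ⟨i, j, hij, b, α, β, hb, hα, hβ, h1, h2⟩ := exists_side (hpq c) (hc.trans hfr)
    have h3 := tendsto_trace_zero hL hij hb hα hβ
      (hu i j hij b α β hb fun x hx hxj => hc (h1 x hx hxj)) hφ hlim
    have h4 := ENNReal.tendsto_ofReal h3
    rw [ENNReal.ofReal_zero] at h4
    refine tendsto_of_tendsto_of_tendsto_of_le_of_le tendsto_const_nhds h4 (fun _ => zero_le)
      fun k => ?_
    refine (lintegral_mono_set h2).trans ?_
    rw [setLIntegral_image_sidePoint, setLIntegral_congr Ioo_ae_eq_Icc.symm]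
    have hgc : Continuous fun s => φ k (sidePoint i b s) ^ 2 :=
      ((hφ k).continuous.comp (isometry_sidePoint i b).continuous).pow 2
    rw [ofReal_integral_eq_lintegral_ofReal ((hgc.continuousOn.integrableOn_compact
      isCompact_Icc).mono_set Ioo_subset_Icc_self) (Eventually.of_forall fun s => sq_nonneg _)]
    refine le_of_eq (lintegral_congr fun s => ?_)
    rw [← sq_abs, ENNReal.ofReal_pow (abs_nonneg _), Real.enorm_eq_ofReal_abs]
    norm_cast
  have hsum : Tendsto (fun k => ∫⁻ x in ΓD, ‖φ k x‖ₑ ^ (2 : ℝ) ∂(Measure.hausdorffMeasure 1)) atTop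
      (𝓝 0) := by
    have h1 := tendsto_finsetSum Finset.univ fun c (_ : c ∈ Finset.univ) => hseg c
    simp only [Finset.sum_const_zero] at h1
    refine tendsto_of_tendsto_of_tendsto_of_le_of_le tendsto_const_nhds h1 (fun _ => zero_le)
      fun k => ?_
    refine (lintegral_mono_set hsub').trans ((lintegral_iUnion_le _ _).trans ?_)
    rw [tsum_fintype]
  have hpow := (ENNReal.continuous_rpow_const (y := 1 / 2)).tendsto 0 |>.comp hsum
  rw [ENNReal.zero_rpow_of_pos (by norm_num)] at hpow
  refine hpow.congr fun k => ?_
  rw [eLpNorm_eq_lintegral_rpow_enorm_toReal two_ne_zero ENNReal.ofNat_ne_top]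
  simp

end BoundaryPart

/-! ### Boundary values of the limit -/

namespace UnitMesh

variable {E : Type*} {Y : UnitMesh E}

lemma mem_Icc_of_mem_vertices {q : Pt} (hq : q ∈ Y.vertices) (i : Fin 2) : q i ∈ Icc (0 : ℝ) 1 := by
  obtain ⟨e, rfl | rfl⟩ := hq
  · exact Y.mem_cell e 0 ⟨le_rfl, (Y.len_pos e).le⟩ i
  · exact Y.mem_cell e _ ⟨(Y.len_pos e).le, le_rfl⟩ i

variable [Fintype E] {L : Fin 2 → ℝ} {T : ℝ} {ΓD : Set Pt}

/-- Functions that vanish on a part of the boundary do so in the vertices there. -/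
lemma vertexValue_eq_zero {δ : ℝ} (hδ : 0 < δ) {N : Fin 2 → ℕ} {f : (Y.mesh δ N).H1}
    (hf : f ∈ Y.dirichletMesh δ N ΓD) {a : Pt → ℝ}
    (ha : (Y.mesh δ N).HasDerivWithVertexValues f.1.fst f.1.snd a) {q : Pt} (hq : q ∈ Y.vertices)
    {n : ∀ i, Fin (N i)} (hn : cellPoint δ n q ∈ ΓD) : a (cellPoint δ n q) = 0 := by
  have hlen : ∀ p, 0 < (Y.mesh δ N).len p := fun p => mul_pos hδ (Y.len_pos p.2)
  obtain ⟨e, rfl | rfl⟩ := hq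
  · have hs : (0 : ℝ) ∈ Icc 0 ((Y.mesh δ N).len (n, e)) := ⟨le_rfl, (hlen _).le⟩
    have h1 := hf (n, e) 0 hs (by rw [meshParam, zero_div]; exact hn)
    rw [MetricGraph.eval_eq hlen f hs, MetricGraph.evalL_eq_of_hasDeriv hlen f ha,
      MetricGraph.primitive_eq _ hs.2 le_rfl, intervalIntegral.integral_same, add_zero] at h1
    exact h1
  · have hs : (Y.mesh δ N).len (n, e) ∈ Icc 0 ((Y.mesh δ N).len (n, e)) := ⟨(hlen _).le, le_rfl⟩
    have hd : (Y.mesh δ N).len (n, e) / δ = Y.len e := mul_div_cancel_left₀ _ hδ.ne'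
    have h1 := hf (n, e) _ hs (by rw [meshParam, hd]; exact hn)
    rw [MetricGraph.eval_eq hlen f hs, MetricGraph.evalL_eq_of_hasDeriv hlen f ha,
      MetricGraph.primitive_eq _ le_rfl hs.1, ← (ha (n, e)).2 hs.1] at h1
    exact h1

/-- Point evaluation is a continuous functional on `H¹` of the mesh, so it commutes with the time
integral. -/
lemma setIntegral_mem_dirichletMesh {δ : ℝ} (hδ : 0 < δ) {N : Fin 2 → ℕ}
    {v : ℝ → (Y.mesh δ N).H1} (hv : MemLp v 2 (timeMeasure T))
    (h : ∀ᵐ t ∂(timeMeasure T), v t ∈ Y.dirichletMesh δ N ΓD) (S : Set ℝ) :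
    ∫ t in S, v t ∂(timeMeasure T) ∈ Y.dirichletMesh δ N ΓD := by
  have := completeSpace_mesh_H1 (Y := Y) hδ N
  have hlen : ∀ p, 0 < (Y.mesh δ N).len p := fun p => mul_pos hδ (Y.len_pos p.2)
  intro p s hs hps
  rw [MetricGraph.eval_eq hlen _ hs, ← ContinuousLinearMap.integral_comp_comm _
    (integrable_time hv).restrict]
  refine integral_eq_zero_of_ae (ae_restrict_of_ae ?_)
  filter_upwards [h] with t ht
  rw [← MetricGraph.eval_eq hlen _ hs, ht p s hs hps, Pi.zero_apply]

/-- Compactness of the support turns the strict conditions of a boundary test into a uniform margin.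
-/
lemma exists_boundary_margin {i j : Fin 2} {b α β : ℝ} {η : Pt → ℝ}
    (hη : IsBoundaryTest L i j b α β η) : ∃ ε > 0, ∀ x, η x ≠ 0 →
      ε ≤ |x i - (L i - b)| ∧ α + ε ≤ x j ∧ x j ≤ β - ε := by
  have hc : Continuous fun x : Pt => min |x i - (L i - b)| (min (x j - α) (β - x j)) := by fun_prop
  obtain ⟨ε, hε, h⟩ := hη.hasCompactSupport.isCompact.exists_forall_le' hc.continuousOn
    (a := 0) fun x hx => lt_min (abs_pos.2 (sub_ne_zero.2 (hη.ne_of_mem_tsupport x hx)))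
      (lt_min (sub_pos.2 (hη.mem_of_mem_tsupport x hx).1) (sub_pos.2 (hη.mem_of_mem_tsupport x hx).2))
  refine ⟨ε, hε, fun x hx => ?_⟩
  have h1 := h x (subset_closure hx)
  simp only [le_min_iff] at h1
  exact ⟨h1.1, by linarith [h1.2.1], by linarith [h1.2.2]⟩

lemma ae_coord_ne (i : Fin 2) (r : ℝ) : ∀ᵐ x : Pt, x i ≠ r := by
  obtain ⟨j, hij⟩ := exists_ne_fin_two i
  obtain ⟨e, he, hex⟩ := exists_coord_equiv hij
  have h1 : ∀ᵐ p : ℝ × ℝ, p.2 ≠ r := by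
    rw [Measure.volume_eq_prod]
    exact Measure.quasiMeasurePreserving_snd.ae (Measure.ae_ne volume r)
  filter_upwards [he.quasiMeasurePreserving.ae h1] with x hx
  rw [hex] at hx
  exact hx

/-- Points whose shift leaves the rectangle lie in the layer of width `δ` at a side. At the side
opposite to `xᵢ = b` the margin `ε > δ` kills the test function. At `xᵢ = b` the nearby vertex lies
exactly on the side, and by the margin its other coordinate is in `(α, β)`, so it belongs to `ΓD`
and the nodal value is zero. -/
lemma shift_conditions_of_isBoundaryTest {δ : ℝ} {N : Fin 2 → ℕ} (hδ : 0 < δ)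
    (hN : ∀ i, (N i : ℝ) * δ = L i) {i j : Fin 2} (hij : i ≠ j) {b α β ε : ℝ}
    (hb : b = 0 ∨ b = L i) (hsub : ∀ x : Pt, x i = b → x j ∈ Ioo α β → x ∈ ΓD) {q : Pt}
    (hq : q ∈ Y.vertices) (hq' : q + latticeVec (Pi.single i 1) ∈ Y.vertices) {η : Pt → ℝ}
    (hη : ∀ x, η x ≠ 0 → ε ≤ |x i - (L i - b)| ∧ α + ε ≤ x j ∧ x j ≤ β - ε) (hε : δ < ε)
    {f : (Y.mesh δ N).H1} (hf : f ∈ Y.dirichletMesh δ N ΓD) {a : Pt → ℝ}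
    (ha : (Y.mesh δ N).HasDerivWithVertexValues f.1.fst f.1.snd a) :
    (∀ᵐ x : Pt, x ∈ rect L → x - δ • latticeVec (Pi.single i 1) ∉ rect L →
      a (nearPoint δ q x) = 0 ∨ η (x - δ • latticeVec (Pi.single i 1)) = 0) ∧
    (∀ x ∈ rect L, x + δ • latticeVec (Pi.single i 1) ∉ rect L →
      a (nearPoint δ (q + latticeVec (Pi.single i 1)) x) = 0 ∨ η x = 0) := by
  set m := latticeVec (Pi.single i 1) with hm
  have hmi : m i = 1 := by simp [hm, latticeVec_apply]
  have hmj : m j = 0 := by simp [hm, latticeVec_apply, hij.symm]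
  -- Both `q` and `q + eᵢ` lie in the unit square, which leaves no room in the `i`-th coordinate.
  have hqi : q i = 0 := by
    have h1 := mem_Icc_of_mem_vertices hq i
    have h2 := mem_Icc_of_mem_vertices hq' i
    rw [PiLp.add_apply, hmi] at h2
    linarith [h1.1, h2.2]
  have hqj := mem_Icc_of_mem_vertices hq j
  constructor
  -- The line `xᵢ = δ` must be excluded: there the shifted point is on the boundary, although `x`
  -- already belongs to the second layer of cells.
  · filter_upwards [ae_coord_ne i δ] with x hxδ hx hx'
    have hxi : x i < δ := by
      by_contra! h
      refine hx' fun k => ?_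
      rcases eq_or_eq_fin_two hij k with rfl | rfl
      · simp only [PiLp.sub_apply, PiLp.smul_apply, hmi, smul_eq_mul, mul_one]
        exact ⟨sub_pos.2 (lt_of_le_of_ne h hxδ.symm), by linarith [(hx k).2]⟩
      · simpa only [PiLp.sub_apply, PiLp.smul_apply, hmj, smul_zero, sub_zero] using hx _
    by_cases h0 : η (x - δ • m) = 0
    · exact .inr h0
    have h1 := hη _ h0
    simp only [PiLp.sub_apply, PiLp.smul_apply, hmi, hmj, smul_eq_mul, mul_one, mul_zero,
      sub_zero] at h1
    left
    rcases hb with rfl | rfl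
    · obtain ⟨n, hn⟩ := exists_mem_cell hδ hN hx
      rw [nearPoint_of_mem_cell hδ hn]
      refine vertexValue_eq_zero hδ hf ha hq (hsub _ ?_ ?_)
      · have h2 : (n i : ℕ) = 0 := by
          have h3 : δ * ((n i : ℕ) : ℝ) < δ * 1 := by linarith [(hn i).1]
          have h4 : ((n i : ℕ) : ℝ) < 1 := lt_of_mul_lt_mul_left h3 hδ.le
          exact Nat.lt_one_iff.1 (by exact_mod_cast h4)
        rw [cellPoint_apply, hqi, h2]
        simp
      · rw [cellPoint_apply]
        have h2 := hn j
        constructor <;> nlinarith [h2.1, h2.2, hqj.1, hqj.2, h1.2.1, h1.2.2]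
    · rw [sub_self, sub_zero, abs_of_neg (by linarith)] at h1
      linarith [(hx i).1, h1.1]
  · intro x hx hx'
    have hxi : L i ≤ x i + δ := by
      by_contra! h
      refine hx' fun k => ?_
      rcases eq_or_eq_fin_two hij k with rfl | rfl
      · simp only [PiLp.add_apply, PiLp.smul_apply, hmi, smul_eq_mul, mul_one]
        exact ⟨by linarith [(hx k).1], h⟩
      · simpa only [PiLp.add_apply, PiLp.smul_apply, hmj, smul_zero, add_zero] using hx _
    by_cases h0 : η x = 0
    · exact .inr h0
    have h1 := hη _ h0
    left
    rcases hb with rfl | rfl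
    · rw [sub_zero, abs_of_neg (by linarith [(hx i).2])] at h1
      linarith [h1.1]
    · obtain ⟨n, hn⟩ := exists_mem_cell hδ hN hx
      rw [nearPoint_of_mem_cell hδ hn]
      refine vertexValue_eq_zero hδ hf ha hq' (hsub _ ?_ ?_)
      · have h2 : (n i : ℕ) + 1 = N i := by
          have h3 : δ * (N i : ℝ) < δ * (((n i : ℕ) : ℝ) + 2) := by
            linarith [(hn i).2, hN i]
          have h4 : (N i : ℝ) < ((n i : ℕ) : ℝ) + 2 := lt_of_mul_lt_mul_left h3 hδ.le
          have h5 : N i < (n i : ℕ) + 2 := by exact_mod_cast h4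
          have := (n i).2
          omega
        have h3 : ((n i : ℕ) : ℝ) + 1 = N i := by exact_mod_cast h2
        rw [cellPoint_apply, PiLp.add_apply, hqi, hmi, ← hN i, ← h3]
        ring
      · rw [cellPoint_apply, PiLp.add_apply, hmj]
        have h2 := hn j
        constructor <;> nlinarith [h2.1, h2.2, hqj.1, hqj.2, h1.2.1, h1.2.2]

/-- The limit vanishes where the sequence does. -/
lemma IsUnfoldedLimit.mem_dirichletRect {δ : ℕ → ℝ} {N : ℕ → Fin 2 → ℕ} {hδ : ∀ k, 0 < δ k}
    {hN : ∀ k i, (N k i : ℝ) * δ k = L i} {v : ∀ k, ℝ → (Y.mesh (δ k) (N k)).H1}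
    {U G : ℕ → Lp (L2Rect L Y.periodic.L2) 2 (timeMeasure T)}
    {Z Zg : Lp (L2Rect L Y.periodic.L2) 2 (timeMeasure T)} {C : ℝ}
    (h : IsUnfoldedLimit Y L T hδ hN v U G Z Zg C) (hconn : Y.graph.Connected)
    (hopp : Y.TouchesOpposite) (e₀ : E) (hL : ∀ i, 0 < L i) (hΓD : IsBoundaryPart L ΓD)
    (hv : ∀ k, ∀ᵐ t ∂(timeMeasure T), v k t ∈ Y.dirichletMesh (δ k) (N k) ΓD)
    {v0 : ℝ → H1Rect L} (hv0 : ∀ᵐ t ∂(timeMeasure T), H1Rect.toL2 (v0 t) = lift L Y.mean (Z t))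
    (hgrad : ∀ q m, q ∈ Y.vertices → q + latticeVec m ∈ Y.vertices → ∀ᵐ t ∂(timeMeasure T),
      lift L (Y.pathFunctional e₀ (q + latticeVec m) - Y.pathFunctional e₀ q) (Zg t) =
        ∑ i, (m i : ℝ) • H1Rect.grad (v0 t) i) :
    ∀ᵐ t ∂(timeMeasure T), v0 t ∈ DirichletRect L ΓD := by
  -- Sides, intervals and test functions form one index family, so that a single null set of times
  -- serves all of them.
  have key := ae_forall_testPair (T := T) (f := fun t => (v0 t).1)
    (ι := (Fin 2 × Fin 2) × (ℝ × ℝ × ℝ) × (Pt → ℝ))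
    (S := fun p => p.1.1 ≠ p.1.2 ∧ (p.2.1.1 = 0 ∨ p.2.1.1 = L p.1.1) ∧
      (∀ x : Pt, x p.1.1 = p.2.1.1 → x p.1.2 ∈ Ioo p.2.1.2.1 p.2.1.2.2 → x ∈ ΓD) ∧
      IsBoundaryTest L p.1.1 p.1.2 p.2.1.1 p.2.1.2.1 p.2.1.2.2 p.2.2)
    (fun p => p.1.1) (fun p => p.2.2) (fun p hp => hp.2.2.2.contDiff) ?_
  · filter_upwards [key] with t ht
    exact hasTrace_zero hL hΓD fun i j hij b α β hb hsub η hη =>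
      ht ((i, j), (b, α, β), η) ⟨hij, hb, hsub, hη⟩
  rintro ⟨⟨i, j⟩, ⟨b, α, β⟩, η⟩ ⟨hij, hb, hsub, hη⟩
  simp only at hij hb hsub hη
  obtain ⟨q, hq, hq'⟩ := hopp.exists_vertex i
  obtain ⟨ε, hε, hmargin⟩ := exists_boundary_margin hη
  have hd : Continuous fun x => fderiv ℝ η x (latticeVec (Pi.single i 1)) :=
    (hη.contDiff.continuous_fderiv (by simp)).clm_apply continuous_const
  -- The derivative identity again, now with test functions that reach `ΓD`; admissible averages are
  -- those that vanish there. Since the path functional is already known to be `∂ᵢ v0`, the identity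
  -- is Green's formula without boundary integral.
  have h1 := shift_limit_ae hconn e₀ hδ hN h.tendsto_zero h.memLp
    (P := fun k => Y.dirichletMesh (δ k) (N k) ΓD)
    (fun k S _ => setIntegral_mem_dirichletMesh (hδ k) (h.memLp k) (hv k) S) h.unfold_eq
    h.unfold_deriv_eq h.norm_le h.norm_deriv_le h.tendsto h.tendsto_deriv
    ((lift L Y.mean).comp_memLp' (Lp.memLp Z)) (h.eq_slow hconn e₀) hq hq' hη.contDiff
    hη.hasCompactSupport hd ?_
  · filter_upwards [h1, hgrad q _ hq hq', hv0] with t h1 h2 h3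
    rw [inner_testPair]
    have h4 : ∑ k, ((Pi.single i 1 : Fin 2 → ℤ) k : ℝ) • H1Rect.grad (v0 t) k =
        H1Rect.grad (v0 t) i := by
      rw [sum_fin_two_of_ne hij]
      simp [hij.symm]
    rw [h2, h4, Function.comp_apply, ← h3] at h1
    simp only [latticeVec_single] at h1
    rw [add_comm]
    exact h1
  · filter_upwards [h.tendsto_zero.eventually_lt_const hε] with k hk f hf a ha
    exact shift_conditions_of_isBoundaryTest (hδ k) (hN k) hij hb hsub hq hq' hmargin hk hf ha

end UnitMesh

/-! ### Compactness -/

namespace UnitMesh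

variable {E : Type*} [Fintype E] {Y : UnitMesh E} {L : Fin 2 → ℝ} {T : ℝ}

lemma memLp_clm {X Z : Type*} [NormedAddCommGroup X] [NormedSpace ℝ X] [NormedAddCommGroup Z]
    [NormedSpace ℝ Z] (A : X →L[ℝ] Z) {u : ℝ → X} (hu : MemLp u 2 (timeMeasure T)) :
    MemLp (fun t => A (u t)) 2 (timeMeasure T) := A.comp_memLp' hu

lemma TouchesOpposite.nonempty {E : Type*} {Y : UnitMesh E} (h : Y.TouchesOpposite) : Nonempty E := by
  obtain ⟨y, hy, _⟩ := h 0
  exact (mem_iUnion.1 hy).nonempty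

lemma memLp_toL2 {V : Type*} {G : MetricGraph E V} {v : ℝ → G.H1} (hv : MemLp v 2 (timeMeasure T)) :
    MemLp (fun t => MetricGraph.H1.toL2 (v t)) 2 (timeMeasure T) :=
  memLp_clm (X := G.H1) (Z := G.L2) MetricGraph.H1.toL2 hv

lemma memLp_deriv {V : Type*} {G : MetricGraph E V} {v : ℝ → G.H1} (hv : MemLp v 2 (timeMeasure T)) :
    MemLp (fun t => MetricGraph.H1.deriv (v t)) 2 (timeMeasure T) :=
  memLp_clm (X := G.H1) (Z := G.L2) MetricGraph.H1.deriv hv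

lemma exists_toLp_clm {X Z : Type*} [NormedAddCommGroup X] [NormedSpace ℝ X] [NormedAddCommGroup Z]
    [NormedSpace ℝ Z] (A : X →L[ℝ] Z) {c : ℝ} (hA : ∀ x, ‖A x‖ ≤ c * ‖x‖) {u : ℝ → X}
    (hu : MemLp u 2 (timeMeasure T)) {C : ℝ≥0}
    (hC : ENNReal.ofReal c * eLpNorm u 2 (timeMeasure T) ≤ C) :
    ∃ U : Lp Z 2 (timeMeasure T), (∀ᵐ t ∂(timeMeasure T), U t = A (u t)) ∧ ‖U‖ ≤ C := by
  have hm : MemLp (fun t => A (u t)) 2 (timeMeasure T) := memLp_clm A hu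
  refine ⟨hm.toLp, hm.coeFn_toLp, ?_⟩
  rw [Lp.norm_toLp]
  refine ENNReal.toReal_le_coe_of_le_coe ((eLpNorm_le_mul_eLpNorm_of_ae_le_mul ?_ 2).trans hC)
  exact Eventually.of_forall fun t => hA (u t)

lemma exists_common_subseq {C : ℝ}
    {U G W : ℕ → Lp (L2Rect L Y.periodic.L2) 2 (timeMeasure T)} (hU : ∀ k, ‖U k‖ ≤ C)
    (hG : ∀ k, ‖G k‖ ≤ C) (hW : ∀ k, ‖W k‖ ≤ C) :
    ∃ Z Zg Zw, ∃ σ : ℕ → ℕ, StrictMono σ ∧ WeakTendsto (fun k => U (σ k)) Z ∧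
      WeakTendsto (fun k => G (σ k)) Zg ∧ WeakTendsto (fun k => W (σ k)) Zw := by
  obtain ⟨Z, σ₁, hσ₁, h1⟩ := WeakTendsto.exists_subseq hU
  obtain ⟨Zg, σ₂, hσ₂, h2⟩ := WeakTendsto.exists_subseq (x := fun k => G (σ₁ k)) fun k => hG _
  obtain ⟨Zw, σ₃, hσ₃, h3⟩ := WeakTendsto.exists_subseq (x := fun k => W (σ₁ (σ₂ k))) fun k => hW _
  exact ⟨Z, Zg, Zw, fun k => σ₁ (σ₂ (σ₃ k)), hσ₁.comp (hσ₂.comp hσ₃),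
    (h1.comp hσ₂).comp hσ₃, h2.comp hσ₃, h3⟩

lemma HasWeakTimeDeriv.unfold {δ : ℝ} (hδ : 0 < δ) {N : Fin 2 → ℕ}
    (hN : ∀ i, (N i : ℝ) * δ = L i) {u w : ℝ → (Y.mesh δ N).L2} (h : HasWeakTimeDeriv T u w)
    (hu : MemLp u 2 (timeMeasure T)) (hw : MemLp w 2 (timeMeasure T))
    {U W : Lp (L2Rect L Y.periodic.L2) 2 (timeMeasure T)}
    (hU : ∀ᵐ t ∂(timeMeasure T), U t = UnitMesh.unfold hδ hN (u t))
    (hW : ∀ᵐ t ∂(timeMeasure T), W t = UnitMesh.unfold hδ hN (w t)) : HasWeakTimeDeriv T U W :=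
  (h.clm hu hw (UnitMesh.unfold hδ hN)).congr (hU.mono fun _ h => h.symm) (hW.mono fun _ h => h.symm)

/-- The limit of the initial values is the initial value of the limit. -/
lemma initialValue_limit (e₀ : E) (hT : 0 < T) {δ : ℕ → ℝ} {N : ℕ → Fin 2 → ℕ}
    (hδ : ∀ k, 0 < δ k) (hN : ∀ k i, (N k i : ℝ) * δ k = L i) (hδ0 : Tendsto δ atTop (𝓝 0))
    {u : ∀ k, ℝ → (Y.mesh (δ k) (N k)).L2} {U W : ℕ → Lp (L2Rect L Y.periodic.L2) 2 (timeMeasure T)}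
    {Z Zw : Lp (L2Rect L Y.periodic.L2) 2 (timeMeasure T)}
    (hUu : ∀ k, ∀ᵐ t ∂(timeMeasure T), U k t = unfold (hδ k) (hN k) (u k t))
    (hUW : ∀ k, HasWeakTimeDeriv T (U k) (W k)) (hU : WeakTendsto U Z) (hW : WeakTendsto W Zw) {C : ℝ}
    (hCU : ∀ k, ‖U k‖ ≤ C) (hCW : ∀ k, ‖W k‖ ≤ C)
    (hZ : ∀ᵐ t ∂(timeMeasure T), Z t = Y.slow (lift L Y.mean (Z t)))
    {a : ∀ k, (Y.mesh (δ k) (N k)).L2} {z : L2Rect L Y.periodic.L2}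
    (ha : ∀ k, IsInitialValue T (u k) (a k)) (hz : Y.MeshTwoScaleStatic L δ N a z) :
    IsInitialValue T (fun t => lift L Y.mean (Z t)) (lift L Y.mean z) ∧
      z = Y.slow (lift L Y.mean z) := by
  obtain ⟨c, hc, hac, C', hC'⟩ := WeakTendsto.initialValue hT hUW hU hW hCU hCW
    (a := fun k => unfold (hδ k) (hN k) (a k))
    fun k => ((ha k).clm (unfold (hδ k) (hN k))).congr ((hUu k).mono fun _ h => h.symm)
  -- The initial values have a weak limit after unfolding; it agrees with the given two-scale limit
  -- on test functions, which are dense.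
  obtain rfl : z = c := eq_of_inner_testL2_eq fun ψ hψ => inner_testL2_eq hδ hN hδ0 hz hC' hac hψ
  refine ⟨hc.clm (lift L Y.mean), eq_slow_of_lift_fluct ?_⟩
  -- The fluctuation of `Z` vanishes at almost every time, so its continuous representative starts
  -- at zero. Hence the limit of the initial values does not depend on `y`.
  refine IsInitialValue.unique hT (hc.clm (lift L Y.fluct)) (u := fun t => lift L Y.fluct (Z t)) ?_
  refine ⟨fun _ => 0, continuousOn_const, ?_, rfl⟩
  filter_upwards [hZ] with t ht
  rw [ht, lift_fluct_slow e₀]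

set_option maxHeartbeats 1600000 in
/-- The assertions about the limit, for a sequence whose unfolded functions converge weakly. -/
lemma IsUnfoldedLimit.exists_limits {δ : ℕ → ℝ} {N : ℕ → Fin 2 → ℕ} {hδ : ∀ k, 0 < δ k}
    {hN : ∀ k i, (N k i : ℝ) * δ k = L i} {v : ∀ k, ℝ → (Y.mesh (δ k) (N k)).H1}
    {U G : ℕ → Lp (L2Rect L Y.periodic.L2) 2 (timeMeasure T)}
    {Z Zg : Lp (L2Rect L Y.periodic.L2) 2 (timeMeasure T)} {C : ℝ}
    (h : IsUnfoldedLimit Y L T hδ hN v U G Z Zg C) (hconn : Y.graph.Connected)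
    (hopp : Y.TouchesOpposite) (e₀ : E) (hL : ∀ i, 0 < L i) (hT : 0 < T) {ΓD : Set Pt}
    (hΓD : IsBoundaryPart L ΓD) {w : ∀ k, ℝ → (Y.mesh (δ k) (N k)).L2}
    (hw : ∀ k, MemLp (w k) 2 (timeMeasure T)) {W : ℕ → Lp (L2Rect L Y.periodic.L2) 2 (timeMeasure T)}
    (hW : ∀ k, ∀ᵐ t ∂(timeMeasure T), W k t = unfold (hδ k) (hN k) (w k t))
    (hCW : ∀ k, ‖W k‖ ≤ C) (hUW : ∀ k, HasWeakTimeDeriv T (U k) (W k))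
    {Zw : Lp (L2Rect L Y.periodic.L2) 2 (timeMeasure T)} (hZw : WeakTendsto W Zw) :
    ∃ (v0 : ℝ → H1Rect L) (w0 : ℝ → L2Rect L ℝ) (v1 : ℝ → L2Rect L Y.periodic.H1),
      MemLp v0 2 (timeMeasure T) ∧ MemLp w0 2 (timeMeasure T) ∧ MemLp v1 2 (timeMeasure T) ∧
      HasWeakTimeDeriv T (fun t => H1Rect.toL2 (v0 t)) w0 ∧
      Y.MeshTwoScale L T δ N (fun k t => MetricGraph.H1.toL2 (v k t))
        (fun t => Y.slow (H1Rect.toL2 (v0 t))) ∧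
      Y.MeshTwoScale L T δ N (fun k t => MetricGraph.H1.deriv (v k t))
        (fun t => Y.slowDeriv (v0 t) + Y.fastDeriv (v1 t)) ∧
      Y.MeshTwoScale L T δ N w (fun t => Y.slow (w0 t)) ∧
      ((∀ k, ∀ᵐ t ∂(timeMeasure T), v k t ∈ Y.dirichletMesh (δ k) (N k) ΓD) →
        ∀ᵐ t ∂(timeMeasure T), v0 t ∈ DirichletRect L ΓD) ∧
      (∀ (a : ∀ k, (Y.mesh (δ k) (N k)).L2) (z : L2Rect L Y.periodic.L2),
        (∀ k, IsInitialValue T (fun t => MetricGraph.H1.toL2 (v k t)) (a k)) →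
        Y.MeshTwoScaleStatic L δ N a z →
        ∃ v00 : L2Rect L ℝ, IsInitialValue T (fun t => H1Rect.toL2 (v0 t)) v00 ∧ z = Y.slow v00) := by
  have hZW : HasWeakTimeDeriv T Z Zw := HasWeakTimeDeriv.of_weakTendsto hUW h.tendsto hZw
  have hslow := h.eq_slow hconn e₀
  obtain ⟨v0, hv0, hv0Z, hgrad⟩ := h.exists_slow hconn hopp e₀
  obtain ⟨v1, hv1, hv1Z⟩ := h.exists_fast hconn e₀ hv0 hgrad
  refine ⟨v0, fun t => lift L Y.mean (Zw t), v1, hv0, memLp_lift _ (Lp.memLp Zw), hv1,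
    ?_, ?_, ?_, ?_, fun hD => ?_, fun a z ha hz => ?_⟩
  · exact (hZW.clm (Lp.memLp Z) (Lp.memLp Zw) (lift L Y.mean)).congr
      (hv0Z.mono fun _ h => h.symm) (Eventually.of_forall fun _ => rfl)
  · refine meshTwoScale_of_weakTendsto hδ hN h.tendsto_zero
      (fun k => memLp_toL2 (h.memLp k)) h.unfold_eq h.norm_le h.tendsto ?_
    filter_upwards [hv0Z, hslow] with t h1 h2
    rw [h1, ← h2]
  · exact meshTwoScale_of_weakTendsto hδ hN h.tendsto_zero
      (fun k => memLp_deriv (h.memLp k)) h.unfold_deriv_eq h.norm_deriv_le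
      h.tendsto_deriv hv1Z
  · exact meshTwoScale_of_weakTendsto hδ hN h.tendsto_zero hw hW hCW hZw
      ((eq_slow_of_hasWeakTimeDeriv e₀ hZW hslow).mono fun _ h => h.symm)
  · exact h.mem_dirichletRect hconn hopp e₀ hL hΓD hD hv0Z hgrad
  · obtain ⟨h1, h2⟩ := initialValue_limit e₀ hT hδ hN h.tendsto_zero h.unfold_eq hUW h.tendsto hZw
      h.norm_le hCW hslow ha hz
    exact ⟨_, h1.congr (hv0Z.mono fun _ h => h.symm), h2⟩

end UnitMesh

set_option maxHeartbeats 1600000 in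
theorem mainTheorem7 {E : Type*} [Fintype E] (Y : UnitMesh E)
    (hconn : Y.graph.Connected) (hopp : Y.TouchesOpposite)
    (L : Fin 2 → ℝ) (hL : ∀ i, 0 < L i) (T : ℝ) (hT : 0 < T)
    (ΓD : Set Pt) (hΓD : IsBoundaryPart L ΓD)
    (δ : ℕ → ℝ) (N : ℕ → Fin 2 → ℕ) (hδ : ∀ k, 0 < δ k)
    (hN : ∀ k i, (N k i : ℝ) * δ k = L i) (hδ0 : Tendsto δ atTop (𝓝 0))
    (v : ∀ k, ℝ → (Y.mesh (δ k) (N k)).H1) (w : ∀ k, ℝ → (Y.mesh (δ k) (N k)).L2)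
    (hv : ∀ k, MemLp (v k) 2 (timeMeasure T)) (hw : ∀ k, MemLp (w k) 2 (timeMeasure T))
    (hvw : ∀ k, HasWeakTimeDeriv T (fun t => MetricGraph.H1.toL2 (v k t)) (w k))
    (C : ℝ≥0)
    (hCv : ∀ k, ENNReal.ofReal √(δ k) * eLpNorm (fun t => MetricGraph.H1.toL2 (v k t)) 2 (timeMeasure T) ≤ C)
    (hCdv : ∀ k, ENNReal.ofReal √(δ k) * eLpNorm (fun t => MetricGraph.H1.deriv (v k t)) 2 (timeMeasure T) ≤ C)
    (hCw : ∀ k, ENNReal.ofReal √(δ k) * eLpNorm (w k) 2 (timeMeasure T) ≤ C) :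
    ∃ σ : ℕ → ℕ, StrictMono σ ∧
    ∃ (v0 : ℝ → H1Rect L) (w0 : ℝ → L2Rect L ℝ) (v1 : ℝ → L2Rect L Y.periodic.H1),
      MemLp v0 2 (timeMeasure T) ∧ MemLp w0 2 (timeMeasure T) ∧ MemLp v1 2 (timeMeasure T) ∧
      HasWeakTimeDeriv T (fun t => H1Rect.toL2 (v0 t)) w0 ∧
      Y.MeshTwoScale L T (δ ∘ σ) (N ∘ σ) (fun k t => MetricGraph.H1.toL2 (v (σ k) t))
        (fun t => Y.slow (H1Rect.toL2 (v0 t))) ∧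
      Y.MeshTwoScale L T (δ ∘ σ) (N ∘ σ) (fun k t => MetricGraph.H1.deriv (v (σ k) t))
        (fun t => Y.slowDeriv (v0 t) + Y.fastDeriv (v1 t)) ∧
      Y.MeshTwoScale L T (δ ∘ σ) (N ∘ σ) (fun k => w (σ k)) (fun t => Y.slow (w0 t)) ∧
      ((∀ k, ∀ᵐ t ∂(timeMeasure T), v k t ∈ Y.dirichletMesh (δ k) (N k) ΓD) →
        ∀ᵐ t ∂(timeMeasure T), v0 t ∈ DirichletRect L ΓD) ∧
      (∀ (a : ∀ k, (Y.mesh (δ k) (N k)).L2) (z : L2Rect L Y.periodic.L2),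
        (∀ k, IsInitialValue T (fun t => MetricGraph.H1.toL2 (v k t)) (a k)) →
        Y.MeshTwoScaleStatic L (δ ∘ σ) (N ∘ σ) (fun k => a (σ k)) z →
        ∃ v00 : L2Rect L ℝ, IsInitialValue T (fun t => H1Rect.toL2 (v0 t)) v00 ∧ z = Y.slow v00) := by
  obtain ⟨e₀⟩ := hopp.nonempty
  have hvu : ∀ k, MemLp (fun t => MetricGraph.H1.toL2 (v k t)) 2 (timeMeasure T) := fun k =>
    UnitMesh.memLp_toL2 (hv k)
  have hvg : ∀ k, MemLp (fun t => MetricGraph.H1.deriv (v k t)) 2 (timeMeasure T) := fun k =>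
    UnitMesh.memLp_deriv (hv k)
  choose U hU hCU using fun k =>
    UnitMesh.exists_toLp_clm (UnitMesh.unfold (hδ k) (hN k)) (UnitMesh.norm_unfold_le (hδ k) (hN k)) (hvu k) (hCv k)
  choose G hG hCG using fun k =>
    UnitMesh.exists_toLp_clm (UnitMesh.unfold (hδ k) (hN k)) (UnitMesh.norm_unfold_le (hδ k) (hN k)) (hvg k) (hCdv k)
  choose W hW hCW using fun k =>
    UnitMesh.exists_toLp_clm (UnitMesh.unfold (hδ k) (hN k)) (UnitMesh.norm_unfold_le (hδ k) (hN k)) (hw k) (hCw k)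
  -- The only place where a subsequence is chosen; it serves all three unfolded sequences, and the
  -- initial values need no further extraction.
  obtain ⟨Z, Zg, Zw, σ, hσ, hZ, hZg, hZw⟩ := UnitMesh.exists_common_subseq hCU hCG hCW
  have hlim : UnitMesh.IsUnfoldedLimit Y L T (δ := δ ∘ σ) (N := N ∘ σ) (fun k => hδ (σ k))
      (fun k => hN (σ k)) (fun k => v (σ k)) (fun k => U (σ k)) (fun k => G (σ k)) Z Zg C :=
    ⟨hδ0.comp hσ.tendsto_atTop, fun k => hv (σ k), fun k => hU (σ k), fun k => hG (σ k),
      fun k => hCU (σ k), fun k => hCG (σ k), hZ, hZg⟩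
  have hUW : ∀ k, HasWeakTimeDeriv T (U k) (W k) := fun k =>
    UnitMesh.HasWeakTimeDeriv.unfold (hδ k) (hN k) (hvw k) (hvu k) (hw k) (hU k) (hW k)
  obtain ⟨v0, w0, v1, h1, h2, h3, h4, h5, h6, h7, h8, h9⟩ := hlim.exists_limits hconn hopp e₀ hL hT hΓD
    (fun k => hw (σ k)) (fun k => hW (σ k)) (fun k => hCW (σ k)) (fun k => hUW (σ k)) hZw
  exact ⟨σ, hσ, v0, w0, v1, h1, h2, h3, h4, h5, h6, h7, fun hD => h8 fun k => hD (σ k),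
    fun a z ha hz => h9 (fun k => a (σ k)) z (fun k => ha (σ k)) hz⟩
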